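/- **Setting.** Fix real constants $\bar\rho,\alpha,t_{\rm i}$ and $\sigma_p>0$; a power spectrum $P_0:[0,\infty)\to\mathbb R$ with $h\mapsto P_0(|h|)$ integrable on $\mathbb R^3$, continuous at $0$ with $P_0(0)=0$; and a free one-particle propagator $G(t,t')=\begin{pmatrix} g_{qq}&g_{qp}\\ g_{pq}&g_{pp}\end{pmatrix}(t,t')\otimes 1_3$ with $g_{qq}(t,t_{\rm i})=1$ for $t\ge t_{\rm i}$ and $g_{qp}(t,t')=0$ for $t\le t'$. Put $g_{rs}=g_{qp}(t_r,t_s)$, $g_s=g_{qp}(t_s,t_{\rm i})$, $\vec K_s=g_s\vec k_s$. All external times satisfy $t_s\ge t_{\rm i}$. *Free functional.* For $\ell$ particles with initial data $x_j=(\vec q_j,\vec p_j)$ and sources $J,K$ (finite sums of point sources in time), $$Z_0[J,K]=\exp\Big(i\sum_j\int J_j(t)\cdot G(t,t_{\rm i})x_j\,dt\Big)\exp\Big(-i\sum_j\iint J_j(t)\cdot G(t,t')K_j(t')\,dt\,dt'\Big).$$ Write $D_j(t)=\frac1i\,\delta/\delta\vec K_{p_j}(t)$ and $D_j=D_j(t_{\rm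 i})$. *Fields.* The density operator $\hat\Phi_\rho(s)=\sum_j\hat\phi_{\rho_j}(s)$, where $\hat\phi_{\rho_j}(s)$ is the translation $J\mapsto J-\delta(\cdot-t_s)(\vec k_s,0)\otimes e_j$; the response field operator $\hat\Phi_B(s)=\sum_j\big(i\vec k_s\cdot D_j(t_s)\big)\hat\phi_{\rho_j}(s)$. *Initial correlations.* With $\vec r=\vec q_i-\vec q_j$, $$C_{\delta_i\delta_j}=\int\!\tfrac{d^3h}{(2\pi)^3}e^{i\vec h\cdot\vec r}P_0(h),\quad \vec C_{\delta_ip_j}=-i\alpha\int\!\tfrac{d^3h}{(2\pi)^3}e^{i\vec h\cdot\vec r}\tfrac{\vec h}{h^2}P_0(h),\quad C_{p_ip_j}=\alpha^2\int\!\tfrac{d^3h}{(2\pi)^3}e^{i\vec h\cdot\vec r}\tfrac{\vec h\otimes\vec h}{h^4}P_0(h).$$ A diagram on $\ell$ particles has lines $C_{\delta_i\delta_j}$ and $\hat C_{p_ip_j}=\exp(-D_i^\top C_{p_ip_j}D_j)-1$ (at most one of each kind per unordered pair) and $\hat C_{\delta_ip_j}=-i\,\vec C_{\delta_ip_j}\cdot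 D_j$ (at most one per ordered pair), such that every particle carries at most one $\delta$-end. $\hat{\mathcal C}^{(\ell)}_{\rm con}$ is $1/\ell!$ times the sum over all connected diagrams of the products of their lines, and its part of order $P_0^N$ is obtained by expanding the exponentials and keeping the terms with exactly $N$ factors $P_0$. *Cumulants.* The order-$P_0^N$ part of $G^{(0,\ell)}_{\Phi_1\cdots\Phi_n}$ is $$\bar\rho^{\,\ell}\int d^{3\ell}q\int d^{3\ell}p\ \prod_j\frac{e^{-p_j^2/2\sigma_p^2}}{(2\pi\sigma_p^2)^{3/2}}\ \big[\hat{\mathcal C}^{(\ell)}_{\rm con}\big]_{P_0^N}\,\hat\Phi_1\cdots\hat\Phi_n\,Z_0[J,K]\Big|_{J=K=0},$$ understood as a tempered distribution in $(\vec k_1,\dots,\vec k_n)$: integrate against a Schwartz function of the wave vectors, insert the convergence factor $e^{-\varepsilon\sum_j|\vec q_j|^2}$, and let $\varepsilon\downarrow0$. **Statement.** In each case below, for every Schwartz function and $\varepsilon>0$ the integrals converge absolutely, the limit exists, and it has the stated value. 1. At order $P_0^2$, $G^{(0,3)}_{\rho\rho\rho}(1,2,3)=\bar\rho^3(2\pi)^3\delta_D(\vec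 k_1+\vec k_2+\vec k_3)\,\mathcal T^{(3,2)}_{1|1|1}(1;2;3)$, where $$\mathcal T^{(3,2)}_{1|1|1}(1;2;3)=e^{-\frac{\sigma_p^2}2(\vec K_1^2+\vec K_2^2+\vec K_3^2)}\Big\{P_0(k_1)P_0(k_2)(1+\alpha g_1)(1+\alpha g_2)\Big[\alpha^2\tfrac{\vec K_3\cdot\vec k_1}{k_1^2}\tfrac{\vec K_3\cdot\vec k_2}{k_2^2}-\alpha\,\vec K_3\cdot\Big(\tfrac{\vec k_1}{k_1^2}+\tfrac{\vec k_2}{k_2^2}\Big)\Big]+\text{cyc. perm.}\Big\}.$$ 2. Every other 3-particle 3-point cumulant (at least one of the three fields is $B$) vanishes at every order $P_0^N$. 3. At order $P_0^2$, $G^{(0,3)}_{\rho_1\rho_2\rho_3\rho_4}=\bar\rho^3(2\pi)^3\delta_D(\sum_j\vec k_j)\big[\mathcal T(1;2;3,4)+\mathcal T(1;3;2,4)+\mathcal T(1;4;2,3)+\mathcal T(2;3;1,4)+\mathcal T(2;4;1,3)+\mathcal T(3;4;1,2)\big]$, where $\mathcal T=\mathcal T^{(3,2)}_{1|1|2}$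 is, with $\vec k_{34}=\vec k_3+\vec k_4$ and $\vec K_{34}=\vec K_3+\vec K_4$, $$\mathcal T(1;2;3,4)=e^{-\frac{\sigma_p^2}2(\vec K_1^2+\vec K_2^2+\vec K_{34}^2)}\Big\{P_0(k_1)P_0(k_2)(1+\alpha g_1)(1+\alpha g_2)\Big[\alpha^2\tfrac{\vec K_{34}\cdot\vec k_1}{k_1^2}\tfrac{\vec K_{34}\cdot\vec k_2}{k_2^2}-\alpha\vec K_{34}\cdot\Big(\tfrac{\vec k_1}{k_1^2}+\tfrac{\vec k_2}{k_2^2}\Big)\Big]$$ $$+\Big[P_0(k_1)(1+\alpha g_1)P_0(k_{34})\Big(1+\alpha\tfrac{\vec K_{34}\cdot\vec k_{34}}{k_{34}^2}\Big)\Big(\alpha^2\tfrac{\vec K_2\cdot\vec k_1}{k_1^2}\tfrac{\vec K_2\cdot\vec k_{34}}{k_{34}^2}-\alpha\tfrac{\vec K_2\cdot\vec k_1}{k_1^2}-\alpha\tfrac{\vec K_2\cdot\vec k_{34}}{k_{34}^2}\Big)+(1\leftrightarrow2)\Big]\Big\}.$$ 4. At order $P_0^2$, $$G^{(0,3)}_{\rho_1\rho_2\rho_3B_4}=i\bar\rho^3(2\pi)^3\delta_D\Big(\sum_j\vec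 k_j\Big)\big[\vec k_4\cdot\vec k_3\,g_{34}\,\mathcal T(1;2;3,4)+\vec k_4\cdot\vec k_2\,g_{24}\,\mathcal T(1;3;2,4)+\vec k_4\cdot\vec k_1\,g_{14}\,\mathcal T(2;3;1,4)\big].$$ 5. Every 3-particle 4-point cumulant with at least two $B$ fields vanishes at every order $P_0^N$. 6. $P_0^2$ is the lowest order: all 3-particle $n$-point cumulants ($n\ge1$) vanish at orders $P_0^0$ and $P_0^1$. -/

import Mathlib

open MeasureTheory Filter Topology

noncomputable section

namespace KFT

/-- Euclidean three-space. -/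
abbrev E3 : Type := EuclideanSpace ℝ (Fin 3)

/-- The parameters of the theory: mean density `rhobar`, momentum dispersion `sigma`, the constant
`alpha` relating initial momenta to the gradient of the velocity potential, initial time `ti`,
initial power spectrum `P0` (a function of the modulus of the wave vector), and the four scalar
blocks of the propagator of the free single-particle equations of motion,
`G(t,t') = ((gqq, gqp), (gpq, gpp)) ⊗ 1₃`. -/
structure System where
  rhobar : ℝ
  sigma : ℝ
  alpha : ℝ
  ti : ℝ
  P0 : ℝ → ℝ
  gqq : ℝ → ℝ → ℝ
  gqp : ℝ → ℝ → ℝ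
  gpq : ℝ → ℝ → ℝ
  gpp : ℝ → ℝ → ℝ

/-! ### Sources, the free generating functional, functional derivatives -/

/-- Sources for `ℓ` particles: for each particle a finite sum `∑ₜ δ(· - t) v(t)` of point sources
in time with values in one-particle phase space (position part, momentum part). -/
abbrev Sources (ℓ : ℕ) : Type := Fin ℓ → (ℝ →₀ (E3 × E3))

/-- Functionals of the two sources `(J, K)`. -/
abbrev Functional (ℓ : ℕ) : Type := Sources ℓ → Sources ℓ → ℂ

/-- Operators on functionals of the sources. -/
abbrev Op (ℓ : ℕ) : Type := Functional ℓ → Functional ℓ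

/-- The scalar product on one-particle phase space. -/
def dot (u v : E3 × E3) : ℝ := inner ℝ u.1 v.1 + inner ℝ u.2 v.2

/-- The free single-particle propagator `G(t,t')` applied to a phase-space vector. -/
def System.prop (S : System) (t t' : ℝ) (x : E3 × E3) : E3 × E3 :=
  (S.gqq t t' • x.1 + S.gqp t t' • x.2, S.gpq t t' • x.1 + S.gpp t t' • x.2)

/-- The free generating functional of `ℓ` particles starting at positions `q` and momenta `p`:
`exp(i ∫ dt ⟨J(t), G(t,tᵢ) x⟩) · exp(-i ∫∫ dt dt' ⟨J(t), G(t,t') K(t')⟩)`. -/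
def System.Z0 (S : System) {ℓ : ℕ} (q p : Fin ℓ → E3) : Functional ℓ := fun J K =>
  Complex.exp (Complex.I *
      ((∑ j, (J j).sum fun t v => dot v (S.prop t S.ti (q j, p j)) : ℝ) : ℂ)) *
  Complex.exp (-Complex.I *
      ((∑ j, (J j).sum fun t v => (K j).sum fun t' w => dot v (S.prop t t' w) : ℝ) : ℂ))

/-- The functional derivative `(1/i) δ/δK_{p_j}(t)`, component `a`. -/
def dK {ℓ : ℕ} (j : Fin ℓ) (t : ℝ) (a : Fin 3) : Op ℓ := fun Z J K =>
  -Complex.I * deriv (fun η : ℝ =>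
    Z J (K + η • (Pi.single j (Finsupp.single t ((0 : E3), EuclideanSpace.single a (1 : ℝ))) :
      Sources ℓ))) 0

/-! ### Collective fields -/

/-- The two collective fields: density `rho` and response field `B`. -/
inductive FieldType
  | rho
  | B

/-- One-particle density operator `exp(-i k · (1/i) δ/δJ_{q_j}(t))`, which is the translation
`J ↦ J - δ(· - t) (k, 0) ⊗ e_j`. -/
def rhoOp {ℓ : ℕ} (j : Fin ℓ) (k : E3) (t : ℝ) : Op ℓ := fun Z J K =>
  Z (J + Pi.single j (Finsupp.single t (-k, (0 : E3)))) K

/-- One-particle operator of a collective field; for the response field it is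
`(i k · (1/i) δ/δK_{p_j}(t))` applied after the density operator. -/
def fieldOp {ℓ : ℕ} (j : Fin ℓ) (k : E3) (t : ℝ) : FieldType → Op ℓ
  | .rho => rhoOp j k t
  | .B => fun Z => ∑ a : Fin 3, (Complex.I * ((k a : ℝ) : ℂ)) • dK j t a (rhoOp j k t Z)

/-- The collective field operator is the sum of its one-particle contributions. -/
def collOp {ℓ : ℕ} (f : FieldType) (k : E3) (t : ℝ) : Op ℓ := fun Z => ∑ j, fieldOp j k t f Z

/-- The product of the collective field operators at the external labels `(k s, t s)`. -/
def fieldProd {ℓ n : ℕ} (f : Fin n → FieldType) (k : Fin n → E3) (t : Fin n → ℝ) : Op ℓ := fun Z =>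
  (List.ofFn fun s => (collOp (f s) (k s) (t s) : Op ℓ)).foldr (fun O Y => O Y) Z

/-! ### Initial two-particle correlations -/

/-- `∫ d³h/(2π)³ e^{i h·r} w(h) P₀(|h|)`. -/
def System.corr (S : System) (w : E3 → ℝ) (r : E3) : ℂ :=
  (((2 * Real.pi) ^ 3 : ℝ) : ℂ)⁻¹ *
    ∫ h : E3, Complex.exp (Complex.I * ((inner ℝ h r : ℝ) : ℂ)) * ((w h * S.P0 ‖h‖ : ℝ) : ℂ)

/-- Density-density correlation at separation `r`. -/
def System.Cdd (S : System) (r : E3) : ℂ := S.corr (fun _ => 1) r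

/-- Density-momentum correlation at separation `r` (position of the density minus position of the
momentum), component `a`. -/
def System.Cdp (S : System) (r : E3) (a : Fin 3) : ℂ :=
  -Complex.I * (S.alpha : ℂ) * S.corr (fun h => h a / ‖h‖ ^ 2) r

/-- Momentum-momentum correlation at separation `r`, components `a`, `b`. -/
def System.Cpp (S : System) (r : E3) (a b : Fin 3) : ℂ :=
  (S.alpha : ℂ) ^ 2 * S.corr (fun h => h a * h b / ‖h‖ ^ 4) r

/-! ### Diagrams -/

/-- Unordered pairs of distinct particles. -/
abbrev Pair (ℓ : ℕ) : Type := {e : Fin ℓ × Fin ℓ // e.1 < e.2}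

/-- Ordered pairs of distinct particles. -/
abbrev Arrow (ℓ : ℕ) : Type := {e : Fin ℓ × Fin ℓ // e.1 ≠ e.2}

/-- A diagram on `ℓ` particles consists of the set of pairs joined by a `C_{δδ}`-line, the set of
ordered pairs `(i,j)` joined by a `Ĉ_{δ_i p_j}`-line, and the set of pairs joined by a
`Ĉ_{pp}`-line. Since a `Ĉ_{pp}`-line is `exp(-D·C·D) - 1 = ∑_{m ≥ 1} (-D·C·D)^m / m!`, we record
for each pair which power `m ≤ N` is taken, `m = 0` meaning that there is no such line. -/
abbrev Diagram (ℓ N : ℕ) : Type := Finset (Pair ℓ) × Finset (Arrow ℓ) × (Pair ℓ → Fin (N + 1))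

namespace Diagram

variable {ℓ N : ℕ}

/-- Pairs joined by a density-density line. -/
def dd (d : Diagram ℓ N) : Finset (Pair ℓ) := d.1

/-- Ordered pairs `(i,j)` joined by a line from the density of `i` to the momentum of `j`. -/
def dp (d : Diagram ℓ N) : Finset (Arrow ℓ) := d.2.1

/-- Power taken from the momentum-momentum line of a pair. -/
def pp (d : Diagram ℓ N) (e : Pair ℓ) : ℕ := (d.2.2 e : ℕ)

/-- The order of the diagram in the power spectrum. -/
def order (d : Diagram ℓ N) : ℕ := d.dd.card + d.dp.card + ∑ e, d.pp e

/-- Number of solid (density) line ends at particle `i`. -/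
def deltaEnds (d : Diagram ℓ N) (i : Fin ℓ) : ℕ :=
  (d.dd.filter fun e => e.1.1 = i ∨ e.1.2 = i).card + (d.dp.filter fun e => e.1.1 = i).card

/-- The graph on the particles obtained by forgetting the types of the lines. -/
def graph (d : Diagram ℓ N) : SimpleGraph (Fin ℓ) :=
  SimpleGraph.fromRel fun i j =>
    (∃ e ∈ d.dd, e.1 = (i, j)) ∨ (∃ e ∈ d.dp, e.1 = (i, j)) ∨ (∃ e, d.pp e ≠ 0 ∧ e.1 = (i, j))

end Diagram

open Classical in
/-- The connected diagrams on `ℓ` particles of order `N` in the power spectrum in which no two solid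
line ends meet at the same particle. -/
def diagrams (ℓ N : ℕ) : Finset (Diagram ℓ N) :=
  Finset.univ.filter fun d => d.order = N ∧ (∀ i, d.deltaEnds i ≤ 1) ∧ d.graph.Connected

/-- Successive application of a finite family of operators (those used below commute on the
functionals they are applied to, so the order is immaterial). -/
def opProd {ℓ : ℕ} {ι : Type} (s : Finset ι) (O : ι → Op ℓ) : Op ℓ := fun Z =>
  s.toList.foldr (fun e Y => O e Y) Z

/-- Multiplication by the density-density correlation of particles `i` and `j`. -/
def System.ddOp (S : System) {ℓ : ℕ} (q : Fin ℓ → E3) (i j : Fin ℓ) : Op ℓ := fun Z =>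
  S.Cdd (q i - q j) • Z

/-- The operator `-i C_{δ_i p_j} · (1/i) δ/δK_{p_j}(tᵢ)`. -/
def System.dpOp (S : System) {ℓ : ℕ} (q : Fin ℓ → E3) (i j : Fin ℓ) : Op ℓ := fun Z =>
  ∑ a, (-Complex.I * S.Cdp (q i - q j) a) • dK j S.ti a Z

/-- The operator `-((1/i) δ/δK_{p_i}(tᵢ))ᵀ C_{p_i p_j} ((1/i) δ/δK_{p_j}(tᵢ))`. -/
def System.ppOp (S : System) {ℓ : ℕ} (q : Fin ℓ → E3) (i j : Fin ℓ) : Op ℓ := fun Z =>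
  -∑ a, ∑ b, S.Cpp (q i - q j) a b • dK i S.ti a (dK j S.ti b Z)

/-- The operator represented by a diagram. -/
def System.diagramOp (S : System) {ℓ N : ℕ} (q : Fin ℓ → E3) (d : Diagram ℓ N) : Op ℓ := fun Z =>
  opProd d.dd (fun e => S.ddOp q e.1.1 e.1.2) <|
  opProd d.dp (fun e => S.dpOp q e.1.1 e.1.2) <|
  opProd Finset.univ
    (fun e Y => ((d.pp e).factorial : ℂ)⁻¹ • (S.ppOp q e.1.1 e.1.2)^[d.pp e] Y) Z

/-- The part of order `N` in the power spectrum of the connected correlation operator of `ℓ`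
particles (including the factor `1/ℓ!`). -/
def System.conOp (S : System) {ℓ : ℕ} (N : ℕ) (q : Fin ℓ → E3) : Op ℓ := fun Z =>
  (ℓ.factorial : ℂ)⁻¹ • ∑ d ∈ diagrams ℓ N, S.diagramOp q d Z

/-! ### Cumulants -/

/-- Maxwell-Boltzmann distribution of the momenta. -/
def System.maxwell (S : System) {ℓ : ℕ} (p : Fin ℓ → E3) : ℝ :=
  ∏ j, Real.exp (-‖p j‖ ^ 2 / (2 * S.sigma ^ 2)) / √((2 * Real.pi * S.sigma ^ 2) ^ 3)

/-- `Ĉ_con Φ̂(1) ⋯ Φ̂(n) Z₀[J,K]` at `J = K = 0`, at order `N` in the power spectrum, for given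
initial positions and momenta of the `ℓ` particles. -/
def System.integrand (S : System) {ℓ n : ℕ} (N : ℕ) (f : Fin n → FieldType) (t : Fin n → ℝ)
    (q p : Fin ℓ → E3) (k : Fin n → E3) : ℂ :=
  S.conOp N q (fieldProd f k t (S.Z0 q p)) 0 0

/-- The integrand smeared with a test function `φ` of the external wave vectors and with a Gaussian
convergence factor for the integration over initial positions. -/
def System.smeared (S : System) {ℓ n : ℕ} (N : ℕ) (f : Fin n → FieldType) (t : Fin n → ℝ)
    (φ : SchwartzMap (Fin n → E3) ℂ) (ε : ℝ)
    (x : (Fin ℓ → E3) × (Fin ℓ → E3) × (Fin n → E3)) : ℂ :=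
  ((Real.exp (-ε * ∑ j, ‖x.1 j‖ ^ 2) * S.maxwell x.2.1 : ℝ) : ℂ) * φ x.2.2 *
    S.integrand N f t x.1 x.2.1 x.2.2

/-- The point `(k₁, …, kₙ, -(k₁ + ⋯ + kₙ))` of the hyperplane `∑ k = 0`. -/
def closeUp {n : ℕ} (k : Fin n → E3) : Fin (n + 1) → E3 :=
  Fin.snoc (α := fun _ => E3) k (-∑ i, k i)

/-- The part of order `N` in the power spectrum of the free `ℓ`-particle cumulant
`G^{(0,ℓ)}_{Φ₁ ⋯ Φₙ₊₁}` with field types `f` at times `t` exists and equals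
`ρ̄^ℓ (2π)³ δ_D(k₁ + ⋯ + kₙ₊₁) T(k₁, …, kₙ₊₁)` as a tempered distribution in the wave vectors. -/
def System.CumulantEq (S : System) (ℓ N : ℕ) {n : ℕ} (f : Fin (n + 1) → FieldType)
    (t : Fin (n + 1) → ℝ) (T : (Fin (n + 1) → E3) → ℂ) : Prop :=
  ∀ φ : SchwartzMap (Fin (n + 1) → E3) ℂ,
    (∀ ε : ℝ, 0 < ε → Integrable (S.smeared (ℓ := ℓ) N f t φ ε)) ∧
    Integrable (fun k : Fin n → E3 => φ (closeUp k) * T (closeUp k)) ∧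
    Tendsto (fun ε : ℝ => (S.rhobar : ℂ) ^ ℓ * ∫ x, S.smeared (ℓ := ℓ) N f t φ ε x) (𝓝[>] 0)
      (𝓝 ((S.rhobar : ℂ) ^ ℓ * (2 * Real.pi : ℂ) ^ 3 *
        ∫ k : Fin n → E3, φ (closeUp k) * T (closeUp k)))

/-! ### The explicit functions -/

/-- `g_s = g_qp(t_s, tᵢ)`. -/
def System.g (S : System) {n : ℕ} (t : Fin n → ℝ) (s : Fin n) : ℝ := S.gqp (t s) S.ti

/-- `K_s = g_s k_s`. -/
def System.Kv (S : System) {n : ℕ} (t : Fin n → ℝ) (k : Fin n → E3) (s : Fin n) : E3 :=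
  S.g t s • k s

/-- The contribution to `T_{1|1|1}` with label `c` singled out. -/
def System.T111term (S : System) (t : Fin 3 → ℝ) (k : Fin 3 → E3) (a b c : Fin 3) : ℝ :=
  S.P0 ‖k a‖ * S.P0 ‖k b‖ * (1 + S.alpha * S.g t a) * (1 + S.alpha * S.g t b) *
    (S.alpha ^ 2 * (inner ℝ (S.Kv t k c) (k a) / ‖k a‖ ^ 2) *
        (inner ℝ (S.Kv t k c) (k b) / ‖k b‖ ^ 2)
      - S.alpha * (inner ℝ (S.Kv t k c) (k a) / ‖k a‖ ^ 2
        + inner ℝ (S.Kv t k c) (k b) / ‖k b‖ ^ 2))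

/-- `T^{(3,2)}_{1|1|1}(1;2;3)`. -/
def System.T111 (S : System) (t : Fin 3 → ℝ) (k : Fin 3 → E3) : ℝ :=
  Real.exp (-(S.sigma ^ 2 / 2) *
      (‖S.Kv t k 0‖ ^ 2 + ‖S.Kv t k 1‖ ^ 2 + ‖S.Kv t k 2‖ ^ 2)) *
    (S.T111term t k 0 1 2 + S.T111term t k 1 2 0 + S.T111term t k 2 0 1)

/-- The contribution to `T_{1|1|2}(a;b;c,d)` with label `b` singled out. -/
def System.T112term (S : System) (t : Fin 4 → ℝ) (k : Fin 4 → E3) (a b c d : Fin 4) : ℝ :=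
  S.P0 ‖k a‖ * (1 + S.alpha * S.g t a) * S.P0 ‖k c + k d‖ *
    (1 + S.alpha * (inner ℝ (S.Kv t k c + S.Kv t k d) (k c + k d) / ‖k c + k d‖ ^ 2)) *
    (S.alpha ^ 2 * (inner ℝ (S.Kv t k b) (k a) / ‖k a‖ ^ 2) *
        (inner ℝ (S.Kv t k b) (k c + k d) / ‖k c + k d‖ ^ 2)
      - S.alpha * (inner ℝ (S.Kv t k b) (k a) / ‖k a‖ ^ 2)
      - S.alpha * (inner ℝ (S.Kv t k b) (k c + k d) / ‖k c + k d‖ ^ 2))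

/-- `T^{(3,2)}_{1|1|2}(a;b;c,d)`. -/
def System.T112 (S : System) (t : Fin 4 → ℝ) (k : Fin 4 → E3) (a b c d : Fin 4) : ℝ :=
  (S.P0 ‖k a‖ * S.P0 ‖k b‖ * (1 + S.alpha * S.g t a) * (1 + S.alpha * S.g t b) *
      (S.alpha ^ 2 * (inner ℝ (S.Kv t k c + S.Kv t k d) (k a) / ‖k a‖ ^ 2) *
          (inner ℝ (S.Kv t k c + S.Kv t k d) (k b) / ‖k b‖ ^ 2)
        - S.alpha * (inner ℝ (S.Kv t k c + S.Kv t k d) (k a) / ‖k a‖ ^ 2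
          + inner ℝ (S.Kv t k c + S.Kv t k d) (k b) / ‖k b‖ ^ 2))
    + (S.T112term t k a b c d + S.T112term t k b a c d)) *
  Real.exp (-(S.sigma ^ 2 / 2) *
    (‖S.Kv t k a‖ ^ 2 + ‖S.Kv t k b‖ ^ 2 + ‖S.Kv t k c + S.Kv t k d‖ ^ 2))

end KFT

end

/-! Everything is exponential in the sources, so every operator acts on translates of `S.Z0` by
multiplication. After the field operators have acted, the functional is a sum over maps $\sigma$
from fields to particles. At $J=K=0$ the integrand (`System.integrand_eq`) is $1/\ell!$ times a sum
over $\sigma$ and over diagrams: the diagram with $D_j$ replaced by $L_j=\sum_{\sigma r=j}g_rk_r$,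
times the response factors, times a plane wave in positions and momenta. It suffices to find the
limit for each $\sigma$ separately. `System.HasLim` expresses such a limit and is stable under sums
and under multiplication by functions of temperate growth.

Suppose $\sigma$ misses a particle $j$. Then $L_j=0$, so diagrams with a momentum end at $j$ vanish.
In the others, $j$ is a leaf attached by a single line with a density end at $j$. The Gaussian mean
of that line over $q_j$ integrates its Fourier weight against an approximate identity at $h=0$, and
it tends to $0$ because $P_0(0)=0$. For a density-momentum line the weight behaves like $P_0/|h|$,
but it is odd: symmetrising produces a sine that compensates the pole at the price of a factor
$|q|$, where $q$ is the position of the other end. The decay of the Fourier transform of the test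
function in the positions of the occupied particles absorbs this growth. If two particles are empty,
both are leaves at the occupied one and both means fade. See `hasLim_of_fading`,
`hasLim_of_fading_pair` and `hasLim_amp_of_not_surjective`. Hence, at every order, only surjective
$\sigma$ can contribute.

Suppose $\sigma$ is surjective. The test function now controls all positions, and dominated
convergence allows $\varepsilon=0$. A connected second-order diagram on three particles consists of
two lines meeting at a centre $x$, so it is a product of functions of $q_a-q_x$ and $q_b-q_x$.
Fourier inversion sets the wave vectors of the two lines equal to the total wave vectors
$\kappa_a,\kappa_b$ of the leaves and imposes $\kappa_a+\kappa_b+\kappa_x=0$; the momentum integral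
gives the damping factor (`hasLim_planeAvg`). Put $A_y(h)=\alpha L_y\cdot h/h^2$. The four lines
between $x$ and $a$ add up to $P_0(1+A_a)(1-A_x)$, those with a density end at $x$ to $P_0(1+A_a)$.
Removing the pairs with two density ends at $x$ leaves the factor
$(1-A_x(\kappa_a))(1-A_x(\kappa_b))-1$, which is the bracket in the formulas. The $3!$ surjections
that induce the same partition of the fields cancel $1/3!$; there is one partition of three fields
and there are six of four fields.

A response field contributes $i k_s\cdot\sum_r g_{qp}(t_r,t_s)k_r$, summed over the fields on its
particle, and by causality this vanishes unless a later field shares the particle. This decides all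
cumulants with response fields. Fewer than two lines cannot connect three particles, so orders $0$
and $1$ vanish. -/

noncomputable section

namespace KFT

/-! ### The operators acting on exponential functionals -/

section Symbols

variable (S : System) {ℓ : ℕ}

/-- The exponent of the first factor of the free functional. -/
def System.freeAction (q p : Fin ℓ → E3) (J : Sources ℓ) : ℝ :=
  ∑ j, (J j).sum fun t v => dot v (S.prop t S.ti (q j, p j))

/-- The exponent of the second factor of the free functional. -/
def System.pairing (J K : Sources ℓ) : ℝ :=
  ∑ j, (J j).sum fun t v => (K j).sum fun t' w => dot v (S.prop t t' w)

/-- A unit point source for component `a` of the momentum of particle `j` at time `t`. -/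
def unitSource (j : Fin ℓ) (t : ℝ) (a : Fin 3) : Sources ℓ :=
  Pi.single j (Finsupp.single t ((0 : E3), EuclideanSpace.single a (1 : ℝ)))

/-- The source created by the density operator of particle `j`. -/
def rhoSource (j : Fin ℓ) (k : E3) (t : ℝ) : Sources ℓ :=
  Pi.single j (Finsupp.single t (-k, (0 : E3)))

lemma dot_add_left (u v w : E3 × E3) : dot (u + v) w = dot u w + dot v w := by
  simp only [dot, Prod.fst_add, Prod.snd_add, inner_add_left]; ring

lemma dot_add_right (u v w : E3 × E3) : dot u (v + w) = dot u v + dot u w := by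
  simp only [dot, Prod.fst_add, Prod.snd_add, inner_add_right]; ring

lemma dot_smul_right (c : ℝ) (u v : E3 × E3) : dot u (c • v) = c * dot u v := by
  simp only [dot, Prod.smul_fst, Prod.smul_snd, inner_smul_right]; ring

lemma dot_zero_left (w : E3 × E3) : dot 0 w = 0 := by simp [dot]

lemma dot_zero_right (w : E3 × E3) : dot w 0 = 0 := by simp [dot]

lemma System.prop_add (t t' : ℝ) (x y : E3 × E3) :
    S.prop t t' (x + y) = S.prop t t' x + S.prop t t' y := by
  simp only [System.prop, Prod.fst_add, Prod.snd_add, smul_add, Prod.mk_add_mk]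
  congr 1 <;> abel

lemma System.prop_smul (t t' c : ℝ) (x : E3 × E3) :
    S.prop t t' (c • x) = c • S.prop t t' x := by
  simp only [System.prop, Prod.smul_fst, Prod.smul_snd, Prod.smul_mk, smul_add,
    smul_comm c]

lemma System.prop_zero (t t' : ℝ) : S.prop t t' 0 = 0 := by
  simp [System.prop]

lemma System.freeAction_add (q p : Fin ℓ → E3) (J J' : Sources ℓ) :
    S.freeAction q p (J + J') = S.freeAction q p J + S.freeAction q p J' := by
  simp only [System.freeAction, Pi.add_apply, ← Finset.sum_add_distrib]
  refine Finset.sum_congr rfl fun j _ => ?_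
  exact Finsupp.sum_add_index' (fun t => dot_zero_left _) (fun t u v => dot_add_left u v _)

lemma System.pairing_add_left (J J' K : Sources ℓ) :
    S.pairing (J + J') K = S.pairing J K + S.pairing J' K := by
  simp only [System.pairing, Pi.add_apply, ← Finset.sum_add_distrib]
  refine Finset.sum_congr rfl fun j _ => ?_
  refine Finsupp.sum_add_index' (fun t => ?_) (fun t v w => ?_)
  · simp [dot_zero_left]
  · simp only [dot_add_left, Finsupp.sum_add]

lemma System.pairing_add_right (J K K' : Sources ℓ) :
    S.pairing J (K + K') = S.pairing J K + S.pairing J K' := by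
  simp only [System.pairing, Pi.add_apply, ← Finset.sum_add_distrib]
  refine Finset.sum_congr rfl fun j _ => ?_
  rw [← Finsupp.sum_add]
  refine Finsupp.sum_congr fun t _ => ?_
  refine Finsupp.sum_add_index' (fun t => ?_) (fun t v w => ?_)
  · simp [System.prop_zero, dot_zero_right]
  · rw [System.prop_add, dot_add_right]

lemma System.pairing_smul_right (c : ℝ) (J K : Sources ℓ) :
    S.pairing J (c • K) = c * S.pairing J K := by
  simp only [System.pairing, Pi.smul_apply, Finset.mul_sum]
  refine Finset.sum_congr rfl fun j _ => ?_
  rw [Finsupp.sum, Finsupp.sum, Finset.mul_sum]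
  refine Finset.sum_congr rfl fun t _ => ?_
  rw [Finsupp.sum_smul_index' (fun t => by simp [System.prop_zero, dot_zero_right]),
    Finsupp.sum, Finsupp.sum, Finset.mul_sum]
  refine Finset.sum_congr rfl fun t' _ => ?_
  rw [System.prop_smul, dot_smul_right]

lemma System.pairing_zero_right (J : Sources ℓ) : S.pairing J 0 = 0 := by
  simp [System.pairing]

lemma System.freeAction_sum {ι : Type} (s : Finset ι) (q p : Fin ℓ → E3) (J : ι → Sources ℓ) :
    S.freeAction q p (∑ i ∈ s, J i) = ∑ i ∈ s, S.freeAction q p (J i) :=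
  map_sum (AddMonoidHom.mk' (S.freeAction q p) (S.freeAction_add q p)) J s

lemma System.pairing_sum_left {ι : Type} (s : Finset ι) (J : ι → Sources ℓ) (K : Sources ℓ) :
    S.pairing (∑ i ∈ s, J i) K = ∑ i ∈ s, S.pairing (J i) K :=
  map_sum (AddMonoidHom.mk' (S.pairing · K) (fun J J' => S.pairing_add_left J J' K)) J s

lemma System.freeAction_rhoSource (q p : Fin ℓ → E3) (j : Fin ℓ) (k : E3) (t : ℝ) :
    S.freeAction q p (rhoSource j k t)
      = -inner ℝ k (S.gqq t S.ti • q j + S.gqp t S.ti • p j) := by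
  rw [System.freeAction, Finset.sum_eq_single j]
  · rw [rhoSource, Pi.single_eq_same, Finsupp.sum_single_index (by simp [dot_zero_left])]
    simp [dot, System.prop]
  · intro b _ hb
    simp [rhoSource, Pi.single_eq_of_ne hb]
  · simp

lemma System.pairing_rhoSource_unitSource (j j' : Fin ℓ) (k : E3) (t t' : ℝ) (a : Fin 3) :
    S.pairing (rhoSource j k t) (unitSource j' t' a)
      = if j = j' then -(S.gqp t t' * k a) else 0 := by
  rw [System.pairing, Finset.sum_eq_single j]
  · rw [rhoSource, Pi.single_eq_same, Finsupp.sum_single_index (by simp [dot_zero_left])]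
    split_ifs with h
    · subst h
      rw [unitSource, Pi.single_eq_same,
        Finsupp.sum_single_index (by simp [dot, System.prop])]
      have : inner ℝ k (EuclideanSpace.single a (1 : ℝ)) = k a := by
        rw [EuclideanSpace.inner_single_right]; simp
      simp [dot, System.prop, inner_smul_right, this]
    · rw [unitSource, Pi.single_eq_of_ne h]
      simp
  · intro b _ hb
    simp [rhoSource, Pi.single_eq_of_ne hb]
  · simp

lemma System.Z0_eq (q p : Fin ℓ → E3) (J K : Sources ℓ) :
    S.Z0 q p J K = Complex.exp (Complex.I * (S.freeAction q p J : ℂ)) *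
      Complex.exp (-Complex.I * (S.pairing J K : ℂ)) := rfl

/-- Finite sums of translates of the free functional, with coefficients depending on `J`. -/
def System.waves {ι : Type} [Fintype ι] (q p : Fin ℓ → E3) (T : ι → Sources ℓ)
    (c : ι → Sources ℓ → ℂ) : Functional ℓ :=
  fun J K => ∑ i, c i J * S.Z0 q p (J + T i) K

/-- The exponent of `S.Z0` is affine in `K`, so the derivative multiplies each translate by the
slope of its exponent; the two factors $-i$ combine to $-1$. -/
lemma System.dK_waves {ι : Type} [Fintype ι] (q p : Fin ℓ → E3) (T : ι → Sources ℓ)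
    (c : ι → Sources ℓ → ℂ) (j : Fin ℓ) (t : ℝ) (a : Fin 3) :
    dK j t a (S.waves q p T c)
      = S.waves q p T (fun i J => (-S.pairing (J + T i) (unitSource j t a) : ℝ) * c i J) := by
  funext J K
  have hd : ∀ i, HasDerivAt
      (fun η : ℝ => c i J * S.Z0 q p (J + T i) (K + η • unitSource j t a))
      (c i J * (Complex.exp (Complex.I * (S.freeAction q p (J + T i) : ℂ)) *
        (Complex.exp (-Complex.I * (S.pairing (J + T i) K : ℂ)) *
          (-Complex.I * (S.pairing (J + T i) (unitSource j t a) : ℂ))))) 0 := by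
    intro i
    have h0 : HasDerivAt (fun η : ℝ =>
        -Complex.I * ((S.pairing (J + T i) K
          + η * S.pairing (J + T i) (unitSource j t a) : ℝ) : ℂ))
        (-Complex.I * (S.pairing (J + T i) (unitSource j t a) : ℂ)) 0 := by
      refine HasDerivAt.const_mul _ (HasDerivAt.ofReal_comp ?_)
      simpa using ((hasDerivAt_id (0 : ℝ)).mul_const
        (S.pairing (J + T i) (unitSource j t a))).const_add (S.pairing (J + T i) K)
    have h1 := ((h0.cexp).const_mul
      (Complex.exp (Complex.I * (S.freeAction q p (J + T i) : ℂ)))).const_mul (c i J)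
    simp only [System.Z0_eq, System.pairing_add_right, System.pairing_smul_right]
    simpa using h1
  have hs := HasDerivAt.fun_sum (u := Finset.univ) (fun i _ => hd i)
  change -Complex.I * deriv (fun η : ℝ =>
    ∑ i, c i J * S.Z0 q p (J + T i) (K + η • unitSource j t a)) 0 = _
  rw [hs.deriv, System.waves, Finset.mul_sum]
  refine Finset.sum_congr rfl fun i _ => ?_
  rw [System.Z0_eq]
  push_cast
  linear_combination (c i J * Complex.exp (Complex.I * (S.freeAction q p (J + T i) : ℂ)) *
    Complex.exp (-Complex.I * (S.pairing (J + T i) K : ℂ)) *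
    (S.pairing (J + T i) (unitSource j t a) : ℂ)) * Complex.I_mul_I

/-- `O` acts on the given family of exponential functionals as multiplication by `s`. -/
def System.ActsAs {ι : Type} [Fintype ι] (q p : Fin ℓ → E3) (T : ι → Sources ℓ) (O : Op ℓ)
    (s : ι → Sources ℓ → ℂ) : Prop :=
  ∀ c, O (S.waves q p T c) = S.waves q p T (s * c)

variable {ι : Type} [Fintype ι] {q p : Fin ℓ → E3} {T : ι → Sources ℓ}

lemma System.waves_smul (x : ℂ) (c : ι → Sources ℓ → ℂ) :
    x • S.waves q p T c = S.waves q p T (x • c) := by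
  funext J K
  simp [System.waves, Finset.mul_sum, mul_assoc]

lemma System.waves_neg (c : ι → Sources ℓ → ℂ) :
    -S.waves q p T c = S.waves q p T (-c) := by
  funext J K
  simp [System.waves]

lemma System.waves_sum {κ : Type} (u : Finset κ) (c : κ → ι → Sources ℓ → ℂ) :
    ∑ x ∈ u, S.waves q p T (c x) = S.waves q p T (∑ x ∈ u, c x) := by
  funext J K
  simp only [System.waves, Finset.sum_apply, Finset.sum_mul]
  rw [Finset.sum_comm]

variable {S}

lemma System.ActsAs.dK (j : Fin ℓ) (t : ℝ) (a : Fin 3) :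
    S.ActsAs q p T (dK j t a)
      (fun i J => ((-S.pairing (J + T i) (unitSource j t a) : ℝ) : ℂ)) :=
  fun c => S.dK_waves q p T c j t a

lemma System.ActsAs.foldr {κ : Type} {O : κ → Op ℓ} {s : κ → ι → Sources ℓ → ℂ}
    (h : ∀ x, S.ActsAs q p T (O x) (s x)) (l : List κ) :
    S.ActsAs q p T (fun Z => l.foldr (fun e Y => O e Y) Z) ((l.map s).prod) := by
  intro c
  induction l with
  | nil => simp
  | cons x l ih =>
    simp only [List.foldr_cons, List.map_cons, List.prod_cons] at ih ⊢
    rw [ih, h x, mul_assoc]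

lemma System.ActsAs.opProd {κ : Type} {O : κ → Op ℓ} {s : κ → ι → Sources ℓ → ℂ}
    (h : ∀ x, S.ActsAs q p T (O x) (s x)) (u : Finset κ) :
    S.ActsAs q p T (opProd u O) (∏ x ∈ u, s x) := by
  have := System.ActsAs.foldr h u.toList
  rwa [Finset.prod_map_toList] at this

lemma System.ActsAs.iterate {O : Op ℓ} {s : ι → Sources ℓ → ℂ}
    (h : S.ActsAs q p T O s) (m : ℕ) : S.ActsAs q p T (O^[m]) (s ^ m) := by
  intro c
  induction m with
  | zero => simp
  | succ m ih => rw [Function.iterate_succ_apply', ih, h, pow_succ', mul_assoc]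

variable (S)

/-- The line joining the density of `i` to the momentum of `j`, the derivatives being replaced by
the vectors `L`. -/
def System.dpLine (q L : Fin ℓ → E3) (i j : Fin ℓ) : ℂ :=
  ∑ a, (-Complex.I * S.Cdp (q i - q j) a) * ((L j a : ℝ) : ℂ)

/-- The exponent of a momentum-momentum line, the derivatives being replaced by the vectors `L`. -/
def System.ppLine (q L : Fin ℓ → E3) (i j : Fin ℓ) : ℂ :=
  -∑ a, ∑ b, S.Cpp (q i - q j) a b * (((L i a : ℝ) : ℂ) * ((L j b : ℝ) : ℂ))

/-- The value of a diagram, the derivatives being replaced by the vectors `L`. -/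
def System.amp {N : ℕ} (d : Diagram ℓ N) (q L : Fin ℓ → E3) : ℂ :=
  (∏ e ∈ d.dd, S.Cdd (q e.1.1 - q e.1.2)) *
    ((∏ e ∈ d.dp, S.dpLine q L e.1.1 e.1.2) *
      ∏ e, (((d.pp e).factorial : ℂ)⁻¹ * S.ppLine q L e.1.1 e.1.2 ^ d.pp e))

/-- The values of the momentum derivatives at time `t'` on the exponential functional with source
`J`. -/
def System.symVec (J : Sources ℓ) (t' : ℝ) (j : Fin ℓ) : E3 :=
  WithLp.toLp 2 fun a => -S.pairing J (unitSource j t' a)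

lemma System.symVec_apply (J : Sources ℓ) (t' : ℝ) (j : Fin ℓ) (a : Fin 3) :
    S.symVec J t' j a = -S.pairing J (unitSource j t' a) := rfl

lemma System.actsAs_dpOp (q' : Fin ℓ → E3) (i j : Fin ℓ) :
    S.ActsAs q p T (S.dpOp q' i j)
      (fun x J => S.dpLine q' (S.symVec (J + T x) S.ti) i j) := by
  intro c
  simp only [System.dpOp, (System.ActsAs.dK _ _ _ : S.ActsAs q p T _ _) c, System.waves_smul,
    System.waves_sum]
  congr 1
  funext x J
  simp [System.dpLine, System.symVec_apply, Finset.sum_mul, mul_assoc]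

lemma System.actsAs_ppOp (q' : Fin ℓ → E3) (i j : Fin ℓ) :
    S.ActsAs q p T (S.ppOp q' i j)
      (fun x J => S.ppLine q' (S.symVec (J + T x) S.ti) i j) := by
  intro c
  have h : ∀ (j : Fin ℓ) (t : ℝ) (a : Fin 3) (c), KFT.dK j t a (S.waves q p T c) = _ :=
    fun j t a c => (System.ActsAs.dK j t a : S.ActsAs q p T _ _) c
  simp only [System.ppOp, h, System.waves_smul, System.waves_sum, System.waves_neg]
  congr 1
  funext x J
  simp [System.ppLine, System.symVec_apply, Finset.sum_mul, mul_assoc]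

lemma System.actsAs_diagramOp {N : ℕ} (q' : Fin ℓ → E3) (d : Diagram ℓ N) :
    S.ActsAs q p T (S.diagramOp q' d)
      (fun x J => S.amp d q' (S.symVec (J + T x) S.ti)) := by
  intro c
  have h1 : ∀ e : Pair ℓ, S.ActsAs q p T
      (fun Y => ((d.pp e).factorial : ℂ)⁻¹ • (S.ppOp q' e.1.1 e.1.2)^[d.pp e] Y)
      (fun x J => ((d.pp e).factorial : ℂ)⁻¹ *
        S.ppLine q' (S.symVec (J + T x) S.ti) e.1.1 e.1.2 ^ d.pp e) := by
    intro e c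
    simp only [(S.actsAs_ppOp q' e.1.1 e.1.2).iterate (d.pp e) c, System.waves_smul]
    congr 1
    funext x J
    simp [mul_assoc]
  have h2 : ∀ e : Pair ℓ, S.ActsAs q p T (S.ddOp q' e.1.1 e.1.2)
      (fun x J => S.Cdd (q' e.1.1 - q' e.1.2)) := by
    intro e c
    simp only [System.ddOp, System.waves_smul]
    rfl
  simp only [System.diagramOp]
  rw [System.ActsAs.opProd h1, System.ActsAs.opProd (fun e : Arrow ℓ =>
    S.actsAs_dpOp q' e.1.1 e.1.2), System.ActsAs.opProd h2]
  congr 1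
  funext x J
  simp [System.amp, mul_assoc, Finset.prod_apply]

lemma System.conOp_waves {N : ℕ} (q' : Fin ℓ → E3) (c : ι → Sources ℓ → ℂ) :
    S.conOp N q' (S.waves q p T c) = S.waves q p T (fun x J => (ℓ.factorial : ℂ)⁻¹ *
      ∑ d ∈ diagrams ℓ N, S.amp d q' (S.symVec (J + T x) S.ti) * c x J) := by
  simp only [System.conOp]
  rw [Finset.sum_congr rfl fun d _ => S.actsAs_diagramOp q' d c, System.waves_sum,
    System.waves_smul]
  congr 1
  funext x J
  simp [Finset.sum_apply]

/-! ### The collective fields -/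

/-- The source created by density operators of the particles `σ s`. -/
def fieldSource {n : ℕ} (k : Fin n → E3) (t : Fin n → ℝ) (σ : Fin n → Fin ℓ) : Sources ℓ :=
  ∑ s, rhoSource (σ s) (k s) (t s)

/-- The factor contributed by one collective field. -/
def System.oneResp (f : FieldType) (k L : E3) : ℂ :=
  match f with
  | .rho => 1
  | .B => Complex.I * ((inner ℝ k L : ℝ) : ℂ)

lemma System.fieldOp_waves (j : Fin ℓ) (k : E3) (t : ℝ) (f : FieldType)
    (c : ι → Sources ℓ → ℂ) :
    fieldOp j k t f (S.waves q p T c)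
      = S.waves q p (fun i => rhoSource j k t + T i) (fun i J =>
        System.oneResp f k (S.symVec (J + (rhoSource j k t + T i)) t j) *
          c i (J + rhoSource j k t)) := by
  have hrho : rhoOp j k t (S.waves q p T c)
      = S.waves q p (fun i => rhoSource j k t + T i) (fun i J => c i (J + rhoSource j k t)) := by
    funext J K
    simp [rhoOp, System.waves, rhoSource, add_assoc]
  cases f with
  | rho => simpa [fieldOp, System.oneResp] using hrho
  | B =>
    simp only [fieldOp, hrho, (System.ActsAs.dK _ _ _ : S.ActsAs q p _ _ _) _, System.waves_smul,
      System.waves_sum]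
    congr 1
    funext x J
    have : ((inner ℝ k (S.symVec (J + (rhoSource j k t + T x)) t j) : ℝ) : ℂ)
        = ∑ a, ((k a : ℝ) : ℂ) *
          ((S.symVec (J + (rhoSource j k t + T x)) t j a : ℝ) : ℂ) := by
      rw [PiLp.inner_apply]
      push_cast
      refine Finset.sum_congr rfl fun a _ => ?_
      simp [mul_comm]
    simp only [System.oneResp, this, System.symVec_apply]
    simp [Finset.sum_mul, Finset.mul_sum, mul_assoc]

/-- Expanding the product of sums over particles gives the sum over all maps `σ`. A density operator
also translates `J` inside the coefficients already produced, so every response factor is evaluated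
at the total source of all fields and not only of those applied before it. -/
lemma System.fieldProd_Z0 {n : ℕ} (f : Fin n → FieldType) (k : Fin n → E3) (t : Fin n → ℝ)
    (q p : Fin ℓ → E3) :
    fieldProd f k t (S.Z0 q p) = S.waves q p (fieldSource k t) (fun σ J =>
      ∏ s, System.oneResp (f s) (k s) (S.symVec (J + fieldSource k t σ) (t s) (σ s))) := by
  induction n with
  | zero =>
    funext J K
    simp [fieldProd, System.waves, fieldSource]
  | succ n ih =>
    have h1 : fieldProd f k t (S.Z0 q p) = collOp (f 0) (k 0) (t 0)
        (fieldProd (fun s => f s.succ) (fun s => k s.succ) (fun s => t s.succ) (S.Z0 q p)) := by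
      simp [fieldProd, List.ofFn_succ]
    rw [h1, ih]
    simp only [collOp, System.fieldOp_waves]
    funext J K
    simp only [Finset.sum_apply, System.waves]
    rw [← (Fin.consEquiv (fun _ => Fin ℓ)).sum_comp, Fintype.sum_prod_type]
    refine Finset.sum_congr rfl fun j _ => Finset.sum_congr rfl fun σ _ => ?_
    have hs : fieldSource k t ((Fin.consEquiv (fun _ => Fin ℓ)) (j, σ))
        = rhoSource j (k 0) (t 0) + fieldSource (fun s => k s.succ) (fun s => t s.succ) σ := by
      simp [fieldSource, Fin.sum_univ_succ, Fin.consEquiv]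
    rw [hs, Fin.prod_univ_succ]
    simp [Fin.consEquiv, add_assoc]

/-- The vectors `∑_{r : σ r = j} g_qp(t_r, t') k_r`. -/
def System.momVec {n : ℕ} (t : Fin n → ℝ) (σ : Fin n → Fin ℓ) (k : Fin n → E3) (t' : ℝ)
    (j : Fin ℓ) : E3 :=
  ∑ r, if σ r = j then S.gqp (t r) t' • k r else 0

/-- The factor contributed by the response fields when field `s` acts on particle `σ s`. -/
def System.resp {n : ℕ} (f : Fin n → FieldType) (t : Fin n → ℝ) (σ : Fin n → Fin ℓ)
    (k : Fin n → E3) : ℂ :=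
  ∏ s, System.oneResp (f s) (k s) (S.momVec t σ k (t s) (σ s))

/-- The plane wave `exp(-i ∑_s k_s · (q_{σ s} + g_s p_{σ s}))`. -/
def System.phase {n : ℕ} (t : Fin n → ℝ) (σ : Fin n → Fin ℓ) (q p : Fin ℓ → E3)
    (k : Fin n → E3) : ℂ :=
  Complex.exp (-Complex.I * ((∑ s, inner ℝ (k s) (q (σ s) + S.g t s • p (σ s)) : ℝ) : ℂ))

/-- The minus sign of the density source cancels the one produced by the derivative, so the
derivatives take the values $+\sum_r g_{qp}(t_r,t')k_r$. -/
lemma System.symVec_fieldSource {n : ℕ} (t : Fin n → ℝ) (σ : Fin n → Fin ℓ) (k : Fin n → E3)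
    (t' : ℝ) (j : Fin ℓ) : S.symVec (fieldSource k t σ) t' j = S.momVec t σ k t' j := by
  ext a
  rw [System.symVec_apply, fieldSource, System.pairing_sum_left, System.momVec,
    WithLp.ofLp_sum, Finset.sum_apply, ← Finset.sum_neg_distrib]
  refine Finset.sum_congr rfl fun r _ => ?_
  rw [System.pairing_rhoSource_unitSource]
  split_ifs <;> simp

/-- This removes all functionals and operators: what remains is an explicit function of positions,
momenta and wave vectors. The condition on `gqq` makes the positions enter the phase with
coefficient one. -/
theorem System.integrand_eq {n : ℕ} (hgqq : ∀ t, S.ti ≤ t → S.gqq t S.ti = 1) (N : ℕ)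
    (f : Fin n → FieldType) (t : Fin n → ℝ) (ht : ∀ s, S.ti ≤ t s) (q p : Fin ℓ → E3)
    (k : Fin n → E3) :
    S.integrand N f t q p k = (ℓ.factorial : ℂ)⁻¹ * ∑ σ : Fin n → Fin ℓ,
      ∑ d ∈ diagrams ℓ N,
        S.amp d q (S.momVec t σ k S.ti) * S.resp f t σ k * S.phase t σ q p k := by
  rw [System.integrand, System.fieldProd_Z0, System.conOp_waves, System.waves, Finset.mul_sum]
  refine Finset.sum_congr rfl fun σ _ => ?_
  have h1 : S.Z0 q p (0 + fieldSource k t σ) 0 = S.phase t σ q p k := by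
    rw [zero_add, System.Z0_eq, System.pairing_zero_right, fieldSource, System.freeAction_sum,
      System.phase]
    simp only [System.freeAction_rhoSource, hgqq _ (ht _), one_smul]
    simp [System.g]
  rw [h1, mul_assoc, Finset.sum_mul]
  congr 1
  refine Finset.sum_congr rfl fun d _ => ?_
  have h2 : S.symVec (fieldSource k t σ) S.ti = S.momVec t σ k S.ti :=
    funext fun j => S.symVec_fieldSource t σ k S.ti j
  simp only [zero_add, h2, S.symVec_fieldSource, System.resp]

end Symbols

/-! ### Fourier transforms of test functions -/

section Analysis

open scoped FourierTransform SchwartzMap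

/-- The Fourier transform `∫ dk φ(k) exp(-i ∑_s k_s · x_s)`. -/
def fourierPi {N : ℕ} (φ : 𝓢(Fin N → E3, ℂ)) (x : Fin N → E3) : ℂ :=
  ∫ k : Fin N → E3, φ k * Complex.exp (-Complex.I * ((∑ s, inner ℝ (k s) (x s) : ℝ) : ℂ))

lemma schwartz_decay {V : Type*} [NormedAddCommGroup V] [NormedSpace ℝ V] (φ : 𝓢(V, ℂ)) (M : ℕ) :
    ∃ C, 0 ≤ C ∧ ∀ x, ‖φ x‖ ≤ C * ((1 + ‖x‖) ^ M)⁻¹ := by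
  refine ⟨2 ^ M * (Finset.Iic (M, 0)).sup (fun m => SchwartzMap.seminorm ℝ m.1 m.2) φ,
    by positivity, fun x => ?_⟩
  have h := SchwartzMap.one_add_le_sup_seminorm_apply (𝕜 := ℝ) (m := (M, 0)) (k := M) (n := 0)
    le_rfl le_rfl φ x
  rw [norm_iteratedFDeriv_zero] at h
  rw [← div_eq_mul_inv, le_div_iff₀ (by positivity), mul_comm]
  exact h

/-- The Fourier transform of a Schwartz function is Schwartz. It is taken on the Euclidean product
`W`, since `Fin N → E3` carries the sup norm; the two Haar measures differ by a constant whose value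
does not matter for decay. -/
lemma fourierPi_decay {N : ℕ} (φ : 𝓢(Fin N → E3, ℂ)) (M : ℕ) :
    ∃ C, 0 ≤ C ∧ ∀ x, ‖fourierPi φ x‖ ≤ C * ((1 + ‖x‖) ^ M)⁻¹ := by
  let W := PiLp 2 (fun _ : Fin N => E3)
  let e : W ≃L[ℝ] (Fin N → E3) := PiLp.continuousLinearEquiv 2 ℝ (fun _ : Fin N => E3)
  let ψ : 𝓢(W, ℂ) := SchwartzMap.compCLMOfContinuousLinearEquiv ℂ e φ
  obtain ⟨C, hC0, hC⟩ := schwartz_decay (𝓕 ψ) M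
  let μ' : Measure (Fin N → E3) := Measure.map e volume
  have : μ'.IsAddHaarMeasure := e.isAddHaarMeasure_map volume
  have hμ : (volume : Measure (Fin N → E3)) = Measure.addHaarScalarFactor volume μ' • μ' :=
    Measure.isAddLeftInvariant_eq_smul _ _
  set c := Measure.addHaarScalarFactor (volume : Measure (Fin N → E3)) μ'
  have hF : ∀ x : Fin N → E3,
      fourierPi φ x = (c : ℝ) • (𝓕 ψ) ((2 * Real.pi)⁻¹ • e.symm x) := by
    intro x
    rw [fourierPi, hμ, integral_smul_nnreal_measure, NNReal.smul_def,
      show μ' = Measure.map e volume from rfl,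
      (show MeasurableEmbedding e from e.toHomeomorph.measurableEmbedding).integral_map,
      SchwartzMap.fourier_coe, Real.fourier_eq']
    congr 1
    refine integral_congr_ae (Eventually.of_forall fun y => ?_)
    simp only [smul_eq_mul]
    rw [mul_comm]
    congr 1
    rw [real_inner_smul_right]
    congr 1
    have : inner ℝ y (e.symm x) = ∑ s, inner ℝ ((e y) s) (x s) := by
      rw [PiLp.inner_apply]; rfl
    rw [this]
    push_cast
    have hpi : (Real.pi : ℂ) ≠ 0 := by exact_mod_cast Real.pi_ne_zero
    field_simp
  refine ⟨c * (C * (2 * Real.pi) ^ M), by positivity, fun x => ?_⟩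
  have hx : ‖x‖ ≤ ‖e.symm x‖ := by
    refine (pi_norm_le_iff_of_nonneg (norm_nonneg _)).2 fun s => ?_
    exact PiLp.norm_apply_le (e.symm x) s
  have h2 : (1 + ‖x‖) ≤ (2 * Real.pi) * (1 + ‖(2 * Real.pi)⁻¹ • e.symm x‖) := by
    rw [norm_smul, Real.norm_of_nonneg (by positivity), mul_add,
      mul_inv_cancel_left₀ (by positivity)]
    have := Real.pi_gt_three
    linarith
  rw [hF, norm_smul, Real.norm_of_nonneg (by positivity), mul_assoc]
  refine mul_le_mul_of_nonneg_left ((hC _).trans ?_) (by positivity)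
  rw [mul_assoc]
  refine mul_le_mul_of_nonneg_left ?_ hC0
  rw [inv_le_iff_one_le_mul₀ (by positivity), mul_assoc, mul_comm, mul_assoc,
    inv_mul_eq_div, one_le_div (by positivity), mul_comm, ← mul_pow]
  exact pow_le_pow_left₀ (by positivity) h2 M

lemma integrable_inv_one_add_norm_pow {V : Type*} [NormedAddCommGroup V] [NormedSpace ℝ V]
    [FiniteDimensional ℝ V] [MeasureSpace V] [BorelSpace V]
    [(volume : Measure V).IsAddHaarMeasure] (M : ℕ) (hM : Module.finrank ℝ V < M) :
    Integrable (fun v : V => ((1 + ‖v‖) ^ M)⁻¹) := by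
  have h := integrable_one_add_norm (E := V) (μ := volume) (r := (M : ℝ)) (by exact_mod_cast hM)
  refine h.congr (Eventually.of_forall fun v => ?_)
  simp only
  rw [Real.rpow_neg (by positivity), Real.rpow_natCast]

instance {N : ℕ} : (volume : Measure (Fin N → E3)).IsAddHaarMeasure :=
  Measure.instIsAddHaarMeasureForallVolumeOfMeasurableAddOfSigmaFinite

lemma schwartz_integrable {N : ℕ} (φ : 𝓢(Fin N → E3, ℂ)) : Integrable φ := φ.integrable

lemma continuous_fourierPi {N : ℕ} (φ : 𝓢(Fin N → E3, ℂ)) : Continuous (fourierPi φ) := by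
  refine continuous_of_dominated (bound := fun k => ‖φ k‖) (fun x => ?_) (fun x => ?_)
    (schwartz_integrable φ).norm ?_
  · exact (φ.continuous.mul (by fun_prop)).aestronglyMeasurable
  · refine Eventually.of_forall fun k => ?_
    rw [norm_mul, neg_mul, mul_comm Complex.I, ← neg_mul, ← Complex.ofReal_neg,
      Complex.norm_exp_ofReal_mul_I, mul_one]
  · exact Eventually.of_forall fun k => by fun_prop

/-! ### The momentum distribution -/

variable (S : System)

lemma one_add_pow_le_exp {b : ℝ} (hb : 0 < b) (M : ℕ) :
    ∃ C, 0 ≤ C ∧ ∀ r : ℝ, 0 ≤ r → (1 + r) ^ M ≤ C * Real.exp (b * r ^ 2) := by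
  refine ⟨M.factorial * Real.exp (1 + 1 / (4 * b)), by positivity, fun r hr => ?_⟩
  have h1 : (1 + r) ^ M / M.factorial ≤ Real.exp (1 + r) :=
    Real.pow_div_factorial_le_exp _ (by positivity) M
  rw [div_le_iff₀ (by positivity)] at h1
  -- Completing the square: $r\le br^2+1/(4b)$.
  have h2 : 1 + r ≤ (1 + 1 / (4 * b)) + b * r ^ 2 := by
    have : 0 ≤ (2 * b * r - 1) ^ 2 / (4 * b) := by positivity
    have h3 : (2 * b * r - 1) ^ 2 / (4 * b) = b * r ^ 2 - r + 1 / (4 * b) := by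
      field_simp; ring
    linarith
  calc (1 + r) ^ M ≤ Real.exp (1 + r) * M.factorial := h1
    _ ≤ Real.exp ((1 + 1 / (4 * b)) + b * r ^ 2) * M.factorial := by gcongr
    _ = _ := by rw [Real.exp_add]; ring

lemma integrable_exp_neg_mul_norm_sq {b : ℝ} (hb : 0 < b) :
    Integrable (fun v : E3 => Real.exp (-b * ‖v‖ ^ 2)) := by
  have h := (GaussianFourier.integrable_cexp_neg_mul_sq_norm_add (V := E3) (b := (b : ℂ))
    (by simpa using hb) 0 0).norm
  refine h.congr (Eventually.of_forall fun v => ?_)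
  simp only [zero_mul, add_zero]
  rw [← Complex.ofReal_pow, ← Complex.ofReal_neg, ← Complex.ofReal_mul,
    ← Complex.ofReal_exp, Complex.norm_of_nonneg (Real.exp_pos _).le]

lemma System.continuous_maxwell {ℓ : ℕ} : Continuous (S.maxwell (ℓ := ℓ)) := by
  unfold System.maxwell
  fun_prop

lemma System.maxwell_nonneg {ℓ : ℕ} (p : Fin ℓ → E3) : 0 ≤ S.maxwell p :=
  Finset.prod_nonneg fun _ _ => by positivity

lemma one_le_finset_prod {ι : Type*} {s : Finset ι} {f : ι → ℝ} (h : ∀ i ∈ s, 1 ≤ f i) :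
    1 ≤ ∏ i ∈ s, f i :=
  Finset.prod_induction f (fun x => 1 ≤ x) (fun _ _ => one_le_mul_of_one_le_of_one_le) le_rfl h

/-- Polynomial weights in `p` are needed because decay in $q+gp$ turns into decay in `q` only at the
cost of powers of $1+\|p\|$. -/
lemma System.integrable_pow_mul_maxwell (hsigma : 0 < S.sigma) (M : ℕ) {ℓ : ℕ} :
    Integrable (fun p : Fin ℓ → E3 => (1 + ‖p‖) ^ M * S.maxwell p) := by
  -- Half of the Gaussian exponent $1/(2\sigma^2)$ is spent on absorbing the polynomial; the other
  -- half keeps the integral finite.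
  have hb : 0 < 1 / (4 * S.sigma ^ 2) := by positivity
  obtain ⟨C, hC0, hC⟩ := one_add_pow_le_exp hb M
  let Nf : ℝ := √((2 * Real.pi * S.sigma ^ 2) ^ 3)
  let g : E3 → ℝ := fun v => (1 + ‖v‖) ^ M * (Real.exp (-‖v‖ ^ 2 / (2 * S.sigma ^ 2)) / Nf)
  have hg : Integrable g := by
    refine Integrable.mono' ((integrable_exp_neg_mul_norm_sq hb).const_mul (C / Nf))
      (Continuous.aestronglyMeasurable (by fun_prop)) (Eventually.of_forall fun v => ?_)
    rw [Real.norm_of_nonneg (by positivity)]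
    have h1 := hC ‖v‖ (norm_nonneg v)
    calc g v ≤ (C * Real.exp (1 / (4 * S.sigma ^ 2) * ‖v‖ ^ 2)) *
          (Real.exp (-‖v‖ ^ 2 / (2 * S.sigma ^ 2)) / Nf) :=
            mul_le_mul_of_nonneg_right h1 (by positivity)
      _ = C / Nf * (Real.exp (1 / (4 * S.sigma ^ 2) * ‖v‖ ^ 2) *
          Real.exp (-‖v‖ ^ 2 / (2 * S.sigma ^ 2))) := by ring
      _ = _ := by
        rw [← Real.exp_add]
        congr 2
        field_simp
        ring
  have hprod : Integrable (fun p : Fin ℓ → E3 => ∏ j, g (p j)) :=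
    Integrable.fintype_prod (f := fun _ => g) fun _ => hg
  refine hprod.mono' (Continuous.aestronglyMeasurable ?_) (Eventually.of_forall fun p => ?_)
  · have := S.continuous_maxwell (ℓ := ℓ)
    fun_prop
  · rw [Real.norm_of_nonneg (mul_nonneg (by positivity) (S.maxwell_nonneg p))]
    rw [System.maxwell, Finset.prod_mul_distrib]
    refine mul_le_mul_of_nonneg_right ?_ (Finset.prod_nonneg fun _ _ => by positivity)
    rw [Finset.prod_pow]
    refine pow_le_pow_left₀ (by positivity) ?_ M
    have h1 : ∀ j, (1 : ℝ) ≤ 1 + ‖p j‖ := fun j => by linarith [norm_nonneg (p j)]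
    have h3 : (1 : ℝ) ≤ ∏ j, (1 + ‖p j‖) := one_le_finset_prod fun j _ => h1 j
    -- The sup norm is dominated by a product of one-particle factors, so integrability reduces to a
    -- single particle.
    have h2 : ‖p‖ ≤ ∏ j, (1 + ‖p j‖) - 1 := by
      refine (pi_norm_le_iff_of_nonneg (by linarith)).2 fun j => ?_
      have : 1 + ‖p j‖ ≤ ∏ j, (1 + ‖p j‖) := by
        rw [← Finset.mul_prod_erase _ _ (Finset.mem_univ j)]
        exact le_mul_of_one_le_right (by positivity) (one_le_finset_prod fun i _ => h1 i)
      linarith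
    linarith

/-- The integral factorises over the particles, and the Gaussian prefactor $(2\pi\sigma^2)^{3/2}$ is
exactly the normalisation of the distribution. -/
lemma System.integral_maxwell_mul_cexp (hsigma : 0 < S.sigma) {ℓ : ℕ} (L : Fin ℓ → E3) :
    ∫ p : Fin ℓ → E3, (S.maxwell p : ℂ) *
        Complex.exp (-Complex.I * ((∑ j, inner ℝ (L j) (p j) : ℝ) : ℂ))
      = ((Real.exp (-(S.sigma ^ 2 / 2) * ∑ j, ‖L j‖ ^ 2) : ℝ) : ℂ) := by
  let g : Fin ℓ → E3 → ℂ := fun j v =>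
    ((√((2 * Real.pi * S.sigma ^ 2) ^ 3) : ℝ) : ℂ)⁻¹ *
      Complex.exp (-((1 / (2 * S.sigma ^ 2) : ℝ) : ℂ) * ‖v‖ ^ 2 +
        (-Complex.I) * ((inner ℝ (L j) v : ℝ) : ℂ))
  have h1 : ∀ p : Fin ℓ → E3, (S.maxwell p : ℂ) *
      Complex.exp (-Complex.I * ((∑ j, inner ℝ (L j) (p j) : ℝ) : ℂ)) = ∏ j, g j (p j) := by
    intro p
    simp only [g, System.maxwell]
    push_cast
    rw [Finset.mul_sum, Complex.exp_sum, ← Finset.prod_mul_distrib]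
    refine Finset.prod_congr rfl fun j _ => ?_
    rw [Complex.exp_add, div_eq_mul_inv]
    have : -(‖p j‖ : ℂ) ^ 2 / (2 * (S.sigma : ℂ) ^ 2)
        = -(1 / (2 * (S.sigma : ℂ) ^ 2)) * (‖p j‖ : ℂ) ^ 2 := by ring
    rw [this]
    ring
  simp_rw [h1]
  rw [integral_fintype_prod_volume_eq_prod]
  have h2 : ∀ j, ∫ v, g j v = Complex.exp (-((S.sigma : ℂ) ^ 2 / 2) * (‖L j‖ : ℂ) ^ 2) := by
    intro j
    simp only [g]
    rw [integral_const_mul, GaussianFourier.integral_cexp_neg_mul_sq_norm_add (by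
      rw [Complex.ofReal_re]; positivity)]
    have hN : ((Real.pi : ℂ) / ((1 / (2 * S.sigma ^ 2) : ℝ) : ℂ))
        ^ ((Module.finrank ℝ E3 : ℂ) / 2) = ((√((2 * Real.pi * S.sigma ^ 2) ^ 3) : ℝ) : ℂ) := by
      rw [← Complex.ofReal_div, finrank_euclideanSpace_fin]
      have : (((3 : ℕ) : ℂ) / 2) = (((3 : ℝ) / 2 : ℝ) : ℂ) := by push_cast; rfl
      rw [this, ← Complex.ofReal_cpow (by positivity)]
      congr 1
      rw [Real.sqrt_eq_rpow, ← Real.rpow_natCast (2 * Real.pi * S.sigma ^ 2) 3,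
        ← Real.rpow_mul (by positivity)]
      congr 1
      · field_simp
      · norm_num
    rw [hN, ← mul_assoc, inv_mul_cancel₀, one_mul]
    · congr 1
      rw [neg_sq, Complex.I_sq]
      push_cast
      have : (S.sigma : ℂ) ≠ 0 := by exact_mod_cast hsigma.ne'
      field_simp
      ring
    · have : 0 < √((2 * Real.pi * S.sigma ^ 2) ^ 3) := by positivity
      exact_mod_cast this.ne'
  simp_rw [h2]
  rw [← Complex.exp_sum]
  push_cast
  rw [Finset.mul_sum]

end Analysis

/-! ### Initial correlations as functions of the separation -/

section Correlations

variable (S : System)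

/-- `(2π)⁻³ ∫ dh exp(i h·r) W(h)`. -/
def planeAvg (W : E3 → ℝ) (r : E3) : ℂ :=
  (((2 * Real.pi) ^ 3 : ℝ) : ℂ)⁻¹ *
    ∫ h : E3, Complex.exp (Complex.I * ((inner ℝ h r : ℝ) : ℂ)) * ((W h : ℝ) : ℂ)

lemma System.corr_eq (w : E3 → ℝ) : S.corr w = planeAvg (fun h => w h * S.P0 ‖h‖) := rfl

lemma norm_cexp_I_mul (x : ℝ) : ‖Complex.exp (Complex.I * (x : ℂ))‖ = 1 := by
  rw [mul_comm, Complex.norm_exp_ofReal_mul_I]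

lemma norm_cexp_neg_I_mul (x : ℝ) : ‖Complex.exp (-Complex.I * (x : ℂ))‖ = 1 := by
  have := norm_cexp_I_mul (-x)
  rwa [Complex.ofReal_neg, mul_neg, ← neg_mul] at this

lemma planeAvg_bounded (W : E3 → ℝ) : ∃ B, ∀ r, ‖planeAvg W r‖ ≤ B := by
  refine ⟨‖(((2 * Real.pi) ^ 3 : ℝ) : ℂ)⁻¹‖ * ∫ h, ‖W h‖, fun r => ?_⟩
  rw [planeAvg, norm_mul]
  refine mul_le_mul_of_nonneg_left ((norm_integral_le_integral_norm _).trans (le_of_eq ?_))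
    (norm_nonneg _)
  congr 1
  funext h
  rw [norm_mul, norm_cexp_I_mul, one_mul, Complex.norm_real]

lemma continuous_planeAvg {W : E3 → ℝ} (hW : Integrable W) : Continuous (planeAvg W) := by
  refine continuous_const.mul ?_
  refine continuous_of_dominated (bound := fun h => ‖W h‖) (fun r => ?_) (fun r => ?_) hW.norm ?_
  · exact (Continuous.aestronglyMeasurable (by fun_prop)).mul hW.ofReal.aestronglyMeasurable
  · refine Eventually.of_forall fun h => ?_
    rw [norm_mul, norm_cexp_I_mul, one_mul, Complex.norm_real]
  · exact Eventually.of_forall fun h => by fun_prop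

lemma planeAvg_neg (W : E3 → ℝ) (r : E3) : planeAvg W (-r) = planeAvg (fun h => W (-h)) r := by
  rw [planeAvg, planeAvg]
  congr 1
  rw [← integral_neg_eq_self]
  simp

/-- In polar coordinates the factor $r^2\,dr$ of three dimensions cancels $r^{-2}$. -/
lemma integrable_indicator_inv_norm_sq (δ : ℝ) :
    Integrable (fun h : E3 => if ‖h‖ < δ then (‖h‖ ^ 2)⁻¹ else 0) := by
  have := (integrable_fun_norm_addHaar (volume : Measure E3)
    (f := fun y : ℝ => if y < δ then (y ^ 2)⁻¹ else 0)).2 ?_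
  · exact this
  · have h1 : IntegrableOn (Set.indicator (Set.Ioo 0 δ) fun _ => (1 : ℝ)) (Set.Ioi 0) := by
      refine Integrable.integrableOn ?_
      rw [integrable_indicator_iff measurableSet_Ioo]
      exact integrableOn_const (by simp)
    refine h1.congr_fun (fun y hy => ?_) measurableSet_Ioi
    have hy0 : y ≠ 0 := ne_of_gt hy
    by_cases h : y < δ
    · simp [Set.indicator, h, Set.mem_Ioi.1 hy, hy0]
    · simp [Set.indicator, h]

variable {S}

lemma System.continuousAt_P0 (hPcont : ContinuousWithinAt S.P0 (Set.Ici 0) 0) :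
    ContinuousAt (fun h : E3 => S.P0 ‖h‖) 0 := by
  have h1 : Tendsto (fun h : E3 => ‖h‖) (𝓝 0) (𝓝[Set.Ici 0] 0) :=
    tendsto_nhdsWithin_iff.2 ⟨tendsto_norm_zero, Eventually.of_forall fun h => norm_nonneg h⟩
  have := hPcont.tendsto.comp h1
  rw [ContinuousAt, norm_zero]
  exact this

/-- Near the origin $|P_0|\le1$ and $|h|^{-2}$ is integrable in three dimensions; outside a ball of
radius $\delta$ the weight is bounded and $P_0$ itself is integrable. This covers the singular
weights of all three kinds of correlation. -/
lemma System.integrable_weight (hPint : Integrable (fun h : E3 => S.P0 ‖h‖))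
    (hPzero : S.P0 0 = 0) (hPcont : ContinuousWithinAt S.P0 (Set.Ici 0) 0) {w : E3 → ℝ}
    (hw : Measurable w) (hb : ∀ h, |w h| ≤ 1 + (‖h‖ ^ 2)⁻¹) :
    Integrable (fun h => w h * S.P0 ‖h‖) := by
  obtain ⟨δ, hδ, hP⟩ : ∃ δ > 0, ∀ h : E3, ‖h‖ < δ → |S.P0 ‖h‖| ≤ 1 := by
    have h1 := Metric.continuousAt_iff.1 (System.continuousAt_P0 hPcont) 1 one_pos
    obtain ⟨δ, hδ, h⟩ := h1
    refine ⟨δ, hδ, fun x hx => ?_⟩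
    have := h (x := x) (by simpa using hx)
    rw [norm_zero, hPzero, Real.dist_eq, sub_zero] at this
    exact this.le
  have hbound := (hPint.norm.add (integrable_indicator_inv_norm_sq δ)).add
    (hPint.norm.const_mul (δ ^ 2)⁻¹)
  refine hbound.mono' (hw.aestronglyMeasurable.mul hPint.aestronglyMeasurable)
    (Eventually.of_forall fun h => ?_)
  simp only [Pi.add_apply, Real.norm_eq_abs]
  rw [abs_mul]
  have h0 := abs_nonneg (S.P0 ‖h‖)
  have h1 := mul_le_mul_of_nonneg_right (hb h) h0
  rw [add_mul, one_mul] at h1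
  split_ifs with hlt
  · have h2 : (‖h‖ ^ 2)⁻¹ * |S.P0 ‖h‖| ≤ (‖h‖ ^ 2)⁻¹ :=
      mul_le_of_le_one_right (by positivity) (hP h hlt)
    have : 0 ≤ (δ ^ 2)⁻¹ * |S.P0 ‖h‖| := by positivity
    linarith
  · have h2 : (‖h‖ ^ 2)⁻¹ ≤ (δ ^ 2)⁻¹ :=
      inv_anti₀ (by positivity) (pow_le_pow_left₀ hδ.le (not_lt.1 hlt) 2)
    have := mul_le_mul_of_nonneg_right h2 h0
    linarith

/-! ### Correlations that fade in the mean -/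

/-- Bounded continuous functions whose Gaussian means over translates tend to zero as the Gaussian
widens, locally uniformly with linear growth in the translation. -/
structure Fading (C : E3 → ℂ) : Prop where
  cont : Continuous C
  bdd : ∃ B, ∀ r, ‖C r‖ ≤ B
  mean : ∃ η : ℝ → ℝ, Tendsto η (𝓝[>] 0) (𝓝 0) ∧ ∀ ε, 0 < ε → ∀ q,
    ‖∫ x : E3, ((Real.exp (-ε * ‖x‖ ^ 2) : ℝ) : ℂ) * C (x - q)‖ ≤ η ε * (1 + ‖q‖)

lemma Fading.neg {C : E3 → ℂ} (h : Fading C) : Fading (fun r => C (-r)) := by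
  obtain ⟨B, hB⟩ := h.bdd
  obtain ⟨η, h0, hη⟩ := h.mean
  refine ⟨h.cont.comp continuous_neg, ⟨B, fun r => hB _⟩, η, h0, fun ε hε q => ?_⟩
  rw [← integral_neg_eq_self]
  have := hη ε hε (-q)
  rw [norm_neg] at this
  simpa [sub_eq_add_neg, add_comm] using this

/-- The Fourier transform of the Gaussian `exp(-ε x²)`, divided by `(2π)³`. -/
def heat (ε : ℝ) (h : E3) : ℝ :=
  ((2 * Real.pi) ^ 3)⁻¹ * ((Real.pi / ε) ^ ((3 : ℝ) / 2) * Real.exp (-‖h‖ ^ 2 / (4 * ε)))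

lemma heat_nonneg {ε : ℝ} (hε : 0 < ε) (h : E3) : 0 ≤ heat ε h := by
  unfold heat; positivity

lemma continuous_heat (ε : ℝ) : Continuous (heat ε) := by
  unfold heat; fun_prop

lemma heat_neg (ε : ℝ) (h : E3) : heat ε (-h) = heat ε h := by simp [heat]

lemma heat_le {ε : ℝ} (hε : 0 < ε) : ∃ B, ∀ h, heat ε h ≤ B := by
  refine ⟨((2 * Real.pi) ^ 3)⁻¹ * ((Real.pi / ε) ^ ((3 : ℝ) / 2) * 1), fun h => ?_⟩
  unfold heat
  gcongr
  rw [Real.exp_le_one_iff]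
  exact div_nonpos_of_nonpos_of_nonneg (by simp) (by positivity)

lemma integral_gaussian_mul_cexp {ε : ℝ} (hε : 0 < ε) (h : E3) :
    ((((2 * Real.pi) ^ 3 : ℝ) : ℂ)⁻¹ * ∫ x : E3, ((Real.exp (-ε * ‖x‖ ^ 2) : ℝ) : ℂ) *
      Complex.exp (Complex.I * ((inner ℝ h x : ℝ) : ℂ))) = ((heat ε h : ℝ) : ℂ) := by
  have h1 : ∀ x : E3, ((Real.exp (-ε * ‖x‖ ^ 2) : ℝ) : ℂ) *
      Complex.exp (Complex.I * ((inner ℝ h x : ℝ) : ℂ)) =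
      Complex.exp (-(ε : ℂ) * ‖x‖ ^ 2 + Complex.I * ((inner ℝ h x : ℝ) : ℂ)) := by
    intro x
    rw [Complex.exp_add]
    push_cast
    rfl
  simp_rw [h1]
  rw [GaussianFourier.integral_cexp_neg_mul_sq_norm_add (by simpa using hε)]
  have h2 : ((Real.pi : ℂ) / (ε : ℂ)) ^ ((Module.finrank ℝ E3 : ℂ) / 2)
      = (((Real.pi / ε) ^ ((3 : ℝ) / 2) : ℝ) : ℂ) := by
    rw [finrank_euclideanSpace_fin, Complex.ofReal_cpow (by positivity)]
    push_cast
    rfl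
  rw [h2, heat, Complex.I_sq]
  push_cast
  congr 3
  ring_nf

/-- `heat ε` is a probability density concentrating at $0$ as $\varepsilon\downarrow0$, so the
integral tends to $f(0)$. -/
lemma tendsto_integral_heat_mul {f : E3 → ℝ} (hf : Integrable f) (hc : ContinuousAt f 0)
    (h0 : f 0 = 0) : Tendsto (fun ε => ∫ h, heat ε h * f h) (𝓝[>] 0) (𝓝 0) := by
  have h1 := Real.tendsto_integral_gaussian_smul' (f := fun h => ((f h : ℝ) : ℂ)) hf.ofReal
    (v := 0) (Complex.continuous_ofReal.continuousAt.comp hc)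
  -- The Gaussian kernel with parameter $c$ has exponent $-\pi^2c|h|^2$; matching it with
  -- $-|h|^2/(4\varepsilon)$ gives $c=1/(4\pi^2\varepsilon)$.
  have h2 : Tendsto (fun ε : ℝ => (1 / (4 * Real.pi ^ 2)) * ε⁻¹) (𝓝[>] 0) atTop :=
    tendsto_inv_nhdsGT_zero.const_mul_atTop (by positivity)
  have h3 := h1.comp h2
  rw [h0, Complex.ofReal_zero] at h3
  have h4 : Tendsto (fun ε : ℝ => ((∫ h, heat ε h * f h : ℝ) : ℂ)) (𝓝[>] 0) (𝓝 0) := by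
    refine h3.congr' ?_
    filter_upwards [self_mem_nhdsWithin] with ε hε
    rw [Set.mem_Ioi] at hε
    rw [← integral_complex_ofReal]
    simp only [Function.comp_apply]
    refine integral_congr_ae (Eventually.of_forall fun h => ?_)
    have hA : ((Real.pi : ℂ) * ((1 / (4 * Real.pi ^ 2) * ε⁻¹ : ℝ) : ℂ))
        ^ ((Module.finrank ℝ E3 : ℂ) / 2)
        = ((((2 * Real.pi) ^ 3)⁻¹ * (Real.pi / ε) ^ ((3 : ℝ) / 2) : ℝ) : ℂ) := by
      have e1 : (((3 : ℕ) : ℂ) / 2) = (((3 : ℝ) / 2 : ℝ) : ℂ) := by push_cast; rfl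
      rw [finrank_euclideanSpace_fin, ← Complex.ofReal_mul, e1,
        ← Complex.ofReal_cpow (by positivity)]
      congr 1
      have e2 : Real.pi * (1 / (4 * Real.pi ^ 2) * ε⁻¹)
          = ((2 * Real.pi) ^ (2 : ℝ))⁻¹ * (Real.pi / ε) := by
        rw [Real.rpow_two]
        field_simp
        ring
      rw [e2, Real.mul_rpow (by positivity) (by positivity), Real.inv_rpow (by positivity),
        ← Real.rpow_mul (by positivity)]
      congr 2
      rw [← Real.rpow_natCast]
      norm_num
    have hB : Complex.exp (-(Real.pi : ℂ) ^ 2 * ((1 / (4 * Real.pi ^ 2) * ε⁻¹ : ℝ) : ℂ) *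
        (‖(0 : E3) - h‖ : ℂ) ^ 2) = ((Real.exp (-‖h‖ ^ 2 / (4 * ε)) : ℝ) : ℂ) := by
      rw [Complex.ofReal_exp, zero_sub, norm_neg]
      congr 1
      push_cast
      have hpi : (Real.pi : ℂ) ≠ 0 := by exact_mod_cast Real.pi_ne_zero
      have hε' : (ε : ℂ) ≠ 0 := by exact_mod_cast hε.ne'
      field_simp
    simp only
    rw [hA, hB, heat, smul_eq_mul, ← Complex.ofReal_mul, ← Complex.ofReal_mul]
    congr 1
    ring
  rw [← Complex.ofReal_zero] at h4
  exact (Complex.continuous_re.tendsto _).comp h4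

/-- After exchanging the integrals, the Gaussian in `x` is integrated against a plane wave and
becomes `heat ε h`. Thus a wide Gaussian mean probes `W` only near $h=0$. -/
lemma integral_gaussian_mul_planeAvg {W : E3 → ℝ} (hW : Integrable W) {ε : ℝ} (hε : 0 < ε)
    (q : E3) :
    ∫ x : E3, ((Real.exp (-ε * ‖x‖ ^ 2) : ℝ) : ℂ) * planeAvg W (x - q)
      = ∫ h : E3, ((heat ε h * W h : ℝ) : ℂ) *
        Complex.exp (-Complex.I * ((inner ℝ h q : ℝ) : ℂ)) := by
  have hint : Integrable (fun z : E3 × E3 => ((Real.exp (-ε * ‖z.1‖ ^ 2) : ℝ) : ℂ) *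
      (Complex.exp (Complex.I * ((inner ℝ z.2 (z.1 - q) : ℝ) : ℂ)) * ((W z.2 : ℝ) : ℂ))) := by
    have h1 := (integrable_exp_neg_mul_norm_sq hε).ofReal (𝕜 := ℂ) |>.mul_prod
      (hW.ofReal (𝕜 := ℂ))
    have h2 := h1.bdd_mul (c := 1) (f := fun z : E3 × E3 =>
      Complex.exp (Complex.I * ((inner ℝ z.2 (z.1 - q) : ℝ) : ℂ)))
      (Continuous.aestronglyMeasurable (by fun_prop))
      (Eventually.of_forall fun z => (norm_cexp_I_mul _).le)
    refine h2.congr (Eventually.of_forall fun z => ?_)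
    simp only [Complex.coe_algebraMap]
    ring
  have h1 : ∀ x : E3, ((Real.exp (-ε * ‖x‖ ^ 2) : ℝ) : ℂ) * planeAvg W (x - q)
      = (((2 * Real.pi) ^ 3 : ℝ) : ℂ)⁻¹ * ∫ h : E3, ((Real.exp (-ε * ‖x‖ ^ 2) : ℝ) : ℂ) *
      (Complex.exp (Complex.I * ((inner ℝ h (x - q) : ℝ) : ℂ)) * ((W h : ℝ) : ℂ)) := by
    intro x
    rw [integral_const_mul, planeAvg]
    ring
  simp_rw [h1]
  rw [integral_const_mul, integral_integral_swap hint, ← integral_const_mul]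
  refine integral_congr_ae (Eventually.of_forall fun h => ?_)
  simp only
  rw [Complex.ofReal_mul, ← integral_gaussian_mul_cexp hε h]
  rw [mul_assoc, mul_assoc]
  congr 1
  rw [← integral_mul_const]
  refine integral_congr_ae (Eventually.of_forall fun x => ?_)
  simp only
  rw [inner_sub_right, Complex.ofReal_sub, mul_sub, sub_eq_add_neg, Complex.exp_add, neg_mul]
  ring_nf

lemma integrable_heat_mul {f : E3 → ℝ} (hf : Integrable f) {ε : ℝ} (hε : 0 < ε) :
    Integrable (fun h => heat ε h * f h) := by
  obtain ⟨B, hB⟩ := heat_le hε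
  refine hf.bdd_mul (c := B) (continuous_heat ε).aestronglyMeasurable
    (Eventually.of_forall fun h => ?_)
  rw [Real.norm_of_nonneg (heat_nonneg hε h)]
  exact hB h

/-- The standing assumptions on the parameters. -/
structure System.Regular (S : System) : Prop where
  sigma_pos : 0 < S.sigma
  int : Integrable (fun h : E3 => S.P0 ‖h‖)
  zero : S.P0 0 = 0
  cont : ContinuousWithinAt S.P0 (Set.Ici 0) 0

lemma System.Regular.integrable_weight (hS : S.Regular) {w : E3 → ℝ}
    (hw : Measurable w) (hb : ∀ h, |w h| ≤ 1 + (‖h‖ ^ 2)⁻¹) :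
    Integrable (fun h => w h * S.P0 ‖h‖) :=
  System.integrable_weight hS.int hS.zero hS.cont hw hb

lemma System.Regular.tendsto_heat_P0 (hS : S.Regular) :
    Tendsto (fun ε => ∫ h, heat ε h * |S.P0 ‖h‖|) (𝓝[>] 0) (𝓝 0) :=
  tendsto_integral_heat_mul hS.int.abs (System.continuousAt_P0 hS.cont).abs (by simp [hS.zero])

/-- The mean is bounded by $\int \mathrm{heat}_\varepsilon|P_0|$ uniformly in the translation, so
linear growth is not needed here. -/
lemma System.Regular.fading_Cdd (hS : S.Regular) : Fading S.Cdd := by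
  have hW : Integrable (fun h : E3 => (1 : ℝ) * S.P0 ‖h‖) := by simpa using hS.int
  refine ⟨continuous_planeAvg hW, planeAvg_bounded _, _, hS.tendsto_heat_P0, fun ε hε q => ?_⟩
  have h0 : 0 ≤ ∫ h, heat ε h * |S.P0 ‖h‖| :=
    integral_nonneg fun h => mul_nonneg (heat_nonneg hε h) (abs_nonneg _)
  refine le_trans ?_ (le_mul_of_one_le_right h0 (by linarith [norm_nonneg q]))
  change ‖∫ x : E3, _ * planeAvg _ (x - q)‖ ≤ _
  rw [integral_gaussian_mul_planeAvg hW hε]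
  refine (norm_integral_le_integral_norm _).trans (le_of_eq ?_)
  congr 1
  funext h
  rw [norm_mul, norm_cexp_neg_I_mul, Complex.norm_real, Real.norm_eq_abs, abs_mul,
    abs_of_nonneg (heat_nonneg hε h)]
  simp

lemma abs_coord_le (h : E3) (a : Fin 3) : |h a| ≤ ‖h‖ := PiLp.norm_apply_le h a

lemma abs_dpWeight_le (h : E3) (a : Fin 3) : |h a / ‖h‖ ^ 2| ≤ 1 + (‖h‖ ^ 2)⁻¹ := by
  rw [abs_div, abs_of_nonneg (by positivity : 0 ≤ ‖h‖ ^ 2)]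
  rcases eq_or_ne h 0 with rfl | h0
  · simp
  · have hpos : 0 < ‖h‖ := norm_pos_iff.2 h0
    rw [div_le_iff₀ (by positivity), add_mul, inv_mul_cancel₀ (by positivity)]
    nlinarith [abs_coord_le h a, sq_nonneg (‖h‖ - 1)]

lemma abs_ppWeight_le (h : E3) (a b : Fin 3) : |h a * h b / ‖h‖ ^ 4| ≤ 1 + (‖h‖ ^ 2)⁻¹ := by
  rw [abs_div, abs_of_nonneg (by positivity : 0 ≤ ‖h‖ ^ 4)]
  rcases eq_or_ne h 0 with rfl | h0
  · simp
  · have hpos : 0 < ‖h‖ := norm_pos_iff.2 h0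
    have h1 : |h a * h b| ≤ ‖h‖ ^ 2 := by
      rw [abs_mul, sq]
      exact mul_le_mul (abs_coord_le h a) (abs_coord_le h b) (abs_nonneg _) hpos.le
    have h2 : |h a * h b| / ‖h‖ ^ 4 ≤ (‖h‖ ^ 2)⁻¹ := by
      rw [div_le_iff₀ (by positivity)]
      refine h1.trans (le_of_eq ?_)
      field_simp
    linarith

lemma System.Regular.integrable_dp (hS : S.Regular) (a : Fin 3) :
    Integrable (fun h : E3 => h a / ‖h‖ ^ 2 * S.P0 ‖h‖) :=
  hS.integrable_weight (by fun_prop) fun h => abs_dpWeight_le h a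

lemma System.Regular.integrable_pp (hS : S.Regular) (a b : Fin 3) :
    Integrable (fun h : E3 => h a * h b / ‖h‖ ^ 4 * S.P0 ‖h‖) :=
  hS.integrable_weight (by fun_prop) fun h => abs_ppWeight_le h a b

/-- A bound by absolute values would leave $P_0/|h|$, which need not vanish at $0$. Since the weight
is odd, only the sine part of the plane wave survives, and $|\sin(h\cdot q)|\le|h||q|$ cancels
$1/|h|$; this is the origin of the linear growth allowed in `Fading`. -/
lemma System.Regular.fading_dp (hS : S.Regular) (a : Fin 3) :
    Fading (S.corr (fun h => h a / ‖h‖ ^ 2)) := by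
  have hW := hS.integrable_dp a
  refine ⟨continuous_planeAvg hW, planeAvg_bounded _, _, hS.tendsto_heat_P0, fun ε hε q => ?_⟩
  have h0 : 0 ≤ ∫ h, heat ε h * |S.P0 ‖h‖| :=
    integral_nonneg fun h => mul_nonneg (heat_nonneg hε h) (abs_nonneg _)
  refine le_trans ?_ (mul_le_mul_of_nonneg_left (show ‖q‖ ≤ 1 + ‖q‖ by linarith) h0)
  rw [System.corr_eq, integral_gaussian_mul_planeAvg hW hε]
  set F : E3 → ℂ := fun h => ((heat ε h * (h a / ‖h‖ ^ 2 * S.P0 ‖h‖) : ℝ) : ℂ) *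
    Complex.exp (-Complex.I * ((inner ℝ h q : ℝ) : ℂ)) with hF
  have hFi : Integrable F := by
    have := (integrable_heat_mul hW hε).ofReal (𝕜 := ℂ)
    refine this.mul_bdd (c := 1) (Continuous.aestronglyMeasurable (by fun_prop))
      (Eventually.of_forall fun h => (norm_cexp_neg_I_mul _).le)
  -- Averaging over $h\mapsto-h$ isolates the sine before any absolute value is taken.
  have hsym : ∫ h, F h = (1 / 2 : ℂ) * ∫ h, (F h + F (-h)) := by
    rw [integral_add hFi hFi.comp_neg, integral_neg_eq_self]
    ring
  rw [hsym, norm_mul, ← integral_mul_const]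
  have hbound : ‖∫ h, (F h + F (-h))‖ ≤ ∫ h, 2 * (heat ε h * |S.P0 ‖h‖| * ‖q‖) := by
    refine norm_integral_le_of_norm_le ?_ (Eventually.of_forall fun h => ?_)
    · exact ((integrable_heat_mul hS.int.abs hε).mul_const _).const_mul 2
    · have e1 : F h + F (-h) = ((heat ε h * (h a / ‖h‖ ^ 2 * S.P0 ‖h‖) : ℝ) : ℂ) *
          (-2 * Complex.I * ((Real.sin (inner ℝ h q) : ℝ) : ℂ)) := by
        simp only [hF, heat_neg, norm_neg, inner_neg_left, PiLp.neg_apply]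
        push_cast
        rw [Complex.sin]
        have : Complex.exp (-Complex.I * -((inner ℝ h q : ℝ) : ℂ))
            = Complex.exp (((inner ℝ h q : ℝ) : ℂ) * Complex.I) := by congr 1; ring
        rw [this]
        have : Complex.exp (-Complex.I * ((inner ℝ h q : ℝ) : ℂ))
            = Complex.exp (-((inner ℝ h q : ℝ) : ℂ) * Complex.I) := by congr 1; ring
        rw [this]
        linear_combination ((heat ε h : ℂ) * ((h a : ℂ) / (‖h‖ : ℂ) ^ 2 * (S.P0 ‖h‖ : ℂ))) *
          (Complex.exp (-((inner ℝ h q : ℝ) : ℂ) * Complex.I) -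
            Complex.exp (((inner ℝ h q : ℝ) : ℂ) * Complex.I)) * Complex.I_sq
      rw [e1, norm_mul, norm_mul, norm_mul, Complex.norm_I, Complex.norm_real, Complex.norm_real,
        Real.norm_eq_abs, Real.norm_eq_abs, abs_mul, abs_mul, abs_of_nonneg (heat_nonneg hε h)]
      have h3 : |Real.sin (inner ℝ h q)| ≤ ‖h‖ * ‖q‖ :=
        (Real.abs_sin_le_abs).trans (abs_real_inner_le_norm h q)
      have h4 : |h a / ‖h‖ ^ 2| * (‖h‖ * ‖q‖) ≤ ‖q‖ := by
        rw [abs_div, abs_of_nonneg (by positivity : 0 ≤ ‖h‖ ^ 2)]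
        rcases eq_or_ne h 0 with rfl | h0
        · simp
        · have hpos : 0 < ‖h‖ := norm_pos_iff.2 h0
          rw [div_mul_eq_mul_div, div_le_iff₀ (by positivity)]
          nlinarith [abs_coord_le h a, norm_nonneg q, mul_nonneg hpos.le (norm_nonneg q)]
      have h5 : |h a / ‖h‖ ^ 2| * |Real.sin (inner ℝ h q)| ≤ ‖q‖ :=
        (mul_le_mul_of_nonneg_left h3 (abs_nonneg _)).trans h4
      have h6 : 0 ≤ heat ε h * |S.P0 ‖h‖| := mul_nonneg (heat_nonneg hε h) (abs_nonneg _)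
      have h7 := mul_le_mul_of_nonneg_left h5 h6
      norm_num
      linarith
  calc ‖(1 / 2 : ℂ)‖ * ‖∫ h, (F h + F (-h))‖
      ≤ ‖(1 / 2 : ℂ)‖ * ∫ h, 2 * (heat ε h * |S.P0 ‖h‖| * ‖q‖) := by gcongr
    _ = _ := by
      rw [integral_const_mul]
      norm_num
      ring

end Correlations

/-! ### Limits of single terms -/

section Limits

open scoped SchwartzMap

variable (S : System)

/-- The contribution to the smeared integrand of an amplitude `A` when field `s` acts on particle
`σ s`. -/
def System.term {ℓ n : ℕ} (t : Fin n → ℝ) (σ : Fin n → Fin ℓ)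
    (A : (Fin ℓ → E3) → (Fin n → E3) → ℂ) (φ : 𝓢(Fin n → E3, ℂ)) (ε : ℝ)
    (x : (Fin ℓ → E3) × (Fin ℓ → E3) × (Fin n → E3)) : ℂ :=
  ((Real.exp (-ε * ∑ j, ‖x.1 j‖ ^ 2) * S.maxwell x.2.1 : ℝ) : ℂ) * φ x.2.2 *
    (A x.1 x.2.2 * S.phase t σ x.1 x.2.1 x.2.2)

/-- The amplitude `A`, with fields distributed over particles by `σ`, contributes
`(2π)³ δ(∑ k) T(k)`. -/
def System.HasLim {ℓ n : ℕ} (t : Fin (n + 1) → ℝ) (σ : Fin (n + 1) → Fin ℓ)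
    (A : (Fin ℓ → E3) → (Fin (n + 1) → E3) → ℂ) (T : (Fin (n + 1) → E3) → ℂ) : Prop :=
  ∀ φ : 𝓢(Fin (n + 1) → E3, ℂ),
    (∀ ε : ℝ, 0 < ε → Integrable (S.term t σ A φ ε)) ∧
    Integrable (fun k : Fin n → E3 => φ (closeUp k) * T (closeUp k)) ∧
    Tendsto (fun ε : ℝ => ∫ x, S.term t σ A φ ε x) (𝓝[>] 0)
      (𝓝 ((2 * Real.pi : ℂ) ^ 3 * ∫ k : Fin n → E3, φ (closeUp k) * T (closeUp k)))

variable {S} {ℓ n : ℕ} {t : Fin (n + 1) → ℝ} {σ : Fin (n + 1) → Fin ℓ}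

lemma System.HasLim.zero : S.HasLim t σ (fun _ _ => 0) (fun _ => 0) := by
  intro φ
  have h : ∀ ε, S.term t σ (fun _ _ => 0) φ ε = fun _ => 0 := by
    intro ε; funext x; simp [System.term]
  simp [h]

lemma System.HasLim.add {A B : (Fin ℓ → E3) → (Fin (n + 1) → E3) → ℂ}
    {T U : (Fin (n + 1) → E3) → ℂ} (hA : S.HasLim t σ A T) (hB : S.HasLim t σ B U) :
    S.HasLim t σ (fun q k => A q k + B q k) (fun k => T k + U k) := by
  intro φ
  obtain ⟨a1, a2, a3⟩ := hA φ
  obtain ⟨b1, b2, b3⟩ := hB φ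
  have h : ∀ ε, S.term t σ (fun q k => A q k + B q k) φ ε
      = fun x => S.term t σ A φ ε x + S.term t σ B φ ε x := by
    intro ε; funext x; simp only [System.term]; ring
  refine ⟨fun ε hε => ?_, ?_, ?_⟩
  · rw [h]; exact (a1 ε hε).add (b1 ε hε)
  · refine (a2.add b2).congr (Eventually.of_forall fun k => ?_)
    simp only [Pi.add_apply]; ring
  · have e1 : ∫ k : Fin n → E3, φ (closeUp k) * (T (closeUp k) + U (closeUp k))
        = (∫ k : Fin n → E3, φ (closeUp k) * T (closeUp k))
          + ∫ k : Fin n → E3, φ (closeUp k) * U (closeUp k) := by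
      rw [← integral_add a2 b2]; simp only [mul_add]
    rw [e1, mul_add]
    refine (a3.add b3).congr' ?_
    filter_upwards [self_mem_nhdsWithin] with ε hε
    rw [h, integral_add (a1 ε hε) (b1 ε hε)]

/-- The multiplier depends on the wave vectors only and is absorbed into the test function, which
remains Schwartz. This is why `HasLim` quantifies over all test functions. -/
lemma System.HasLim.temperate_mul {A : (Fin ℓ → E3) → (Fin (n + 1) → E3) → ℂ}
    {T : (Fin (n + 1) → E3) → ℂ} (hA : S.HasLim t σ A T) {m : (Fin (n + 1) → E3) → ℂ}
    (hm : m.HasTemperateGrowth) :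
    S.HasLim t σ (fun q k => m k * A q k) (fun k => m k * T k) := by
  intro φ
  obtain ⟨a1, a2, a3⟩ := hA (SchwartzMap.smulLeftCLM ℂ m φ)
  have h : ∀ ε, S.term t σ (fun q k => m k * A q k) φ ε
      = S.term t σ A (SchwartzMap.smulLeftCLM ℂ m φ) ε := by
    intro ε; funext x
    simp only [System.term, SchwartzMap.smulLeftCLM_apply_apply hm, smul_eq_mul]; ring
  have e : ∀ k : Fin n → E3, φ (closeUp k) * (m (closeUp k) * T (closeUp k))
      = SchwartzMap.smulLeftCLM ℂ m φ (closeUp k) * T (closeUp k) := by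
    intro k
    simp only [SchwartzMap.smulLeftCLM_apply_apply hm, smul_eq_mul]; ring
  simp only [h, e]
  exact ⟨a1, a2, a3⟩

lemma System.HasLim.const_mul {A : (Fin ℓ → E3) → (Fin (n + 1) → E3) → ℂ}
    {T : (Fin (n + 1) → E3) → ℂ} (hA : S.HasLim t σ A T) (c : ℂ) :
    S.HasLim t σ (fun q k => c * A q k) (fun k => c * T k) :=
  hA.temperate_mul (Function.HasTemperateGrowth.const c)

lemma System.HasLim.sum {ι : Type*} {s : Finset ι}
    {A : ι → (Fin ℓ → E3) → (Fin (n + 1) → E3) → ℂ}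
    {T : ι → (Fin (n + 1) → E3) → ℂ} (h : ∀ i ∈ s, S.HasLim t σ (A i) (T i)) :
    S.HasLim t σ (fun q k => ∑ i ∈ s, A i q k) (fun k => ∑ i ∈ s, T i k) := by
  classical
  induction s using Finset.induction_on with
  | empty => simpa using System.HasLim.zero
  | insert a s ha ih =>
    simp only [Finset.sum_insert ha]
    exact (h a (by simp)).add (ih fun i hi => h i (by simp [hi]))

/-- If every distribution of the fields over the particles has a limit, so has the cumulant. -/
theorem System.cumulantEq_of_hasLim (hgqq : ∀ t, S.ti ≤ t → S.gqq t S.ti = 1) {N : ℕ}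
    {f : Fin (n + 1) → FieldType} (ht : ∀ s, S.ti ≤ t s)
    {U : (Fin (n + 1) → Fin ℓ) → (Fin (n + 1) → E3) → ℂ}
    (h : ∀ σ, S.HasLim t σ (fun q k => S.resp f t σ k *
      ∑ d ∈ diagrams ℓ N, S.amp d q (S.momVec t σ k S.ti)) (U σ))
    {T : (Fin (n + 1) → E3) → ℂ}
    (hT : ∀ k : Fin n → E3, T (closeUp k) = (ℓ.factorial : ℂ)⁻¹ * ∑ σ, U σ (closeUp k)) :
    S.CumulantEq ℓ N f t T := by
  intro φ
  have key : ∀ ε, S.smeared (ℓ := ℓ) N f t φ ε = fun x => (ℓ.factorial : ℂ)⁻¹ *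
      ∑ σ : Fin (n + 1) → Fin ℓ, S.term t σ (fun q k => S.resp f t σ k *
        ∑ d ∈ diagrams ℓ N, S.amp d q (S.momVec t σ k S.ti)) φ ε x := by
    intro ε; funext x
    rw [System.smeared, S.integrand_eq hgqq N f t ht]
    rw [mul_left_comm, Finset.mul_sum]
    congr 1
    refine Finset.sum_congr rfl fun σ _ => ?_
    rw [System.term]
    simp only [Finset.mul_sum, Finset.sum_mul]
    refine Finset.sum_congr rfl fun d _ => ?_
    ring
  have hT' : ∀ k : Fin n → E3, φ (closeUp k) * T (closeUp k) = (ℓ.factorial : ℂ)⁻¹ *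
      ∑ σ, φ (closeUp k) * U σ (closeUp k) := by
    intro k
    rw [hT, Finset.mul_sum, Finset.mul_sum, Finset.mul_sum]
    refine Finset.sum_congr rfl fun σ _ => ?_
    ring
  simp only [key, hT']
  refine ⟨fun ε hε => ?_, ?_, ?_⟩
  · exact (integrable_finsetSum _ fun σ _ => (h σ φ).1 ε hε).const_mul _
  · exact (integrable_finsetSum _ fun σ _ => (h σ φ).2.1).const_mul _
  · rw [mul_assoc]
    refine Tendsto.const_mul _ ?_
    have h1 := (tendsto_finsetSum (Finset.univ : Finset (Fin (n + 1) → Fin ℓ))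
      fun σ _ => (h σ φ).2.2).const_mul (ℓ.factorial : ℂ)⁻¹
    rw [← Finset.mul_sum, ← integral_finsetSum _ fun σ _ => (h σ φ).2.1] at h1
    rw [integral_const_mul, mul_left_comm]
    refine h1.congr' ?_
    filter_upwards [self_mem_nhdsWithin] with ε hε
    rw [integral_const_mul, integral_finsetSum _ fun σ _ => (h σ φ).1 ε hε]

/-! ### Amplitudes depending on positions only -/

/-- The phase-space arguments `q_{σ s} + g_s p_{σ s}`. -/
def System.arg (S : System) (t : Fin n → ℝ) (σ : Fin n → Fin ℓ)
    (z : (Fin ℓ → E3) × (Fin ℓ → E3)) (s : Fin n) : E3 :=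
  z.1 (σ s) + S.g t s • z.2 (σ s)

/-- The smeared integrand of an amplitude depending on positions only, integrated over the wave
vectors. -/
def System.posTerm (S : System) (t : Fin n → ℝ) (σ : Fin n → Fin ℓ) (c : (Fin ℓ → E3) → ℂ)
    (φ : 𝓢(Fin n → E3, ℂ)) (ε : ℝ) (z : (Fin ℓ → E3) × (Fin ℓ → E3)) : ℂ :=
  ((Real.exp (-ε * ∑ j, ‖z.1 j‖ ^ 2) * S.maxwell z.2 : ℝ) : ℂ) * c z.1 *
    fourierPi φ (S.arg t σ z)

lemma integrable_gaussian_pi {ε : ℝ} (hε : 0 < ε) :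
    Integrable (fun q : Fin ℓ → E3 => Real.exp (-ε * ∑ j, ‖q j‖ ^ 2)) := by
  have h : Integrable (fun q : Fin ℓ → E3 => ∏ j, Real.exp (-ε * ‖q j‖ ^ 2)) :=
    Integrable.fintype_prod (f := fun _ v => Real.exp (-ε * ‖v‖ ^ 2))
      fun _ => integrable_exp_neg_mul_norm_sq hε
  refine h.congr (Eventually.of_forall fun q => ?_)
  simp only
  rw [Finset.mul_sum, Real.exp_sum]

lemma System.continuous_phase (S : System) (t : Fin n → ℝ) (σ : Fin n → Fin ℓ) :
    Continuous (fun x : (Fin ℓ → E3) × (Fin ℓ → E3) × (Fin n → E3) =>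
      S.phase t σ x.1 x.2.1 x.2.2) := by
  unfold System.phase
  fun_prop

lemma System.Regular.integrable_term (hS : S.Regular) (t : Fin n → ℝ) (σ : Fin n → Fin ℓ)
    {c : (Fin ℓ → E3) → ℂ} (hc : Continuous c) (hb : ∃ B, ∀ q, ‖c q‖ ≤ B)
    (φ : 𝓢(Fin n → E3, ℂ)) {ε : ℝ} (hε : 0 < ε) :
    Integrable (S.term t σ (fun q _ => c q) φ ε) := by
  obtain ⟨B, hB⟩ := hb
  have hM : Integrable (S.maxwell (ℓ := ℓ)) := by
    simpa using S.integrable_pow_mul_maxwell hS.sigma_pos 0 (ℓ := ℓ)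
  have h1 := ((integrable_gaussian_pi hε (ℓ := ℓ)).ofReal (𝕜 := ℂ)).mul_prod
    ((hM.ofReal (𝕜 := ℂ)).mul_prod (schwartz_integrable φ))
  have h2 := h1.bdd_mul (c := B)
    (f := fun x : (Fin ℓ → E3) × (Fin ℓ → E3) × (Fin n → E3) =>
      c x.1 * S.phase t σ x.1 x.2.1 x.2.2)
    ((hc.comp continuous_fst).mul (S.continuous_phase t σ)).aestronglyMeasurable
    (Eventually.of_forall fun x => by
      rw [norm_mul, System.phase, norm_cexp_neg_I_mul, mul_one]; exact hB _)
  refine h2.congr (Eventually.of_forall fun x => ?_)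
  simp only [System.term, Complex.coe_algebraMap, Complex.ofReal_mul]
  ring

lemma System.integral_term_inner (t : Fin n → ℝ) (σ : Fin n → Fin ℓ) (c : (Fin ℓ → E3) → ℂ)
    (φ : 𝓢(Fin n → E3, ℂ)) (ε : ℝ) (q p : Fin ℓ → E3) :
    ∫ k, S.term t σ (fun q _ => c q) φ ε (q, p, k) = S.posTerm t σ c φ ε (q, p) := by
  rw [System.posTerm, fourierPi, ← integral_const_mul]
  refine integral_congr_ae (Eventually.of_forall fun k => ?_)
  simp only [System.term, System.phase, System.arg]
  ring

lemma System.Regular.integrable_posTerm (hS : S.Regular) (t : Fin n → ℝ) (σ : Fin n → Fin ℓ)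
    {c : (Fin ℓ → E3) → ℂ} (hc : Continuous c) (hb : ∃ B, ∀ q, ‖c q‖ ≤ B)
    (φ : 𝓢(Fin n → E3, ℂ)) {ε : ℝ} (hε : 0 < ε) :
    Integrable (S.posTerm t σ c φ ε) := by
  have h1 := hS.integrable_term t σ hc hb φ hε
  have h2 := (volume_preserving_prodAssoc (α₁ := Fin ℓ → E3) (β₁ := Fin ℓ → E3)
    (γ₁ := Fin n → E3)).integrable_comp_of_integrable h1
  refine (Integrable.integral_prod_left h2).congr (Eventually.of_forall fun z => ?_)
  exact S.integral_term_inner t σ c φ ε z.1 z.2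

instance sigmaFinite_prod_pi {X : Type*} [MeasureSpace X] [SigmaFinite (volume : Measure X)] :
    SigmaFinite (volume : Measure (X × (Fin n → E3))) :=
  Measure.prod.instSigmaFinite

instance sigmaFinite_pi_prod {X : Type*} [MeasureSpace X] [SigmaFinite (volume : Measure X)] :
    SigmaFinite (volume : Measure ((Fin n → E3) × X)) :=
  Measure.prod.instSigmaFinite

lemma System.Regular.integral_term (hS : S.Regular) (t : Fin n → ℝ) (σ : Fin n → Fin ℓ)
    {c : (Fin ℓ → E3) → ℂ} (hc : Continuous c) (hb : ∃ B, ∀ q, ‖c q‖ ≤ B)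
    (φ : 𝓢(Fin n → E3, ℂ)) {ε : ℝ} (hε : 0 < ε) :
    ∫ x, S.term t σ (fun q _ => c q) φ ε x = ∫ z, S.posTerm t σ c φ ε z := by
  have h1 := hS.integrable_term t σ hc hb φ hε
  have hmp := volume_preserving_prodAssoc (α₁ := Fin ℓ → E3) (β₁ := Fin ℓ → E3)
    (γ₁ := Fin n → E3)
  have h2 := hmp.integrable_comp_of_integrable h1
  have h3 := hmp.integral_comp' (S.term t σ (fun q _ => c q) φ ε)
  have h4 : Integrable (fun w : ((Fin ℓ → E3) × (Fin ℓ → E3)) × (Fin n → E3) =>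
    S.term t σ (fun q _ => c q) φ ε (MeasurableEquiv.prodAssoc w)) := h2
  rw [← h3, Measure.volume_eq_prod, integral_prod _ h4]
  refine integral_congr_ae (Eventually.of_forall fun z => ?_)
  exact S.integral_term_inner t σ c φ ε z.1 z.2

/-- The transform of a test function decays in the positions of all particles carrying fields. -/
lemma System.fourierPi_arg_decay (t : Fin n → ℝ) (σ : Fin n → Fin ℓ) (φ : 𝓢(Fin n → E3, ℂ))
    (J : Finset (Fin ℓ)) (hJ : ∀ j ∈ J, ∃ s, σ s = j) :
    ∃ C, 0 ≤ C ∧ ∀ z, ‖fourierPi φ (S.arg t σ z)‖ ≤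
      C * ((1 + ‖z.2‖) ^ (6 * J.card) * ∏ j ∈ J, ((1 + ‖z.1 j‖) ^ 6)⁻¹) := by
  -- Six powers per particle: four suffice for integrability in three dimensions, and up to two may
  -- be lost to the linear growth of Gaussian means.
  obtain ⟨C, hC0, hC⟩ := fourierPi_decay φ (6 * J.card)
  set G : ℝ := ∑ s, |S.g t s| with hG
  have hG0 : 0 ≤ G := Finset.sum_nonneg fun _ _ => abs_nonneg _
  refine ⟨C * (1 + G) ^ (6 * J.card), by positivity, fun z => (hC _).trans ?_⟩
  set x := S.arg t σ z with hx
  have h1 : ∀ j ∈ J, 1 + ‖z.1 j‖ ≤ (1 + ‖x‖) * ((1 + G) * (1 + ‖z.2‖)) := by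
    intro j hj
    obtain ⟨s, rfl⟩ := hJ j hj
    have e : z.1 (σ s) = x s - S.g t s • z.2 (σ s) := by simp [hx, System.arg]
    have h2 : ‖z.1 (σ s)‖ ≤ ‖x‖ + G * ‖z.2‖ := by
      rw [e]
      refine (norm_sub_le _ _).trans (add_le_add (norm_le_pi_norm x s) ?_)
      rw [norm_smul]
      refine mul_le_mul ?_ (norm_le_pi_norm z.2 _) (norm_nonneg _) hG0
      exact Finset.single_le_sum (f := fun s => |S.g t s|) (fun _ _ => abs_nonneg _)
        (Finset.mem_univ s)
    nlinarith [norm_nonneg x, norm_nonneg z.2, mul_nonneg hG0 (norm_nonneg z.2),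
      mul_nonneg (norm_nonneg x) (norm_nonneg z.2),
      mul_nonneg (norm_nonneg x) (mul_nonneg hG0 (norm_nonneg z.2)),
      mul_nonneg (norm_nonneg x) hG0]
  have h3 : ∏ j ∈ J, (1 + ‖z.1 j‖) ^ 6
      ≤ ((1 + ‖x‖) * ((1 + G) * (1 + ‖z.2‖))) ^ (6 * J.card) := by
    rw [pow_mul, ← Finset.prod_const]
    exact Finset.prod_le_prod (fun _ _ => by positivity)
      fun j hj => pow_le_pow_left₀ (by positivity) (h1 j hj) 6
  rw [mul_assoc]
  refine mul_le_mul_of_nonneg_left ?_ hC0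
  have hpos : 0 < ∏ j ∈ J, (1 + ‖z.1 j‖) ^ 6 := Finset.prod_pos fun _ _ => by positivity
  rw [Finset.prod_inv_distrib, ← mul_assoc, ← div_eq_mul_inv, le_div_iff₀ hpos,
    inv_mul_le_iff₀ (by positivity), ← mul_pow, ← mul_pow]
  exact h3

end Limits

/-! ### Particles without fields -/

section Fading

open scoped SchwartzMap

/-- Three positions listed in the order given by a permutation of the particles. -/
def tripleEquiv (e : Equiv.Perm (Fin 3)) : (Fin 3 → E3) ≃ᵐ E3 × E3 × E3 :=
  ((MeasurableEquiv.piCongrLeft (fun _ => E3) e).symm.trans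
    (MeasurableEquiv.piFinSuccAbove (fun _ : Fin 3 => E3) 0)).trans
      (MeasurableEquiv.prodCongr (MeasurableEquiv.refl E3)
        (MeasurableEquiv.piFinTwo (fun _ => E3)))

lemma tripleEquiv_apply (e : Equiv.Perm (Fin 3)) (q : Fin 3 → E3) :
    tripleEquiv e q = (q (e 0), q (e 1), q (e 2)) := rfl

lemma tripleEquiv_symm_apply (e : Equiv.Perm (Fin 3)) (y : E3 × E3 × E3) :
    (tripleEquiv e).symm y (e 0) = y.1 ∧ (tripleEquiv e).symm y (e 1) = y.2.1 ∧
      (tripleEquiv e).symm y (e 2) = y.2.2 := by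
  have h := (tripleEquiv e).apply_symm_apply y
  rw [tripleEquiv_apply] at h
  exact ⟨congrArg Prod.fst h, congrArg (fun z => z.2.1) h, congrArg (fun z => z.2.2) h⟩

lemma measurePreserving_tripleEquiv (e : Equiv.Perm (Fin 3)) :
    MeasurePreserving (tripleEquiv e) := by
  refine (((volume_measurePreserving_piCongrLeft (fun _ => E3) e).symm _).trans
    (volume_preserving_piFinSuccAbove (fun _ : Fin 3 => E3) 0)).trans ?_
  exact MeasurePreserving.prod (MeasurePreserving.id _)
    (volume_preserving_piFinTwo (fun _ => E3))

lemma perm_three_cases (e : Equiv.Perm (Fin 3)) (j : Fin 3) : j = e 0 ∨ j = e 1 ∨ j = e 2 := by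
  have h : e.symm j = 0 ∨ e.symm j = 1 ∨ e.symm j = 2 := by
    generalize e.symm j = i
    fin_cases i <;> simp
  simpa [Equiv.symm_apply_eq] using h

lemma sum_perm_three {M : Type*} [AddCommMonoid M] (e : Equiv.Perm (Fin 3)) (f : Fin 3 → M) :
    ∑ j, f j = f (e 0) + f (e 1) + f (e 2) := by
  rw [← Equiv.sum_comp e, Fin.sum_univ_three]

/-- Phase space with the first particle split off. -/
def splitOne (e : Equiv.Perm (Fin 3)) :
    E3 × (E3 × E3) × (Fin 3 → E3) ≃ᵐ (Fin 3 → E3) × (Fin 3 → E3) :=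
  MeasurableEquiv.prodAssoc.symm.trans
    (MeasurableEquiv.prodCongr (tripleEquiv e).symm (MeasurableEquiv.refl _))

/-- Phase space with the first two particles split off. -/
def splitTwo (e : Equiv.Perm (Fin 3)) :
    (E3 × E3) × E3 × (Fin 3 → E3) ≃ᵐ (Fin 3 → E3) × (Fin 3 → E3) :=
  MeasurableEquiv.prodAssoc.symm.trans
    (MeasurableEquiv.prodCongr (MeasurableEquiv.prodAssoc.trans (tripleEquiv e).symm)
      (MeasurableEquiv.refl _))

lemma measurePreserving_splitOne (e : Equiv.Perm (Fin 3)) : MeasurePreserving (splitOne e) :=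
  (volume_preserving_prodAssoc.symm _).trans
    (MeasurePreserving.prod ((measurePreserving_tripleEquiv e).symm _) (MeasurePreserving.id _))

lemma measurePreserving_splitTwo (e : Equiv.Perm (Fin 3)) : MeasurePreserving (splitTwo e) :=
  (volume_preserving_prodAssoc.symm _).trans
    (MeasurePreserving.prod (volume_preserving_prodAssoc.trans
      ((measurePreserving_tripleEquiv e).symm _)) (MeasurePreserving.id _))

lemma integral_split {X Y Z : Type*} [MeasureSpace X] [MeasureSpace Y] [MeasureSpace Z]
    [SFinite (volume : Measure X)] [SFinite (volume : Measure Y)] {Θ : X × Y ≃ᵐ Z}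
    (hΘ : MeasurePreserving Θ) {F : Z → ℂ} (hF : Integrable F) :
    ∫ z, F z = ∫ y, ∫ x, F (Θ (x, y)) := by
  have h : Integrable (fun w : X × Y => F (Θ w)) := hΘ.integrable_comp_of_integrable hF
  rw [← hΘ.integral_comp' F, Measure.volume_eq_prod, integral_prod_symm _ h]

variable {S : System} {n : ℕ} {t : Fin (n + 1) → ℝ} {σ : Fin (n + 1) → Fin 3}

/-- The bound is uniform in $\varepsilon\ge0$. With `J` the set of occupied particles it serves both
as a dominating function and as an estimate after the empty particles have been integrated out. -/
lemma norm_posTerm_le {ℓ n : ℕ} {t : Fin n → ℝ} {σ : Fin n → Fin ℓ} (φ : 𝓢(Fin n → E3, ℂ))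
    {c : (Fin ℓ → E3) → ℂ} (hb : ∃ B, ∀ q, ‖c q‖ ≤ B) (J : Finset (Fin ℓ))
    (hJ : ∀ j ∈ J, ∃ s, σ s = j) :
    ∃ C, 0 ≤ C ∧ ∀ ε, 0 ≤ ε → ∀ z, ‖S.posTerm t σ c φ ε z‖ ≤
      C * (((1 + ‖z.2‖) ^ (6 * J.card) * S.maxwell z.2) * ∏ j ∈ J, ((1 + ‖z.1 j‖) ^ 6)⁻¹) := by
  obtain ⟨B, hB⟩ := hb
  obtain ⟨C, hC0, hC⟩ := S.fourierPi_arg_decay t σ φ J hJ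
  have hB0 : 0 ≤ B := (norm_nonneg _).trans (hB 0)
  refine ⟨B * C, by positivity, fun ε hε z => ?_⟩
  have hM := S.maxwell_nonneg z.2
  rw [System.posTerm, norm_mul, norm_mul, Complex.norm_real,
    Real.norm_of_nonneg (mul_nonneg (Real.exp_pos _).le hM)]
  have h1 : Real.exp (-ε * ∑ j, ‖z.1 j‖ ^ 2) ≤ 1 := by
    rw [Real.exp_le_one_iff]
    have : 0 ≤ ∑ j, ‖z.1 j‖ ^ 2 := by positivity
    nlinarith
  calc _ ≤ 1 * S.maxwell z.2 * B *
        (C * ((1 + ‖z.2‖) ^ (6 * J.card) * ∏ j ∈ J, ((1 + ‖z.1 j‖) ^ 6)⁻¹)) := by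
        gcongr
        · exact hB _
        · exact hC z
    _ = _ := by ring

lemma integrable_inv_pow_E3 {M : ℕ} (hM : 3 < M) :
    Integrable (fun v : E3 => ((1 + ‖v‖) ^ M)⁻¹) :=
  integrable_inv_one_add_norm_pow M (by rw [finrank_euclideanSpace_fin]; exact hM)

/-- The empty particle `e 0` occurs only in its Gaussian and in the line to `e 2`. Its integral is
at most $\eta(\varepsilon)(1+|q_{e2}|)$, and the rest is integrable against this growth, because `e
1` and `e 2` carry fields. -/
theorem System.Regular.hasLim_of_fading (hS : S.Regular) (e : Equiv.Perm (Fin 3))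
    (h0 : ∀ s, σ s ≠ e 0) (h1 : ∃ s, σ s = e 1) (h2 : ∃ s, σ s = e 2) {C : E3 → ℂ}
    (hC : Fading C) {c : (Fin 3 → E3) → ℂ} (hc : Continuous c) (hb : ∃ B, ∀ q, ‖c q‖ ≤ B)
    (hind : ∀ q v, c (Function.update q (e 0) v) = c q) :
    S.HasLim t σ (fun q _ => C (q (e 0) - q (e 2)) * c q) (fun _ => 0) := by
  intro φ
  have hcont : Continuous (fun q : Fin 3 → E3 => C (q (e 0) - q (e 2)) * c q) :=
    (hC.cont.comp (by fun_prop)).mul hc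
  have hbdd : ∃ B, ∀ q : Fin 3 → E3, ‖C (q (e 0) - q (e 2)) * c q‖ ≤ B := by
    obtain ⟨B1, hB1⟩ := hC.bdd
    obtain ⟨B2, hB2⟩ := hb
    refine ⟨B1 * B2, fun q => ?_⟩
    rw [norm_mul]
    exact mul_le_mul (hB1 _) (hB2 _) (norm_nonneg _) ((norm_nonneg _).trans (hB1 0))
  refine ⟨fun ε hε => hS.integrable_term t σ hcont hbdd φ hε, by simp, ?_⟩
  simp only [mul_zero, integral_zero]
  obtain ⟨η, hη0, hη⟩ := hC.mean
  obtain ⟨K, hK0, hK⟩ := norm_posTerm_le (S := S) (t := t) (σ := σ) φ hb {e 1, e 2} (by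
    intro j hj
    rcases Finset.mem_insert.1 hj with rfl | hj
    · exact h1
    · rw [Finset.mem_singleton.1 hj]; exact h2)
  -- The exponent $5$ at `e 2` is $6-1$: one power pays for the factor $1+|q_{e2}|$.
  set bnd : (E3 × E3) × (Fin 3 → E3) → ℝ := fun w =>
    K * ((((1 + ‖w.1.1‖) ^ 6)⁻¹ * ((1 + ‖w.1.2‖) ^ 5)⁻¹) *
      ((1 + ‖w.2‖) ^ (6 * ({e 1, e 2} : Finset (Fin 3)).card) * S.maxwell w.2)) with hbnd
  have hbi : Integrable bnd :=
    (((integrable_inv_pow_E3 (by norm_num)).mul_prod (integrable_inv_pow_E3 (by norm_num))).mul_prod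
      (S.integrable_pow_mul_maxwell hS.sigma_pos _)).const_mul K
  have hb0 : ∀ w, 0 ≤ bnd w := fun w => by
    have := S.maxwell_nonneg w.2
    positivity
  -- In the second factor the empty particle can be placed at the origin, since neither `c` nor the
  -- transform of `φ` depends on its position.
  have hfac : ∀ ε y w, S.posTerm t σ (fun q => C (q (e 0) - q (e 2)) * c q) φ ε
      (splitOne e (y, w)) = (((Real.exp (-ε * ‖y‖ ^ 2) : ℝ) : ℂ) * C (y - w.1.2)) *
        S.posTerm t σ c φ ε (splitOne e (0, w)) := by
    intro ε y w
    have hq : ∀ v : E3, splitOne e (v, w) = ((tripleEquiv e).symm (v, w.1), w.2) := fun v => rfl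
    obtain ⟨a0, a1, a2⟩ := tripleEquiv_symm_apply e (y, w.1)
    obtain ⟨b0, b1, b2⟩ := tripleEquiv_symm_apply e (0, w.1)
    simp only [hq, System.posTerm]
    set q := (tripleEquiv e).symm (y, w.1)
    set q0 := (tripleEquiv e).symm (0, w.1)
    have hupd : q0 = Function.update q (e 0) 0 := by
      funext j
      rcases perm_three_cases e j with rfl | rfl | rfl
      · simp [b0]
      · rw [b1, Function.update_of_ne (by simp), a1]
      · rw [b2, Function.update_of_ne (by simp), a2]
    have harg : S.arg t σ (q, w.2) = S.arg t σ (q0, w.2) := by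
      funext s
      simp only [System.arg]
      rw [hupd, Function.update_of_ne (h0 s)]
    rw [harg, hupd, hind, ← hupd, sum_perm_three e, sum_perm_three e, a0, a1, a2, b0, b1, b2]
    simp only [norm_zero, mul_add, Real.exp_add]
    simp
    ring
  have hest : ∀ ε, 0 < ε → ‖∫ x, S.term t σ (fun q _ => C (q (e 0) - q (e 2)) * c q) φ ε x‖
      ≤ η ε * ∫ w, bnd w := by
    intro ε hε
    rw [hS.integral_term t σ hcont hbdd φ hε, integral_split (measurePreserving_splitOne e)
      (hS.integrable_posTerm t σ hcont hbdd φ hε), ← integral_const_mul]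
    refine norm_integral_le_of_norm_le (hbi.const_mul _) (Eventually.of_forall fun w => ?_)
    simp only [hfac]
    rw [integral_mul_const, norm_mul]
    obtain ⟨b0, b1, b2⟩ := tripleEquiv_symm_apply e (0, w.1)
    have h3 := hK ε hε.le (splitOne e (0, w))
    change _ ≤ K * (((1 + ‖w.2‖) ^ _ * S.maxwell w.2) *
      ∏ j ∈ {e 1, e 2}, ((1 + ‖(tripleEquiv e).symm (0, w.1) j‖) ^ 6)⁻¹) at h3
    rw [Finset.prod_pair (by simp), b1, b2] at h3
    have h4 := hη ε hε w.1.2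
    have hM := S.maxwell_nonneg w.2
    refine (mul_le_mul h4 h3 (norm_nonneg _) ((norm_nonneg _).trans h4)).trans (le_of_eq ?_)
    simp only [hbnd]
    have : (1 + ‖w.1.2‖) ≠ 0 := by positivity
    field_simp
  refine squeeze_zero_norm' ?_ (by simpa using hη0.mul_const (∫ w, bnd w))
  filter_upwards [self_mem_nhdsWithin] with ε hε using hest ε hε

/-- All fields sit on `e 2`, so for fixed position of `e 2` the integrals over the two empty
particles separate, and each of them fades. -/
theorem System.Regular.hasLim_of_fading_pair (hS : S.Regular) (e : Equiv.Perm (Fin 3))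
    (h0 : ∀ s, σ s = e 2) {C₁ C₂ : E3 → ℂ} (hC₁ : Fading C₁) (hC₂ : Fading C₂) :
    S.HasLim t σ (fun q _ => C₁ (q (e 0) - q (e 2)) * C₂ (q (e 1) - q (e 2))) (fun _ => 0) := by
  intro φ
  obtain ⟨B₁, hB₁⟩ := hC₁.bdd
  obtain ⟨B₂, hB₂⟩ := hC₂.bdd
  obtain ⟨η₁, hη₁0, hη₁⟩ := hC₁.mean
  obtain ⟨η₂, hη₂0, hη₂⟩ := hC₂.mean
  have hcont : Continuous (fun q : Fin 3 → E3 => C₁ (q (e 0) - q (e 2)) * C₂ (q (e 1) - q (e 2))) :=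
    (hC₁.cont.comp (by fun_prop)).mul (hC₂.cont.comp (by fun_prop))
  have hbdd : ∃ B, ∀ q : Fin 3 → E3, ‖C₁ (q (e 0) - q (e 2)) * C₂ (q (e 1) - q (e 2))‖ ≤ B := by
    refine ⟨B₁ * B₂, fun q => ?_⟩
    rw [norm_mul]
    exact mul_le_mul (hB₁ _) (hB₂ _) (norm_nonneg _) ((norm_nonneg _).trans (hB₁ 0))
  refine ⟨fun ε hε => hS.integrable_term t σ hcont hbdd φ hε, by simp, ?_⟩
  simp only [mul_zero, integral_zero]
  obtain ⟨K, hK0, hK⟩ := norm_posTerm_le (S := S) (t := t) (σ := σ) φ (c := fun _ => 1)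
    ⟨1, fun _ => by simp⟩ {e 2} (by
      intro j hj
      rw [Finset.mem_singleton.1 hj]; exact ⟨0, h0 0⟩)
  -- Here the exponent is $6-2=4$, since both means grow linearly in $q_{e2}$; it still exceeds the
  -- dimension.
  set bnd : E3 × (Fin 3 → E3) → ℝ := fun w =>
    K * (((1 + ‖w.1‖) ^ 4)⁻¹ *
      ((1 + ‖w.2‖) ^ (6 * ({e 2} : Finset (Fin 3)).card) * S.maxwell w.2)) with hbnd
  have hbi : Integrable bnd :=
    ((integrable_inv_pow_E3 (by norm_num)).mul_prod
      (S.integrable_pow_mul_maxwell hS.sigma_pos _)).const_mul K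
  have hfac : ∀ ε (y : E3 × E3) w,
      S.posTerm t σ (fun q => C₁ (q (e 0) - q (e 2)) * C₂ (q (e 1) - q (e 2))) φ ε
      (splitTwo e (y, w)) = ((((Real.exp (-ε * ‖y.1‖ ^ 2) : ℝ) : ℂ) * C₁ (y.1 - w.1)) *
        (((Real.exp (-ε * ‖y.2‖ ^ 2) : ℝ) : ℂ) * C₂ (y.2 - w.1))) *
        S.posTerm t σ (fun _ => 1) φ ε (splitTwo e (0, w)) := by
    intro ε y w
    have hq : ∀ v : E3 × E3, splitTwo e (v, w) = ((tripleEquiv e).symm (v.1, v.2, w.1), w.2) :=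
      fun v => rfl
    obtain ⟨a0, a1, a2⟩ := tripleEquiv_symm_apply e (y.1, y.2, w.1)
    obtain ⟨b0, b1, b2⟩ := tripleEquiv_symm_apply e (0, 0, w.1)
    simp only [hq, System.posTerm, Prod.fst_zero, Prod.snd_zero]
    set q := (tripleEquiv e).symm (y.1, y.2, w.1)
    set q0 := (tripleEquiv e).symm (0, 0, w.1)
    have harg : S.arg t σ (q, w.2) = S.arg t σ (q0, w.2) := by
      funext s
      simp only [System.arg, h0, a2, b2]
    rw [harg, sum_perm_three e, sum_perm_three e, a0, a1, a2, b0, b1, b2]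
    simp only [norm_zero, mul_add, Real.exp_add]
    simp
    ring
  have hest : ∀ ε, 0 < ε → ‖∫ x, S.term t σ
      (fun q _ => C₁ (q (e 0) - q (e 2)) * C₂ (q (e 1) - q (e 2))) φ ε x‖
      ≤ (η₁ ε * η₂ ε) * ∫ w, bnd w := by
    intro ε hε
    rw [hS.integral_term t σ hcont hbdd φ hε, integral_split (measurePreserving_splitTwo e)
      (hS.integrable_posTerm t σ hcont hbdd φ hε), ← integral_const_mul]
    refine norm_integral_le_of_norm_le (hbi.const_mul _) (Eventually.of_forall fun w => ?_)
    simp only [hfac]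
    rw [integral_mul_const, norm_mul, Measure.volume_eq_prod, integral_prod_mul
      (fun y : E3 => ((Real.exp (-ε * ‖y‖ ^ 2) : ℝ) : ℂ) * C₁ (y - w.1))
      (fun y : E3 => ((Real.exp (-ε * ‖y‖ ^ 2) : ℝ) : ℂ) * C₂ (y - w.1)), norm_mul]
    obtain ⟨b0, b1, b2⟩ := tripleEquiv_symm_apply e (0, 0, w.1)
    have h3 := hK ε hε.le (splitTwo e (0, w))
    change _ ≤ K * (((1 + ‖w.2‖) ^ _ * S.maxwell w.2) *
      ∏ j ∈ {e 2}, ((1 + ‖(tripleEquiv e).symm (0, 0, w.1) j‖) ^ 6)⁻¹) at h3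
    rw [Finset.prod_singleton, b2] at h3
    have h4 := hη₁ ε hε w.1
    have h5 := hη₂ ε hε w.1
    have h6 := mul_le_mul h4 h5 (norm_nonneg _) ((norm_nonneg _).trans h4)
    have hM := S.maxwell_nonneg w.2
    refine (mul_le_mul h6 h3 (norm_nonneg _)
      ((mul_nonneg (norm_nonneg _) (norm_nonneg _)).trans h6)).trans (le_of_eq ?_)
    simp only [hbnd]
    have : (1 + ‖w.1‖) ≠ 0 := by positivity
    field_simp
  refine squeeze_zero_norm' ?_ (by simpa using (hη₁0.mul hη₂0).mul_const (∫ w, bnd w))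
  filter_upwards [self_mem_nhdsWithin] with ε hε using hest ε hε

end Fading

/-! ### Three particles with fields -/

section Occupied

open scoped SchwartzMap FourierTransform

lemma inner_withLp_triple (v w : WithLp 2 (E3 × WithLp 2 (E3 × E3))) :
    inner ℝ v w = inner ℝ v.fst w.fst + (inner ℝ v.snd.fst w.snd.fst
      + inner ℝ v.snd.snd w.snd.snd) := by
  rw [WithLp.prod_inner_apply, WithLp.prod_inner_apply]
  rfl

instance : (volume : Measure (E3 × E3)).IsAddHaarMeasure :=
  inferInstanceAs ((volume : Measure E3).prod volume).IsAddHaarMeasure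

instance : (volume : Measure (E3 × E3 × E3)).IsAddHaarMeasure :=
  Measure.prod.instIsAddHaarMeasure _ _

/-- The scalar product on triples of vectors. -/
def dotTriple (u v : E3 × E3 × E3) : ℝ :=
  inner ℝ u.1 v.1 + (inner ℝ u.2.1 v.2.1 + inner ℝ u.2.2 v.2.2)

lemma dotTriple_smul_right (c : ℝ) (u v : E3 × E3 × E3) :
    dotTriple u (c • v) = c * dotTriple u v := by
  simp only [dotTriple, Prod.smul_fst, Prod.smul_snd, inner_smul_right]
  ring

lemma dotTriple_comm (u v : E3 × E3 × E3) : dotTriple u v = dotTriple v u := by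
  simp only [dotTriple, real_inner_comm]

/-- Fourier inversion for functions of three vectors. -/
theorem fourier_inversion_triple {m : E3 × E3 × E3 → ℂ} (hc : Continuous m) (hi : Integrable m)
    {F : E3 × E3 × E3 → ℂ}
    (hF : ∀ y, F y = ∫ κ, m κ * Complex.exp (-Complex.I * ((dotTriple κ y : ℝ) : ℂ)))
    (hFi : Integrable F) (c : E3 × E3 × E3) :
    ∫ y, F y * Complex.exp (Complex.I * ((dotTriple c y : ℝ) : ℂ))
      = ((2 * Real.pi : ℝ) : ℂ) ^ 9 * m c := by
  let V := WithLp 2 (E3 × WithLp 2 (E3 × E3))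
  let T : V ≃ᵐ E3 × E3 × E3 := (MeasurableEquiv.toLp 2 (E3 × WithLp 2 (E3 × E3))).symm.trans
    (MeasurableEquiv.prodCongr (MeasurableEquiv.refl _) (MeasurableEquiv.toLp 2 (E3 × E3)).symm)
  have hT : MeasurePreserving T :=
    (WithLp.volume_preserving_symm_measurableEquiv_toLp_prod E3 (WithLp 2 (E3 × E3))).trans
      (MeasurePreserving.prod (MeasurePreserving.id _)
        (WithLp.volume_preserving_symm_measurableEquiv_toLp_prod E3 E3))
  have hTc : Continuous T := by
    change Continuous fun v : V => (v.fst, v.snd.fst, v.snd.snd)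
    fun_prop
  have hTi : ∀ v w : V, inner ℝ v w = dotTriple (T v) (T w) := inner_withLp_triple
  let m' : V → ℂ := fun v => m (T v)
  have hm'c : Continuous m' := hc.comp hTc
  have hm'i : Integrable m' := hT.integrable_comp_of_integrable hi
  have hFour : ∀ w, 𝓕 m' w = F ((2 * Real.pi) • T w) := by
    intro w
    rw [Real.fourier_eq', hF, ← hT.integral_comp']
    refine integral_congr_ae (Eventually.of_forall fun v => ?_)
    simp only [m', smul_eq_mul, hTi, dotTriple_smul_right]
    rw [mul_comm]
    congr 2
    push_cast
    ring
  have hF2 : Integrable (fun y : E3 × E3 × E3 => F ((2 * Real.pi) • y)) :=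
    hFi.comp_smul (by positivity)
  have hm'f : Integrable (𝓕 m') := by
    have : 𝓕 m' = fun w => F ((2 * Real.pi) • T w) := funext hFour
    rw [this]
    exact hT.integrable_comp_of_integrable hF2
  have hinv := hm'c.fourierInv_fourier_eq hm'i hm'f
  have h1 := congrFun hinv (T.symm c)
  rw [Real.fourierInv_eq'] at h1
  simp only [hFour, hTi, T.apply_symm_apply, m'] at h1
  have h2 := hT.integral_comp' (fun y =>
    Complex.exp (((2 * Real.pi * dotTriple y c : ℝ) : ℂ) * Complex.I) • F ((2 * Real.pi) • y))
  rw [h2] at h1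
  -- Rescaling by $2\pi$ passes between the two conventions for the Fourier transform; the Jacobian
  -- in real dimension $9$ gives the factor $(2\pi)^9$.
  have h3 := Measure.integral_comp_smul (volume : Measure (E3 × E3 × E3))
    (fun y => F y * Complex.exp (Complex.I * ((dotTriple c y : ℝ) : ℂ))) (2 * Real.pi)
  have hfin : Module.finrank ℝ (E3 × E3 × E3) = 9 := by simp
  rw [hfin, abs_of_nonneg (by positivity)] at h3
  have h4 : ∫ y, Complex.exp (((2 * Real.pi * dotTriple y c : ℝ) : ℂ) * Complex.I) •
      F ((2 * Real.pi) • y) = ∫ y, F ((2 * Real.pi) • y) *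
        Complex.exp (Complex.I * ((dotTriple c ((2 * Real.pi) • y) : ℝ) : ℂ)) := by
    refine integral_congr_ae (Eventually.of_forall fun y => ?_)
    simp only [smul_eq_mul, dotTriple_smul_right, dotTriple_comm c y]
    rw [mul_comm, mul_comm Complex.I]
  rw [h4, h3] at h1
  rw [← h1, Complex.real_smul]
  push_cast
  have hpi : (Real.pi : ℂ) ≠ 0 := by exact_mod_cast Real.pi_ne_zero
  field_simp

/-! ### Coordinates adapted to a distribution of the fields -/

/-- Translation of the second component by a function of the first one. -/
def shear {X Y : Type*} [MeasurableSpace X] [MeasurableSpace Y] [AddGroup Y] [MeasurableAdd₂ Y]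
    [MeasurableSub₂ Y] (f : X → Y) (hf : Measurable f) : X × Y ≃ᵐ X × Y where
  toFun z := (z.1, z.2 - f z.1)
  invFun z := (z.1, z.2 + f z.1)
  left_inv z := by simp
  right_inv z := by simp
  measurable_toFun := by
    have : Measurable fun z : X × Y => (z.1, z.2 - f z.1) := by fun_prop
    exact this
  measurable_invFun := by
    have : Measurable fun z : X × Y => (z.1, z.2 + f z.1) := by fun_prop
    exact this

lemma measurePreserving_shear {X Y : Type*} [MeasureSpace X] [MeasureSpace Y] [AddGroup Y]
    [MeasurableAdd₂ Y] [MeasurableSub₂ Y] [SFinite (volume : Measure X)]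
    [SFinite (volume : Measure Y)] [(volume : Measure Y).IsAddRightInvariant]
    (f : X → Y) (hf : Measurable f) : MeasurePreserving (shear f hf) := by
  have h : Measurable (Function.uncurry fun (x : X) (y : Y) => y - f x) := by
    unfold Function.uncurry
    fun_prop
  exact (MeasurePreserving.id (volume : Measure X)).skew_product h
    (Eventually.of_forall fun x => map_sub_right_eq_self volume (f x))

/-- The first two components of a family, and the others. -/
def pairEquiv (m : ℕ) : (Fin (m + 2) → E3) ≃ᵐ (Fin m → E3) × (E3 × E3) :=
  (((MeasurableEquiv.piFinSuccAbove (fun _ : Fin (m + 2) => E3) 0).trans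
    (MeasurableEquiv.prodCongr (MeasurableEquiv.refl E3)
      (MeasurableEquiv.piFinSuccAbove (fun _ : Fin (m + 1) => E3) 0))).trans
        MeasurableEquiv.prodAssoc.symm).trans MeasurableEquiv.prodComm

lemma pairEquiv_apply {m : ℕ} (k : Fin (m + 2) → E3) :
    pairEquiv m k = (fun j => k j.succ.succ, k 0, k 1) := rfl

lemma measurePreserving_pairEquiv (m : ℕ) : MeasurePreserving (pairEquiv m) := by
  refine (((volume_preserving_piFinSuccAbove (fun _ : Fin (m + 2) => E3) 0).trans
    ?_).trans (volume_preserving_prodAssoc.symm _)).trans Measure.measurePreserving_swap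
  exact MeasurePreserving.prod (MeasurePreserving.id _)
    (volume_preserving_piFinSuccAbove (fun _ : Fin (m + 1) => E3) 0)

/-- The first two and the last component of a family, and the others. -/
def outerEquiv (m : ℕ) : (Fin (m + 3) → E3) ≃ᵐ (Fin m → E3) × (E3 × E3 × E3) :=
  ((((MeasurableEquiv.piFinSuccAbove (fun _ : Fin (m + 3) => E3) (Fin.last _)).trans
    (MeasurableEquiv.prodCongr (MeasurableEquiv.refl E3) (pairEquiv m))).trans
      MeasurableEquiv.prodComm).trans MeasurableEquiv.prodAssoc).trans
        (MeasurableEquiv.prodCongr (MeasurableEquiv.refl _) MeasurableEquiv.prodAssoc)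

lemma outerEquiv_apply {m : ℕ} (k : Fin (m + 3) → E3) :
    outerEquiv m k = (fun j => k j.succ.succ.castSucc, k 0, k 1, k (Fin.last _)) := by
  have h : ∀ j, (Fin.last (m + 2)).succAbove j = j.castSucc := fun j => Fin.succAbove_last_apply j
  have e : outerEquiv m k = (fun j => k ((Fin.last (m + 2)).succAbove j.succ.succ),
    k ((Fin.last (m + 2)).succAbove 0), k ((Fin.last (m + 2)).succAbove 1), k (Fin.last _)) := rfl
  rw [e]
  simp only [h]
  rfl

lemma measurePreserving_outerEquiv (m : ℕ) : MeasurePreserving (outerEquiv m) := by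
  refine ((((volume_preserving_piFinSuccAbove (fun _ : Fin (m + 3) => E3) (Fin.last _)).trans
    ?_).trans Measure.measurePreserving_swap).trans volume_preserving_prodAssoc).trans ?_
  · exact MeasurePreserving.prod (MeasurePreserving.id _) (measurePreserving_pairEquiv m)
  · exact MeasurePreserving.prod (MeasurePreserving.id _) volume_preserving_prodAssoc

/-- The total wave vector acting on each particle. -/
def waveSum {n ℓ : ℕ} (σ : Fin n → Fin ℓ) (k : Fin n → E3) (j : Fin ℓ) : E3 :=
  ∑ s, if σ s = j then k s else 0

lemma sum_inner_comp {n ℓ : ℕ} (σ : Fin n → Fin ℓ) (k : Fin n → E3) (q : Fin ℓ → E3) :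
    ∑ s, inner ℝ (k s) (q (σ s)) = ∑ j, inner ℝ (waveSum σ k j) (q j) := by
  simp only [waveSum, sum_inner]
  rw [Finset.sum_comm]
  refine Finset.sum_congr rfl fun s _ => ?_
  rw [Finset.sum_eq_single (σ s)]
  · simp
  · intro j _ hj
    simp [Ne.symm hj]
  · simp

lemma System.sum_inner_momVec (S : System) {n ℓ : ℕ} (t : Fin n → ℝ) (σ : Fin n → Fin ℓ)
    (k : Fin n → E3) (p : Fin ℓ → E3) :
    ∑ s, inner ℝ (k s) (S.g t s • p (σ s)) = ∑ j, inner ℝ (S.momVec t σ k S.ti j) (p j) := by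
  have h := sum_inner_comp σ (fun s => S.g t s • k s) p
  simp only [real_inner_smul_left] at h
  simp only [real_inner_smul_right]
  exact h

variable {m : ℕ}

/-- The part of the wave vector acting on particle `j` not due to the first two and the last
field. -/
def restSum (σ : Fin (m + 3) → Fin 3) (j : Fin 3) (r : Fin m → E3) : E3 :=
  ∑ i : Fin m, if σ i.succ.succ.castSucc = j then r i else 0

lemma continuous_restSum (σ : Fin (m + 3) → Fin 3) (j : Fin 3) : Continuous (restSum σ j) := by
  refine continuous_finsetSum _ fun i _ => ?_
  split_ifs <;> fun_prop

/-- Wave vectors on the hyperplane `∑ k = 0` in terms of the wave vectors acting on the first two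
particles. -/
def hyperCfg (e : Equiv.Perm (Fin 3)) (σ : Fin (m + 3) → Fin 3) :
    (Fin m → E3) × (E3 × E3) ≃ᵐ (Fin (m + 2) → E3) :=
  (shear (fun r => (restSum σ (e 0) r, restSum σ (e 1) r))
    ((continuous_restSum σ _).prodMk (continuous_restSum σ _)).measurable).trans (pairEquiv m).symm

/-- Wave vectors in terms of the wave vectors acting on the three particles. -/
def fullCfg (e : Equiv.Perm (Fin 3)) (σ : Fin (m + 3) → Fin 3) :
    (Fin m → E3) × (E3 × E3 × E3) ≃ᵐ (Fin (m + 3) → E3) :=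
  (shear (fun r => (restSum σ (e 0) r, restSum σ (e 1) r, restSum σ (e 2) r))
    ((continuous_restSum σ _).prodMk ((continuous_restSum σ _).prodMk
      (continuous_restSum σ _))).measurable).trans (outerEquiv m).symm

lemma measurePreserving_hyperCfg (e : Equiv.Perm (Fin 3)) (σ : Fin (m + 3) → Fin 3) :
    MeasurePreserving (hyperCfg e σ) :=
  (measurePreserving_shear _ _).trans ((measurePreserving_pairEquiv m).symm _)

lemma measurePreserving_fullCfg (e : Equiv.Perm (Fin 3)) (σ : Fin (m + 3) → Fin 3) :
    MeasurePreserving (fullCfg e σ) :=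
  (measurePreserving_shear _ _).trans ((measurePreserving_outerEquiv m).symm _)

lemma hyperCfg_eq (e : Equiv.Perm (Fin 3)) (σ : Fin (m + 3) → Fin 3)
    (z : (Fin m → E3) × (E3 × E3)) :
    hyperCfg e σ z = Fin.cons (z.2.1 - restSum σ (e 0) z.1)
      (Fin.cons (z.2.2 - restSum σ (e 1) z.1) z.1) := by
  refine (pairEquiv m).injective ?_
  rw [pairEquiv_apply]
  exact (pairEquiv m).apply_symm_apply _

lemma fullCfg_eq (e : Equiv.Perm (Fin 3)) (σ : Fin (m + 3) → Fin 3)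
    (z : (Fin m → E3) × (E3 × E3 × E3)) :
    fullCfg e σ z = Fin.snoc (α := fun _ => E3) (Fin.cons (z.2.1 - restSum σ (e 0) z.1)
      (Fin.cons (z.2.2.1 - restSum σ (e 1) z.1) z.1) : Fin (m + 2) → E3)
      (z.2.2.2 - restSum σ (e 2) z.1) := by
  refine (outerEquiv m).injective ?_
  refine ((outerEquiv m).apply_symm_apply _).trans ?_
  rw [outerEquiv_apply]
  have h0 : (0 : Fin (m + 3)) = Fin.castSucc 0 := rfl
  have h1 : (1 : Fin (m + 3)) = Fin.castSucc 1 := rfl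
  rw [h0, h1]
  simp only [Fin.snoc_castSucc, Fin.snoc_last]
  rfl

lemma continuous_fullCfg (e : Equiv.Perm (Fin 3)) (σ : Fin (m + 3) → Fin 3) :
    Continuous (fullCfg e σ) := by
  have h := fun j => continuous_restSum σ j
  rw [continuous_pi_iff]
  intro i
  have hi : ∀ z, fullCfg e σ z i = Fin.snoc (α := fun _ => E3)
      (Fin.cons (z.2.1 - restSum σ (e 0) z.1)
      (Fin.cons (z.2.2.1 - restSum σ (e 1) z.1) z.1) : Fin (m + 2) → E3)
      (z.2.2.2 - restSum σ (e 2) z.1) i := fun z => congrFun (fullCfg_eq e σ z) i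
  simp only [hi]
  refine Fin.lastCases ?_ (fun i => ?_) i
  · simp only [Fin.snoc_last]
    exact (continuous_snd.comp (continuous_snd.comp continuous_snd)).sub
      ((h _).comp continuous_fst)
  · simp only [Fin.snoc_castSucc]
    refine Fin.cases ?_ (fun i => Fin.cases ?_ (fun i => ?_) i) i
    · simp only [Fin.cons_zero]
      exact (continuous_fst.comp continuous_snd).sub ((h _).comp continuous_fst)
    · simp only [Fin.cons_succ, Fin.cons_zero]
      exact (continuous_fst.comp (continuous_snd.comp continuous_snd)).sub
        ((h _).comp continuous_fst)
    · simp only [Fin.cons_succ]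
      fun_prop

variable {e : Equiv.Perm (Fin 3)} {σ : Fin (m + 3) → Fin 3}

/-- The fields `0`, `1` and `Fin.last` represent the three particles. The shear has subtracted from
each of them what the remaining fields add to the same particle, so the totals are the free
coordinates. -/
lemma waveSum_fullCfg (h0 : σ 0 = e 0) (h1 : σ 1 = e 1) (h2 : σ (Fin.last _) = e 2)
    (z : (Fin m → E3) × (E3 × E3 × E3)) :
    waveSum σ (fullCfg e σ z) (e 0) = z.2.1 ∧ waveSum σ (fullCfg e σ z) (e 1) = z.2.2.1 ∧
      waveSum σ (fullCfg e σ z) (e 2) = z.2.2.2 := by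
  have hz0 : (0 : Fin (m + 3)) = Fin.castSucc 0 := rfl
  have hz1 : (1 : Fin (m + 3)) = (Fin.succ 0).castSucc := rfl
  have key : ∀ j, waveSum σ (fullCfg e σ z) j
      = ((if e 0 = j then z.2.1 - restSum σ (e 0) z.1 else 0) +
        ((if e 1 = j then z.2.2.1 - restSum σ (e 1) z.1 else 0) + restSum σ j z.1)) +
        (if e 2 = j then z.2.2.2 - restSum σ (e 2) z.1 else 0) := by
    intro j
    rw [waveSum, fullCfg_eq, Fin.sum_univ_castSucc, Fin.sum_univ_succ, Fin.sum_univ_succ]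
    rw [hz0] at h0
    rw [hz1] at h1
    simp only [Fin.snoc_castSucc, Fin.snoc_last, h2, h0, h1, Fin.cons_zero, Fin.cons_succ]
    rfl
  refine ⟨?_, ?_, ?_⟩ <;> rw [key] <;> simp

/-- Every remaining field acts on exactly one of the three particles, so total momentum conservation
reduces to $\kappa_2=-(\kappa_0+\kappa_1)$. -/
lemma closeUp_hyperCfg (z : (Fin m → E3) × (E3 × E3)) :
    closeUp (hyperCfg e σ z) = fullCfg e σ (z.1, z.2.1, z.2.2, -(z.2.1 + z.2.2)) := by
  have hsum : ∑ i, z.1 i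
      = restSum σ (e 0) z.1 + restSum σ (e 1) z.1 + restSum σ (e 2) z.1 := by
    simp only [restSum, ← Finset.sum_add_distrib]
    refine Finset.sum_congr rfl fun i _ => ?_
    rcases perm_three_cases e (σ i.succ.succ.castSucc) with h | h | h <;> simp only [h] <;> simp
  rw [closeUp, fullCfg_eq, hyperCfg_eq]
  congr 1
  rw [Fin.sum_univ_succ, Fin.sum_univ_succ]
  simp only [Fin.cons_zero, Fin.cons_succ]
  rw [hsum]
  abel

lemma norm_le_norm_fullCfg (z : (Fin m → E3) × (E3 × E3 × E3)) :
    ‖z.1‖ ≤ ‖fullCfg e σ z‖ := by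
  refine (pi_norm_le_iff_of_nonneg (norm_nonneg _)).2 fun i => ?_
  have h : fullCfg e σ z i.succ.succ.castSucc = z.1 i := by
    rw [fullCfg_eq, Fin.snoc_castSucc]
    rfl
  rw [← h]
  exact norm_le_pi_norm _ _

end Occupied

/-! ### Tree amplitudes when every particle carries a field -/

section Core

open scoped SchwartzMap

variable {S : System} {m : ℕ} {e : Equiv.Perm (Fin 3)} {σ : Fin (m + 3) → Fin 3}
  {t : Fin (m + 3) → ℝ}

/-- The Gaussian damping factor due to the momentum dispersion. -/
def System.damping (S : System) {n ℓ : ℕ} (t : Fin n → ℝ) (σ : Fin n → Fin ℓ)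
    (k : Fin n → E3) : ℝ :=
  Real.exp (-(S.sigma ^ 2 / 2) * ∑ j, ‖S.momVec t σ k S.ti j‖ ^ 2)

lemma System.continuous_momVec (S : System) {n ℓ : ℕ} (t : Fin n → ℝ) (σ : Fin n → Fin ℓ)
    (t' : ℝ) (j : Fin ℓ) : Continuous fun k => S.momVec t σ k t' j := by
  unfold System.momVec
  refine continuous_finsetSum _ fun s _ => ?_
  split_ifs <;> fun_prop

lemma System.continuous_damping (S : System) {n ℓ : ℕ} (t : Fin n → ℝ) (σ : Fin n → Fin ℓ) :
    Continuous (S.damping t σ) := by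
  have h := fun j => S.continuous_momVec t σ S.ti j
  unfold System.damping
  fun_prop

lemma System.damping_nonneg (S : System) {n ℓ : ℕ} (t : Fin n → ℝ) (σ : Fin n → Fin ℓ)
    (k : Fin n → E3) : 0 ≤ S.damping t σ k := (Real.exp_pos _).le

lemma System.damping_le_one (S : System) {n ℓ : ℕ} (t : Fin n → ℝ) (σ : Fin n → Fin ℓ)
    (k : Fin n → E3) : S.damping t σ k ≤ 1 := by
  rw [System.damping, Real.exp_le_one_iff]
  have : 0 ≤ (S.sigma ^ 2 / 2) * ∑ j, ‖S.momVec t σ k S.ti j‖ ^ 2 := by positivity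
  linarith

/-- Decay of a test function in the coordinates not fixed by the total wave vectors. -/
lemma schwartz_fullCfg_decay (e : Equiv.Perm (Fin 3)) (σ : Fin (m + 3) → Fin 3)
    (φ : 𝓢(Fin (m + 3) → E3, ℂ)) (M : ℕ) :
    ∃ C, 0 ≤ C ∧ ∀ z, ‖φ (fullCfg e σ z)‖ ≤ C * ((1 + ‖z.1‖) ^ M)⁻¹ := by
  obtain ⟨C, hC0, hC⟩ := schwartz_decay φ M
  refine ⟨C, hC0, fun z => (hC _).trans ?_⟩
  have := norm_le_norm_fullCfg (e := e) (σ := σ) z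
  gcongr

lemma integrable_inv_pow_pi (m : ℕ) :
    Integrable (fun r : Fin m → E3 => ((1 + ‖r‖) ^ (3 * m + 1))⁻¹) :=
  integrable_inv_one_add_norm_pow _ (by
    rw [Module.finrank_pi_fintype]
    simp
    omega)

/-- The point of the hyperplane `∑ k = 0` with given total wave vectors. -/
def onShell (h : E3 × E3) : E3 × E3 × E3 := (h.1, h.2, -(h.1 + h.2))

lemma continuous_onShell : Continuous onShell := by
  unfold onShell
  fun_prop

/-- `W` supplies integrability in the two free total wave vectors, and the decay of `φ` supplies it
in the remaining coordinates. Multiplying and dividing by $(1+\|r\|)^{3m+1}$ separates the two. -/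
lemma integrable_onShell (e : Equiv.Perm (Fin 3)) (σ : Fin (m + 3) → Fin 3)
    (φ : 𝓢(Fin (m + 3) → E3, ℂ)) {W : E3 × E3 → ℂ} (hW : Integrable W)
    {D : (Fin (m + 3) → E3) → ℝ} (hD : Continuous D) (hD1 : ∀ k, ‖D k‖ ≤ 1) :
    Integrable (fun z : (Fin m → E3) × (E3 × E3) =>
      φ (fullCfg e σ (z.1, onShell z.2)) * (W z.2 * D (fullCfg e σ (z.1, onShell z.2)))) := by
  obtain ⟨C, hC0, hC⟩ := schwartz_fullCfg_decay e σ φ (3 * m + 1)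
  have h1 := ((integrable_inv_pow_pi m).ofReal (𝕜 := ℂ)).mul_prod hW
  have hcfg : Continuous fun z : (Fin m → E3) × (E3 × E3) => fullCfg e σ (z.1, onShell z.2) :=
    (continuous_fullCfg e σ).comp (continuous_fst.prodMk (continuous_onShell.comp continuous_snd))
  have h2 := h1.bdd_mul (c := C) (f := fun z : (Fin m → E3) × (E3 × E3) =>
      (((1 + ‖z.1‖) ^ (3 * m + 1) : ℝ) : ℂ) * (φ (fullCfg e σ (z.1, onShell z.2)) *
        D (fullCfg e σ (z.1, onShell z.2)))) ?_ ?_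
  · refine h2.congr (Eventually.of_forall fun z => ?_)
    have : (((1 + ‖z.1‖) ^ (3 * m + 1) : ℝ) : ℂ) ≠ 0 := by
      exact_mod_cast (by positivity : (0 : ℝ) < (1 + ‖z.1‖) ^ (3 * m + 1)).ne'
    simp only [Complex.coe_algebraMap, Complex.ofReal_inv]
    field_simp
  · refine Continuous.aestronglyMeasurable ?_
    have h3 := φ.continuous.comp hcfg
    have h4 := Complex.continuous_ofReal.comp (hD.comp hcfg)
    have h5 : Continuous fun z : (Fin m → E3) × (E3 × E3) =>
      (((1 + ‖z.1‖) ^ (3 * m + 1) : ℝ) : ℂ) := by fun_prop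
    exact h5.mul (h3.mul h4)
  · refine Eventually.of_forall fun z => ?_
    rw [norm_mul, norm_mul, Complex.norm_real, Complex.norm_real,
      Real.norm_of_nonneg (by positivity)]
    have h3 := hC (z.1, onShell z.2)
    have h4 := hD1 (fullCfg e σ (z.1, onShell z.2))
    calc _ ≤ (1 + ‖z.1‖) ^ (3 * m + 1) * ((C * ((1 + ‖z.1‖) ^ (3 * m + 1))⁻¹) * 1) := by
          gcongr
      _ = C := by
          have : (1 + ‖z.1‖) ^ (3 * m + 1) ≠ 0 := by positivity
          field_simp

/-- The phase due to the initial momenta. -/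
def System.momPhase (S : System) {n ℓ : ℕ} (t : Fin n → ℝ) (σ : Fin n → Fin ℓ)
    (z : (Fin n → E3) × (Fin ℓ → E3)) : ℂ :=
  Complex.exp (-Complex.I * ((∑ j, inner ℝ (S.momVec t σ z.1 S.ti j) (z.2 j) : ℝ) : ℂ))

lemma System.continuous_momPhase (S : System) {n ℓ : ℕ} (t : Fin n → ℝ) (σ : Fin n → Fin ℓ) :
    Continuous (S.momPhase t σ) := by
  have h := fun j => (S.continuous_momVec t σ S.ti j).comp
    (continuous_fst (X := Fin n → E3) (Y := Fin ℓ → E3))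
  simp only [Function.comp_def] at h
  unfold System.momPhase
  fun_prop

lemma System.norm_momPhase (S : System) {n ℓ : ℕ} (t : Fin n → ℝ) (σ : Fin n → Fin ℓ)
    (z : (Fin n → E3) × (Fin ℓ → E3)) : ‖S.momPhase t σ z‖ = 1 := norm_cexp_neg_I_mul _

/-- A test function with the momentum phases, in adapted coordinates. -/
def System.phased (S : System) (t : Fin (m + 3) → ℝ) (e : Equiv.Perm (Fin 3))
    (σ : Fin (m + 3) → Fin 3) (φ : 𝓢(Fin (m + 3) → E3, ℂ)) (p : Fin 3 → E3)
    (z : (Fin m → E3) × (E3 × E3 × E3)) : ℂ :=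
  φ (fullCfg e σ z) * S.momPhase t σ (fullCfg e σ z, p)

lemma System.continuous_phased (S : System) (t : Fin (m + 3) → ℝ) (e : Equiv.Perm (Fin 3))
    (σ : Fin (m + 3) → Fin 3) (φ : 𝓢(Fin (m + 3) → E3, ℂ)) (p : Fin 3 → E3) :
    Continuous (S.phased t e σ φ p) := by
  have h1 : Continuous fun z => φ (fullCfg e σ z) := φ.continuous.comp (continuous_fullCfg e σ)
  have h2 : Continuous fun z => S.momPhase t σ (fullCfg e σ z, p) :=
    (S.continuous_momPhase t σ).comp ((continuous_fullCfg e σ).prodMk continuous_const)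
  exact h1.mul h2

lemma System.norm_phased (S : System) (t : Fin (m + 3) → ℝ) (e : Equiv.Perm (Fin 3))
    (σ : Fin (m + 3) → Fin 3) (φ : 𝓢(Fin (m + 3) → E3, ℂ)) (p : Fin 3 → E3)
    (z : (Fin m → E3) × (E3 × E3 × E3)) : ‖S.phased t e σ φ p z‖ = ‖φ (fullCfg e σ z)‖ := by
  rw [System.phased, norm_mul, S.norm_momPhase, mul_one]

lemma System.integrable_phased (S : System) (t : Fin (m + 3) → ℝ) (e : Equiv.Perm (Fin 3))
    (σ : Fin (m + 3) → Fin 3) (φ : 𝓢(Fin (m + 3) → E3, ℂ)) (p : Fin 3 → E3) :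
    Integrable (S.phased t e σ φ p) := by
  have h := (measurePreserving_fullCfg e σ).integrable_comp_of_integrable (schwartz_integrable φ)
  exact h.norm.mono' (S.continuous_phased t e σ φ p).aestronglyMeasurable
    (Eventually.of_forall fun z => (S.norm_phased t e σ φ p z).le)

/-- A test function with the momentum phases, integrated over all wave vector configurations with
given total wave vectors. -/
def System.marginal (S : System) (t : Fin (m + 3) → ℝ) (e : Equiv.Perm (Fin 3))
    (σ : Fin (m + 3) → Fin 3) (φ : 𝓢(Fin (m + 3) → E3, ℂ)) (p : Fin 3 → E3)
    (κ : E3 × E3 × E3) : ℂ :=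
  ∫ r, S.phased t e σ φ p (r, κ)

lemma System.continuous_marginal (S : System) (t : Fin (m + 3) → ℝ) (e : Equiv.Perm (Fin 3))
    (σ : Fin (m + 3) → Fin 3) (φ : 𝓢(Fin (m + 3) → E3, ℂ)) (p : Fin 3 → E3) :
    Continuous (S.marginal t e σ φ p) := by
  obtain ⟨C, hC0, hC⟩ := schwartz_fullCfg_decay e σ φ (3 * m + 1)
  have hcont := S.continuous_phased t e σ φ p
  refine continuous_of_dominated (bound := fun r => C * ((1 + ‖r‖) ^ (3 * m + 1))⁻¹)
    (fun κ => ?_) (fun κ => ?_) ((integrable_inv_pow_pi m).const_mul C) ?_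
  · exact Continuous.aestronglyMeasurable (by fun_prop)
  · refine Eventually.of_forall fun r => ?_
    rw [S.norm_phased]
    exact hC (r, κ)
  · exact Eventually.of_forall fun r => by fun_prop

lemma System.integrable_marginal (S : System) (t : Fin (m + 3) → ℝ) (e : Equiv.Perm (Fin 3))
    (σ : Fin (m + 3) → Fin 3) (φ : 𝓢(Fin (m + 3) → E3, ℂ)) (p : Fin 3 → E3) :
    Integrable (S.marginal t e σ φ p) :=
  Integrable.integral_prod_right (S.integrable_phased t e σ φ p)

lemma continuous_dotTriple : Continuous fun z : (E3 × E3 × E3) × (E3 × E3 × E3) =>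
    dotTriple z.1 z.2 := by
  unfold dotTriple
  fun_prop

/-- The positions couple only to the total wave vectors of the particles. Integrating first over the
other coordinates therefore exhibits the transform as a function of the three positions that is the
Fourier transform of `S.marginal`, ready for inversion. -/
lemma System.fourierPi_arg_eq (h0 : σ 0 = e 0) (h1 : σ 1 = e 1) (h2 : σ (Fin.last _) = e 2)
    (φ : 𝓢(Fin (m + 3) → E3, ℂ)) (p : Fin 3 → E3) (y : E3 × E3 × E3) :
    fourierPi φ (S.arg t σ ((tripleEquiv e).symm y, p)) =
      ∫ κ, S.marginal t e σ φ p κ * Complex.exp (-Complex.I * ((dotTriple κ y : ℝ) : ℂ)) := by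
  have hd : Continuous fun z : (Fin m → E3) × (E3 × E3 × E3) =>
      Complex.exp (-Complex.I * ((dotTriple z.2 y : ℝ) : ℂ)) := by
    have := continuous_dotTriple.comp
      ((continuous_snd (X := Fin m → E3)).prodMk (continuous_const (y := y)))
    simp only [Function.comp_def] at this
    fun_prop
  have h : Integrable (fun z : (Fin m → E3) × (E3 × E3 × E3) => S.phased t e σ φ p z *
      Complex.exp (-Complex.I * ((dotTriple z.2 y : ℝ) : ℂ))) :=
    (S.integrable_phased t e σ φ p).mul_bdd (c := 1) hd.aestronglyMeasurable
      (Eventually.of_forall fun z => (norm_cexp_neg_I_mul _).le)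
  have e1 : ∀ z : (Fin m → E3) × (E3 × E3 × E3), φ (fullCfg e σ z) * Complex.exp (-Complex.I *
      ((∑ s, inner ℝ (fullCfg e σ z s) (S.arg t σ ((tripleEquiv e).symm y, p) s) : ℝ) : ℂ))
      = S.phased t e σ φ p z * Complex.exp (-Complex.I * ((dotTriple z.2 y : ℝ) : ℂ)) := by
    intro z
    rw [System.phased, System.momPhase, mul_assoc, ← Complex.exp_add]
    simp only [System.arg, inner_add_right, Finset.sum_add_distrib]
    rw [sum_inner_comp, S.sum_inner_momVec, sum_perm_three e]
    obtain ⟨a0, a1, a2⟩ := tripleEquiv_symm_apply e y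
    obtain ⟨b0, b1, b2⟩ := waveSum_fullCfg h0 h1 h2 z
    rw [a0, a1, a2, b0, b1, b2, dotTriple]
    congr 2
    push_cast
    ring
  rw [fourierPi, ← (measurePreserving_fullCfg e σ).integral_comp']
  simp only [e1]
  rw [Measure.volume_eq_prod, integral_prod_symm _ h]
  refine integral_congr_ae (Eventually.of_forall fun κ => ?_)
  simp only [System.marginal]
  rw [integral_mul_const]

/-- Momenta enter only through a plane wave, whose Gaussian mean is the damping factor. -/
lemma System.Regular.integral_maxwell_mul_marginal (hS : S.Regular) (φ : 𝓢(Fin (m + 3) → E3, ℂ))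
    (κ : E3 × E3 × E3) :
    ∫ p, (S.maxwell p : ℂ) * S.marginal t e σ φ p κ
      = ∫ r, φ (fullCfg e σ (r, κ)) * S.damping t σ (fullCfg e σ (r, κ)) := by
  obtain ⟨C, hC0, hC⟩ := schwartz_fullCfg_decay e σ φ (3 * m + 1)
  have hcfg : Continuous fun r => fullCfg e σ (r, κ) :=
    (continuous_fullCfg e σ).comp (continuous_id.prodMk continuous_const)
  have hφ : Integrable fun r => φ (fullCfg e σ (r, κ)) :=
    ((integrable_inv_pow_pi m).const_mul C).mono' (φ.continuous.comp hcfg).aestronglyMeasurable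
      (Eventually.of_forall fun r => hC (r, κ))
  have hM : Integrable (S.maxwell (ℓ := 3)) := by
    simpa using S.integrable_pow_mul_maxwell hS.sigma_pos 0 (ℓ := 3)
  have hI := ((hM.ofReal (𝕜 := ℂ)).mul_prod hφ).bdd_mul (c := 1)
    (f := fun z : (Fin 3 → E3) × (Fin m → E3) => S.momPhase t σ (fullCfg e σ (z.2, κ), z.1))
    ((S.continuous_momPhase t σ).comp
      ((hcfg.comp continuous_snd).prodMk continuous_fst)).aestronglyMeasurable
    (Eventually.of_forall fun z => (S.norm_momPhase t σ _).le)
  have hswap := integral_integral_swap (μ := (volume : Measure (Fin 3 → E3)))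
    (ν := (volume : Measure (Fin m → E3))) (f := fun p r =>
      S.momPhase t σ (fullCfg e σ (r, κ), p) * ((S.maxwell p : ℂ) * φ (fullCfg e σ (r, κ)))) hI
  calc _ = ∫ p, ∫ r, S.momPhase t σ (fullCfg e σ (r, κ), p) *
      ((S.maxwell p : ℂ) * φ (fullCfg e σ (r, κ))) := by
        refine integral_congr_ae (Eventually.of_forall fun p => ?_)
        simp only [System.marginal]
        rw [← integral_const_mul]
        refine integral_congr_ae (Eventually.of_forall fun r => ?_)
        simp only [System.phased]
        ring
    _ = _ := hswap
    _ = _ := by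
        refine integral_congr_ae (Eventually.of_forall fun r => ?_)
        simp only
        rw [System.damping, ← S.integral_maxwell_mul_cexp hS.sigma_pos, ← integral_const_mul]
        refine integral_congr_ae (Eventually.of_forall fun p => ?_)
        simp only [System.momPhase]
        ring

/-- Two lines meeting at `x` carry $h_1$ and $h_2$ to the leaves and hence $-(h_1+h_2)$ to the
centre, so the product is a superposition of plane waves on the hyperplane of vanishing total wave
vector. -/
lemma planeAvg_mul_planeAvg {W₁ W₂ : E3 → ℝ} (a b x : E3) :
    planeAvg W₁ (a - x) * planeAvg W₂ (b - x) = (((2 * Real.pi) ^ 6 : ℝ) : ℂ)⁻¹ *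
      ∫ h : E3 × E3, ((W₁ h.1 : ℂ) * (W₂ h.2 : ℂ)) *
        Complex.exp (Complex.I * ((dotTriple (onShell h) (a, b, x) : ℝ) : ℂ)) := by
  rw [planeAvg, planeAvg, mul_mul_mul_comm, ← integral_prod_mul]
  congr 1
  · rw [← mul_inv]
    congr 1
    push_cast
    ring
  · rw [Measure.volume_eq_prod]
    refine integral_congr_ae (Eventually.of_forall fun h => ?_)
    simp only
    rw [mul_mul_mul_comm, ← Complex.exp_add, mul_comm]
    congr 2
    rw [← mul_add, ← Complex.ofReal_add]
    congr 2
    simp only [dotTriple, onShell, inner_sub_right, inner_neg_left, inner_add_left]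
    ring

lemma System.continuous_arg (S : System) {n ℓ : ℕ} (t : Fin n → ℝ) (σ : Fin n → Fin ℓ) :
    Continuous (S.arg t σ) := by
  unfold System.arg
  fun_prop

/-- When every particle carries a field, the test function alone makes the integral converge, and
the convergence factor is removed by dominated convergence. -/
lemma System.Regular.integrable_posTerm_zero (hS : S.Regular) {n : ℕ} {t : Fin n → ℝ}
    {σ : Fin n → Fin 3} (hσ : ∀ j, ∃ s, σ s = j) (φ : 𝓢(Fin n → E3, ℂ))
    {c : (Fin 3 → E3) → ℂ} (hc : Continuous c) (hb : ∃ B, ∀ q, ‖c q‖ ≤ B) :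
    Integrable (S.posTerm t σ c φ 0) ∧
      Tendsto (fun ε : ℝ => ∫ z, S.posTerm t σ c φ ε z) (𝓝[>] 0)
        (𝓝 (∫ z, S.posTerm t σ c φ 0 z)) := by
  obtain ⟨K, hK0, hK⟩ := norm_posTerm_le (S := S) (t := t) (σ := σ) φ hb Finset.univ
    fun j _ => hσ j
  set bnd : (Fin 3 → E3) × (Fin 3 → E3) → ℝ := fun z =>
    K * (((1 + ‖z.2‖) ^ (6 * (Finset.univ : Finset (Fin 3)).card) * S.maxwell z.2) *
      ∏ j, ((1 + ‖z.1 j‖) ^ 6)⁻¹) with hbnd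
  have hbi : Integrable bnd := by
    have h3 : Integrable (fun q : Fin 3 → E3 => ∏ j, ((1 + ‖q j‖) ^ 6)⁻¹) :=
      Integrable.fintype_prod (f := fun _ v => ((1 + ‖v‖) ^ 6)⁻¹)
        fun _ => integrable_inv_pow_E3 (by norm_num)
    refine ((h3.mul_prod (S.integrable_pow_mul_maxwell hS.sigma_pos
      (6 * (Finset.univ : Finset (Fin 3)).card))).const_mul K).congr
        (Eventually.of_forall fun z => ?_)
    simp only [hbnd]
    ring
  have hposcont : ∀ ε, Continuous (S.posTerm t σ c φ ε) := by
    intro ε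
    have h3 := S.continuous_maxwell (ℓ := 3)
    have h4 := continuous_fourierPi φ
    have h5 := S.continuous_arg t σ
    unfold System.posTerm
    fun_prop
  refine ⟨hbi.mono' (hposcont 0).aestronglyMeasurable
    (Eventually.of_forall fun z => hK 0 le_rfl z), ?_⟩
  refine tendsto_integral_filter_of_dominated_convergence bnd ?_ ?_ hbi ?_
  · exact Eventually.of_forall fun ε => (hposcont ε).aestronglyMeasurable
  · filter_upwards [self_mem_nhdsWithin] with ε hε
    exact Eventually.of_forall fun z => hK ε (le_of_lt hε) z
  · refine Eventually.of_forall fun z => ?_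
    have h3 : Continuous fun ε => S.posTerm t σ c φ ε z := by
      unfold System.posTerm
      fun_prop
    exact (h3.tendsto 0).mono_left nhdsWithin_le_nhds

lemma System.integrable_fourierPi_arg {n : ℕ} {t : Fin n → ℝ} {σ : Fin n → Fin 3}
    (hσ : ∀ j, ∃ s, σ s = j) (φ : 𝓢(Fin n → E3, ℂ)) (p : Fin 3 → E3) :
    Integrable (fun q => fourierPi φ (S.arg t σ (q, p))) := by
  obtain ⟨C, hC0, hC⟩ := S.fourierPi_arg_decay t σ φ Finset.univ fun j _ => hσ j
  have h3 : Integrable (fun q : Fin 3 → E3 => ∏ j, ((1 + ‖q j‖) ^ 6)⁻¹) :=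
    Integrable.fintype_prod (f := fun _ v => ((1 + ‖v‖) ^ 6)⁻¹)
      fun _ => integrable_inv_pow_E3 (by norm_num)
  refine (h3.const_mul (C * (1 + ‖p‖) ^ (6 * (Finset.univ : Finset (Fin 3)).card))).mono' ?_
    (Eventually.of_forall fun q => (hC (q, p)).trans (le_of_eq (by ring)))
  have h4 := continuous_fourierPi φ
  have h5 := S.continuous_arg t σ
  exact Continuous.aestronglyMeasurable (by fun_prop)

/-- Write both lines as superpositions of plane waves and integrate over positions and momenta
first. Fourier inversion gives $(2\pi)^9$ and the two lines give $(2\pi)^{-6}$, so $(2\pi)^3$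
remains. -/
lemma System.Regular.integral_posTerm_zero (hS : S.Regular)
    (h0 : σ 0 = e 0) (h1 : σ 1 = e 1) (h2 : σ (Fin.last _) = e 2)
    (hσ : ∀ j, ∃ s, σ s = j) {W₁ W₂ : E3 → ℝ} (hW₁ : Integrable W₁) (hW₂ : Integrable W₂)
    (φ : 𝓢(Fin (m + 3) → E3, ℂ)) :
    ∫ z, S.posTerm t σ (fun q => planeAvg W₁ (q (e 0) - q (e 2)) *
        planeAvg W₂ (q (e 1) - q (e 2))) φ 0 z
      = (2 * Real.pi : ℂ) ^ 3 * ∫ h : E3 × E3, ((W₁ h.1 : ℂ) * (W₂ h.2 : ℂ)) *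
        ∫ r, φ (fullCfg e σ (r, onShell h)) * S.damping t σ (fullCfg e σ (r, onShell h)) := by
  set W : E3 × E3 → ℂ := fun h => (W₁ h.1 : ℂ) * (W₂ h.2 : ℂ) with hWdef
  have hW : Integrable W := (hW₁.ofReal (𝕜 := ℂ)).mul_prod (hW₂.ofReal (𝕜 := ℂ))
  have hT : MeasurePreserving (MeasurableEquiv.prodCongr (tripleEquiv e).symm
      (MeasurableEquiv.refl (Fin 3 → E3))) :=
    MeasurePreserving.prod ((measurePreserving_tripleEquiv e).symm _) (MeasurePreserving.id _)
  set A : (E3 × E3 × E3) × (Fin 3 → E3) → ℂ := fun w =>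
    (S.maxwell w.2 : ℂ) * fourierPi φ (S.arg t σ ((tripleEquiv e).symm w.1, w.2)) with hA
  have hAi : Integrable A := by
    have h3 := (hS.integrable_posTerm_zero (t := t) hσ φ (c := fun _ => 1) continuous_const
      ⟨1, fun _ => by simp⟩).1
    refine (hT.integrable_comp_of_integrable h3).congr (Eventually.of_forall fun w => ?_)
    have h4 : MeasurableEquiv.prodCongr (tripleEquiv e).symm (MeasurableEquiv.refl (Fin 3 → E3)) w
      = ((tripleEquiv e).symm w.1, w.2) := rfl
    rw [Function.comp_apply, h4]
    simp [System.posTerm, hA]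
  have hEc : Continuous fun z : (E3 × E3) × (E3 × E3 × E3) =>
      Complex.exp (Complex.I * ((dotTriple (onShell z.1) z.2 : ℝ) : ℂ)) := by
    have := continuous_dotTriple.comp ((continuous_onShell.comp
      (continuous_fst (Y := E3 × E3 × E3))).prodMk continuous_snd)
    simp only [Function.comp_def] at this
    fun_prop
  have hE : ∀ h : E3 × E3, Integrable (fun w : (E3 × E3 × E3) × (Fin 3 → E3) =>
      A w * Complex.exp (Complex.I * ((dotTriple (onShell h) w.1 : ℝ) : ℂ))) := fun h =>
    hAi.mul_bdd (c := 1) (hEc.comp (continuous_const.prodMk continuous_fst)).aestronglyMeasurable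
      (Eventually.of_forall fun z => (norm_cexp_I_mul _).le)
  have hprod : Integrable (fun z : ((E3 × E3 × E3) × (Fin 3 → E3)) × (E3 × E3) =>
      (A z.1 * W z.2) * Complex.exp (Complex.I * ((dotTriple (onShell z.2) z.1.1 : ℝ) : ℂ)))
      ((volume : Measure ((E3 × E3 × E3) × (Fin 3 → E3))).prod volume) :=
    (hAi.mul_prod hW).mul_bdd (c := 1) (hEc.comp (continuous_snd.prodMk
      (continuous_fst.comp continuous_fst))).aestronglyMeasurable
      (Eventually.of_forall fun z => (norm_cexp_I_mul _).le)
  have hswap := integral_integral_swap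
    (f := fun (w : (E3 × E3 × E3) × (Fin 3 → E3)) (h : E3 × E3) =>
      (A w * W h) * Complex.exp (Complex.I * ((dotTriple (onShell h) w.1 : ℝ) : ℂ))) hprod
  have hinner : ∀ h : E3 × E3, ∫ w : (E3 × E3 × E3) × (Fin 3 → E3),
      A w * Complex.exp (Complex.I * ((dotTriple (onShell h) w.1 : ℝ) : ℂ))
      = ((2 * Real.pi : ℝ) : ℂ) ^ 9 *
        ∫ r, φ (fullCfg e σ (r, onShell h)) * S.damping t σ (fullCfg e σ (r, onShell h)) := by
    intro h
    rw [← hS.integral_maxwell_mul_marginal φ (onShell h), ← integral_const_mul,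
      Measure.volume_eq_prod, integral_prod_symm _ (hE h)]
    refine integral_congr_ae (Eventually.of_forall fun p => ?_)
    simp only [hA, mul_assoc]
    rw [integral_const_mul, fourier_inversion_triple (S.continuous_marginal t e σ φ p)
      (S.integrable_marginal t e σ φ p) (S.fourierPi_arg_eq h0 h1 h2 φ p) ?_ (onShell h)]
    · ring
    · exact ((measurePreserving_tripleEquiv e).symm _).integrable_comp_of_integrable
        (S.integrable_fourierPi_arg hσ φ p)
  rw [← hT.integral_comp']
  have hstart : ∀ w : (E3 × E3 × E3) × (Fin 3 → E3), S.posTerm t σ (fun q =>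
      planeAvg W₁ (q (e 0) - q (e 2)) * planeAvg W₂ (q (e 1) - q (e 2))) φ 0
        (MeasurableEquiv.prodCongr (tripleEquiv e).symm (MeasurableEquiv.refl (Fin 3 → E3)) w)
      = (((2 * Real.pi) ^ 6 : ℝ) : ℂ)⁻¹ * ∫ h : E3 × E3, (A w * W h) *
        Complex.exp (Complex.I * ((dotTriple (onShell h) w.1 : ℝ) : ℂ)) := by
    intro w
    have h4 : MeasurableEquiv.prodCongr (tripleEquiv e).symm (MeasurableEquiv.refl (Fin 3 → E3)) w
      = ((tripleEquiv e).symm w.1, w.2) := rfl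
    obtain ⟨a0, a1, a2⟩ := tripleEquiv_symm_apply e w.1
    rw [h4]
    simp only [System.posTerm]
    rw [a0, a1, a2, planeAvg_mul_planeAvg]
    simp only [mul_assoc (A w)]
    rw [integral_const_mul]
    simp only [neg_zero, zero_mul, Real.exp_zero, one_mul, hWdef, hA]
    ring
  simp only [hstart]
  rw [integral_const_mul, hswap]
  have hlast : ∀ h : E3 × E3, ∫ w : (E3 × E3 × E3) × (Fin 3 → E3), (A w * W h) *
      Complex.exp (Complex.I * ((dotTriple (onShell h) w.1 : ℝ) : ℂ))
      = ((2 * Real.pi : ℝ) : ℂ) ^ 9 * (W h *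
        ∫ r, φ (fullCfg e σ (r, onShell h)) * S.damping t σ (fullCfg e σ (r, onShell h))) := by
    intro h
    rw [mul_left_comm, ← hinner, ← integral_const_mul]
    refine integral_congr_ae (Eventually.of_forall fun w => ?_)
    simp only
    ring
  simp only [hlast]
  rw [integral_const_mul, ← mul_assoc]
  congr 1
  have hpi : (Real.pi : ℂ) ≠ 0 := by exact_mod_cast Real.pi_ne_zero
  push_cast
  field_simp

/-- The position integral evaluates each line weight at the total wave vector of its leaf. The
representatives `0`, `1` and `Fin.last` of the particles are a normalisation that
`hasLim_of_surjective` removes. -/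
theorem System.Regular.hasLim_planeAvg (hS : S.Regular)
    (h0 : σ 0 = e 0) (h1 : σ 1 = e 1) (h2 : σ (Fin.last _) = e 2)
    {W₁ W₂ : E3 → ℝ} (hW₁ : Integrable W₁) (hW₂ : Integrable W₂) :
    S.HasLim t σ (fun q _ => planeAvg W₁ (q (e 0) - q (e 2)) * planeAvg W₂ (q (e 1) - q (e 2)))
      (fun k => ((W₁ (waveSum σ k (e 0)) : ℂ) * (W₂ (waveSum σ k (e 1)) : ℂ)) *
        S.damping t σ k) := by
  intro φ
  set c : (Fin 3 → E3) → ℂ :=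
    fun q => planeAvg W₁ (q (e 0) - q (e 2)) * planeAvg W₂ (q (e 1) - q (e 2)) with hcdef
  set W : E3 × E3 → ℂ := fun h => (W₁ h.1 : ℂ) * (W₂ h.2 : ℂ) with hWdef
  have hW : Integrable W := (hW₁.ofReal (𝕜 := ℂ)).mul_prod (hW₂.ofReal (𝕜 := ℂ))
  have hc : Continuous c := ((continuous_planeAvg hW₁).comp (by fun_prop)).mul
    ((continuous_planeAvg hW₂).comp (by fun_prop))
  have hb : ∃ B, ∀ q, ‖c q‖ ≤ B := by
    obtain ⟨B1, hB1⟩ := planeAvg_bounded W₁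
    obtain ⟨B2, hB2⟩ := planeAvg_bounded W₂
    refine ⟨B1 * B2, fun q => ?_⟩
    rw [hcdef, norm_mul]
    exact mul_le_mul (hB1 _) (hB2 _) (norm_nonneg _) ((norm_nonneg _).trans (hB1 0))
  have hD1 : ∀ k, ‖S.damping t σ k‖ ≤ 1 := fun k => by
    rw [Real.norm_of_nonneg (S.damping_nonneg t σ k)]; exact S.damping_le_one t σ k
  have hshell := integrable_onShell e σ φ hW (S.continuous_damping t σ) hD1
  have hhyp : ∀ z : (Fin m → E3) × (E3 × E3), φ (closeUp (hyperCfg e σ z)) *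
      (((W₁ (waveSum σ (closeUp (hyperCfg e σ z)) (e 0)) : ℂ) *
        (W₂ (waveSum σ (closeUp (hyperCfg e σ z)) (e 1)) : ℂ)) *
        S.damping t σ (closeUp (hyperCfg e σ z)))
      = φ (fullCfg e σ (z.1, onShell z.2)) *
        (W z.2 * S.damping t σ (fullCfg e σ (z.1, onShell z.2))) := by
    intro z
    have h3 := closeUp_hyperCfg (e := e) (σ := σ) z
    obtain ⟨b0, b1, -⟩ := waveSum_fullCfg h0 h1 h2 (z.1, onShell z.2)
    rw [h3]
    change φ (fullCfg e σ (z.1, onShell z.2)) *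
      (((W₁ (waveSum σ (fullCfg e σ (z.1, onShell z.2)) (e 0)) : ℂ) *
        (W₂ (waveSum σ (fullCfg e σ (z.1, onShell z.2)) (e 1)) : ℂ)) *
        S.damping t σ (fullCfg e σ (z.1, onShell z.2))) = _
    rw [b0, b1]
    rfl
  have hmpH := measurePreserving_hyperCfg e σ
  refine ⟨fun ε hε => hS.integrable_term t σ hc hb φ hε, ?_, ?_⟩
  · refine (hmpH.integrable_comp_emb (hyperCfg e σ).measurableEmbedding).1 ?_
    exact hshell.congr (Eventually.of_forall fun z => (hhyp z).symm)
  have hσ : ∀ j, ∃ s, σ s = j := fun j => by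
    rcases perm_three_cases e j with h | h | h
    · exact ⟨0, h0.trans h.symm⟩
    · exact ⟨1, h1.trans h.symm⟩
    · exact ⟨Fin.last _, h2.trans h.symm⟩
  have hval : ∫ z, S.posTerm t σ c φ 0 z = (2 * Real.pi : ℂ) ^ 3 *
      ∫ k : Fin (m + 2) → E3, φ (closeUp k) * (((W₁ (waveSum σ (closeUp k) (e 0)) : ℂ) *
        (W₂ (waveSum σ (closeUp k) (e 1)) : ℂ)) * S.damping t σ (closeUp k)) := by
    rw [hS.integral_posTerm_zero h0 h1 h2 hσ hW₁ hW₂ φ, ← hmpH.integral_comp']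
    simp only [hhyp]
    rw [show (∫ z : (Fin m → E3) × (E3 × E3), φ (fullCfg e σ (z.1, onShell z.2)) *
        (W z.2 * S.damping t σ (fullCfg e σ (z.1, onShell z.2)))) = _ from
      integral_prod_symm _ hshell]
    congr 1
    refine integral_congr_ae (Eventually.of_forall fun h => ?_)
    simp only
    rw [← integral_const_mul]
    refine integral_congr_ae (Eventually.of_forall fun r => ?_)
    simp only [hWdef]
    ring
  rw [← hval]
  refine (hS.integrable_posTerm_zero hσ φ hc hb).2.congr' ?_
  filter_upwards [self_mem_nhdsWithin] with ε hε
  exact (hS.integral_term t σ hc hb φ hε).symm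

end Core

/-! ### Relabelling the fields -/

section Relabel

open scoped SchwartzMap

variable {S : System} {n ℓ : ℕ}

lemma sum_closeUp (k : Fin n → E3) : ∑ i, closeUp k i = 0 := by
  rw [Fin.sum_univ_castSucc]
  simp [closeUp]

lemma closeUp_init {k : Fin (n + 1) → E3} (h : ∑ i, k i = 0) :
    closeUp (fun i : Fin n => k i.castSucc) = k := by
  rw [Fin.sum_univ_castSucc] at h
  funext i
  refine Fin.lastCases ?_ (fun i => ?_) i
  · rw [closeUp, Fin.snoc_last, ← eq_neg_of_add_eq_zero_right h]
  · rw [closeUp, Fin.snoc_castSucc]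

/-- A permutation of the fields acting on the hyperplane `∑ k = 0`. -/
def hyperPerm (π : Equiv.Perm (Fin (n + 1))) : (Fin n → E3) →ₗ[ℝ] (Fin n → E3) where
  toFun k j := closeUp k (π j.castSucc)
  map_add' k k' := by
    have h : closeUp (k + k') = closeUp k + closeUp k' := by
      funext i
      refine Fin.lastCases ?_ (fun i => ?_) i
      · simp only [closeUp, Fin.snoc_last, Pi.add_apply, Finset.sum_add_distrib, neg_add]
      · simp only [closeUp, Fin.snoc_castSucc, Pi.add_apply]
    funext j
    simp only [h, Pi.add_apply]
  map_smul' c k := by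
    have h : closeUp (c • k) = c • closeUp k := by
      funext i
      refine Fin.lastCases ?_ (fun i => ?_) i
      · simp only [closeUp, Fin.snoc_last, Pi.smul_apply, ← Finset.smul_sum, smul_neg]
      · simp only [closeUp, Fin.snoc_castSucc, Pi.smul_apply]
    funext j
    simp only [h, Pi.smul_apply, RingHom.id_apply]

lemma closeUp_hyperPerm (π : Equiv.Perm (Fin (n + 1))) (k : Fin n → E3) :
    closeUp (hyperPerm π k) = fun i => closeUp k (π i) :=
  closeUp_init (k := fun i => closeUp k (π i)) ((Equiv.sum_comp π _).trans (sum_closeUp k))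

lemma hyperPerm_mul (π ρ : Equiv.Perm (Fin (n + 1))) :
    hyperPerm (π * ρ) = hyperPerm ρ ∘ₗ hyperPerm π := by
  refine LinearMap.ext fun k => ?_
  funext j
  change closeUp k (π (ρ j.castSucc)) = closeUp (hyperPerm π k) (ρ j.castSucc)
  rw [closeUp_hyperPerm]

lemma hyperPerm_one : hyperPerm (1 : Equiv.Perm (Fin (n + 1))) = LinearMap.id := by
  refine LinearMap.ext fun k => ?_
  funext j
  change closeUp k j.castSucc = k j
  rw [closeUp, Fin.snoc_castSucc]

lemma hyperPerm_pow (π : Equiv.Perm (Fin (n + 1))) (N : ℕ) :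
    hyperPerm (π ^ N) = hyperPerm π ^ N := by
  induction N with
  | zero => rw [pow_zero, pow_zero, hyperPerm_one]; rfl
  | succ N ih => rw [pow_succ', hyperPerm_mul, ih, pow_succ]; rfl

/-- A permutation has finite order, so the determinant of its action on the hyperplane is a root of
unity. Consequently the measure obtained by eliminating the last wave vector does not depend on
which one is eliminated. -/
lemma abs_det_hyperPerm (π : Equiv.Perm (Fin (n + 1))) : |LinearMap.det (hyperPerm π)| = 1 := by
  have h : hyperPerm π ^ orderOf π = 1 := by
    rw [← hyperPerm_pow, pow_orderOf_eq_one, hyperPerm_one]; rfl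
  have h2 : LinearMap.det (hyperPerm π) ^ orderOf π = 1 := by
    rw [← map_pow, h, map_one]
  have h3 : |LinearMap.det (hyperPerm π)| ^ orderOf π = 1 := by rw [← abs_pow, h2, abs_one]
  exact (pow_eq_one_iff_of_nonneg (abs_nonneg _) (orderOf_pos π).ne').1 h3

/-- The action of a permutation of the fields on the hyperplane `∑ k = 0`, as an equivalence. -/
def hyperPermEquiv (π : Equiv.Perm (Fin (n + 1))) : (Fin n → E3) ≃ᵐ (Fin n → E3) where
  toFun := hyperPerm π
  invFun := hyperPerm π⁻¹
  left_inv k := by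
    rw [← LinearMap.comp_apply, ← hyperPerm_mul, mul_inv_cancel, hyperPerm_one]; rfl
  right_inv k := by
    rw [← LinearMap.comp_apply, ← hyperPerm_mul, inv_mul_cancel, hyperPerm_one]; rfl
  measurable_toFun := (LinearMap.continuous_of_finiteDimensional (hyperPerm π)).measurable
  measurable_invFun := (LinearMap.continuous_of_finiteDimensional (hyperPerm π⁻¹)).measurable

lemma measurePreserving_hyperPermEquiv (π : Equiv.Perm (Fin (n + 1))) :
    MeasurePreserving (hyperPermEquiv π) := by
  refine ⟨(hyperPermEquiv π).measurable, ?_⟩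
  have h := abs_det_hyperPerm π
  have h0 : LinearMap.det (hyperPerm π) ≠ 0 := by
    intro h0
    rw [h0, abs_zero] at h
    exact zero_ne_one h
  have h1 := Measure.map_linearMap_addHaar_eq_smul_addHaar (volume : Measure (Fin n → E3)) h0
  rw [abs_inv, h, inv_one, ENNReal.ofReal_one, one_smul] at h1
  exact h1

/-- Relabelling of the components of a family. -/
def relabel (π : Equiv.Perm (Fin n)) : (Fin n → E3) ≃ᵐ (Fin n → E3) :=
  (MeasurableEquiv.piCongrLeft (fun _ => E3) π).symm

lemma measurePreserving_relabel (π : Equiv.Perm (Fin n)) : MeasurePreserving (relabel π) :=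
  (volume_measurePreserving_piCongrLeft (fun _ => E3) π).symm _

/-- The test function is permuted along with the wave vectors; Lebesgue measure, both on the full
space and on the hyperplane, is invariant. -/
lemma System.HasLim.relabel {t : Fin (n + 1) → ℝ} {σ : Fin (n + 1) → Fin ℓ}
    (π : Equiv.Perm (Fin (n + 1)))
    {A : (Fin ℓ → E3) → (Fin (n + 1) → E3) → ℂ} {T : (Fin (n + 1) → E3) → ℂ}
    (h : S.HasLim (t ∘ π) (σ ∘ π) A T) :
    S.HasLim t σ (fun q k => A q (k ∘ π)) (fun k => T (k ∘ π)) := by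
  intro φ
  let φ' : 𝓢(Fin (n + 1) → E3, ℂ) := SchwartzMap.compCLMOfContinuousLinearEquiv ℂ
    (ContinuousLinearEquiv.piCongrLeft ℝ (fun _ => E3) π) φ
  have hφ : ∀ k : Fin (n + 1) → E3, φ' (k ∘ π) = φ k := fun k => by
    change φ (ContinuousLinearEquiv.piCongrLeft ℝ (fun _ => E3) π (k ∘ π)) = φ k
    congr 1
    exact (Equiv.piCongrLeft (fun _ => E3) π).apply_symm_apply k
  obtain ⟨h1, h2, h3⟩ := h φ'
  have hmp : MeasurePreserving (MeasurableEquiv.prodCongr (MeasurableEquiv.refl (Fin ℓ → E3))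
      (MeasurableEquiv.prodCongr (MeasurableEquiv.refl (Fin ℓ → E3)) (KFT.relabel π))) :=
    MeasurePreserving.prod (MeasurePreserving.id _)
      (MeasurePreserving.prod (MeasurePreserving.id _) (measurePreserving_relabel π))
  have hterm : ∀ ε x, S.term (t ∘ π) (σ ∘ π) A φ' ε
      (MeasurableEquiv.prodCongr (MeasurableEquiv.refl (Fin ℓ → E3))
      (MeasurableEquiv.prodCongr (MeasurableEquiv.refl (Fin ℓ → E3)) (KFT.relabel π)) x)
      = S.term t σ (fun q k => A q (k ∘ π)) φ ε x := by
    intro ε x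
    change S.term (t ∘ π) (σ ∘ π) A φ' ε (x.1, x.2.1, x.2.2 ∘ π) = _
    have hph : S.phase (t ∘ π) (σ ∘ π) x.1 x.2.1 (x.2.2 ∘ π) = S.phase t σ x.1 x.2.1 x.2.2 := by
      rw [System.phase, System.phase]
      congr 3
      exact Equiv.sum_comp π (fun s => inner ℝ (x.2.2 s) (x.1 (σ s) + S.g t s • x.2.1 (σ s)))
    simp only [System.term, hφ, hph]
  have hcl : ∀ k : Fin n → E3, φ' (closeUp (hyperPermEquiv π k)) *
      T (closeUp (hyperPermEquiv π k)) = φ (closeUp k) * T (closeUp k ∘ π) := by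
    intro k
    have h4 : closeUp (hyperPermEquiv π k) = closeUp k ∘ π := closeUp_hyperPerm π k
    rw [h4, hφ]
  have hH := measurePreserving_hyperPermEquiv π
  refine ⟨fun ε hε => ?_, ?_, ?_⟩
  · exact (hmp.integrable_comp_of_integrable (h1 ε hε)).congr
      (Eventually.of_forall fun x => hterm ε x)
  · exact (hH.integrable_comp_of_integrable h2).congr (Eventually.of_forall hcl)
  · rw [← hH.integral_comp'] at h3
    simp only [hcl] at h3
    refine h3.congr fun ε => ?_
    rw [← hmp.integral_comp']
    simp only [hterm]

lemma waveSum_comp (π : Equiv.Perm (Fin n)) (σ : Fin n → Fin ℓ) (k : Fin n → E3) (j : Fin ℓ) :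
    waveSum (σ ∘ π) (k ∘ π) j = waveSum σ k j :=
  Equiv.sum_comp π fun s => if σ s = j then k s else 0

lemma System.momVec_comp (t : Fin n → ℝ) (π : Equiv.Perm (Fin n)) (σ : Fin n → Fin ℓ)
    (k : Fin n → E3) (t' : ℝ) (j : Fin ℓ) :
    S.momVec (t ∘ π) (σ ∘ π) (k ∘ π) t' j = S.momVec t σ k t' j :=
  Equiv.sum_comp π fun r => if σ r = j then S.gqp (t r) t' • k r else 0

lemma exists_perm_three {m : ℕ} (a b c : Fin (m + 3)) (hab : a ≠ b) (hac : a ≠ c) (hbc : b ≠ c) :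
    ∃ π : Equiv.Perm (Fin (m + 3)), π 0 = a ∧ π 1 = b ∧ π (Fin.last _) = c := by
  have hlast : ∀ i : Fin (m + 3), (i = 0 ∨ i = 1) → i ≠ Fin.last (m + 2) := by
    rintro i (rfl | rfl) h <;> simp [Fin.ext_iff] at h
  have hx : Function.Injective ![(0 : Fin (m + 3)), 1, Fin.last _] := by
    intro i j hij
    have h1 := hlast 0 (Or.inl rfl)
    have h2 := hlast 1 (Or.inr rfl)
    fin_cases i <;> fin_cases j <;> simp_all [eq_comm]
  have hy : Function.Injective ![a, b, c] := by
    intro i j hij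
    fin_cases i <;> fin_cases j <;> simp_all [eq_comm]
  -- The symmetric group acts three-transitively.
  obtain ⟨π, hπ⟩ := (Equiv.Perm.isMultiplyPretransitive (Fin (m + 3)) 3).exists_smul_eq
    ⟨_, hx⟩ ⟨_, hy⟩
  have h := fun i => DFunLike.congr_fun hπ i
  exact ⟨π, h 0, h 1, h 2⟩

/-- A relabelling of the fields moves one field of each particle to the positions `0`, `1` and
`Fin.last`; total wave vectors and damping are invariant under it. -/
theorem System.Regular.hasLim_of_surjective (hS : S.Regular) {m : ℕ} {t : Fin (m + 3) → ℝ}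
    {σ : Fin (m + 3) → Fin 3} (hσ : Function.Surjective σ) (e : Equiv.Perm (Fin 3))
    {W₁ W₂ : E3 → ℝ} (hW₁ : Integrable W₁) (hW₂ : Integrable W₂) :
    S.HasLim t σ (fun q _ => planeAvg W₁ (q (e 0) - q (e 2)) * planeAvg W₂ (q (e 1) - q (e 2)))
      (fun k => ((W₁ (waveSum σ k (e 0)) : ℂ) * (W₂ (waveSum σ k (e 1)) : ℂ)) *
        S.damping t σ k) := by
  obtain ⟨a, ha⟩ := hσ (e 0)
  obtain ⟨b, hb⟩ := hσ (e 1)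
  obtain ⟨c, hc⟩ := hσ (e 2)
  have hne : ∀ {i j : Fin 3} {x y : Fin (m + 3)}, σ x = e i → σ y = e j → i ≠ j → x ≠ y := by
    rintro i j x y hx hy hij rfl
    exact hij (e.injective (hx.symm.trans hy))
  obtain ⟨π, h0, h1, h2⟩ := exists_perm_three a b c (hne ha hb (by decide))
    (hne ha hc (by decide)) (hne hb hc (by decide))
  have h := (hS.hasLim_planeAvg (t := t ∘ π) (σ := σ ∘ π) (e := e)
    ((congrArg σ h0).trans ha) ((congrArg σ h1).trans hb) ((congrArg σ h2).trans hc)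
    hW₁ hW₂).relabel π
  simpa only [waveSum_comp, System.damping, System.momVec_comp] using h

end Relabel

/-! ### Lines of a diagram -/

section Lines

variable {ℓ N : ℕ}

/-- The possible lines of a diagram: density-density lines, density-momentum lines, and
momentum-momentum lines. -/
abbrev Line (ℓ : ℕ) : Type := Pair ℓ ⊕ Arrow ℓ ⊕ Pair ℓ

namespace Line

/-- The first particle of a line. -/
def fst : Line ℓ → Fin ℓ
  | .inl e => e.1.1
  | .inr (.inl e) => e.1.1
  | .inr (.inr e) => e.1.1

/-- The second particle of a line. -/
def snd : Line ℓ → Fin ℓ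
  | .inl e => e.1.2
  | .inr (.inl e) => e.1.2
  | .inr (.inr e) => e.1.2

/-- The line has a density end at the particle. -/
def deltaAt : Line ℓ → Fin ℓ → Prop
  | .inl e, i => e.1.1 = i ∨ e.1.2 = i
  | .inr (.inl e), i => e.1.1 = i
  | .inr (.inr _), _ => False

/-- The line has a momentum end at the particle. -/
def momAt : Line ℓ → Fin ℓ → Prop
  | .inl _, _ => False
  | .inr (.inl e), i => e.1.2 = i
  | .inr (.inr e), i => e.1.1 = i ∨ e.1.2 = i

instance (l : Line ℓ) : DecidablePred l.deltaAt := fun i => by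
  rcases l with e | e | e <;> unfold deltaAt <;> infer_instance

/-- The line ends at the particle. -/
def touches (l : Line ℓ) (i : Fin ℓ) : Prop := l.fst = i ∨ l.snd = i

lemma fst_ne_snd (l : Line ℓ) : l.fst ≠ l.snd := by
  rcases l with e | e | e
  · exact e.2.ne
  · exact e.2
  · exact e.2.ne

lemma touches_iff (l : Line ℓ) (i : Fin ℓ) : l.touches i ↔ l.deltaAt i ∨ l.momAt i := by
  rcases l with e | e | e <;> simp [touches, fst, snd, deltaAt, momAt]

end Line

namespace Diagram

/-- The multiplicity of a line in a diagram. -/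
def mult (d : Diagram ℓ N) : Line ℓ → ℕ
  | .inl e => if e ∈ d.dd then 1 else 0
  | .inr (.inl e) => if e ∈ d.dp then 1 else 0
  | .inr (.inr e) => d.pp e

lemma order_eq (d : Diagram ℓ N) : d.order = ∑ l, d.mult l := by
  simp [order, Fintype.sum_sum_type, mult, add_assoc]

lemma deltaEnds_eq (d : Diagram ℓ N) (i : Fin ℓ) :
    d.deltaEnds i = ∑ l : Line ℓ, if l.deltaAt i then d.mult l else 0 := by
  -- The instance `D` is kept arbitrary because the decidability of `Line.deltaAt` is not
  -- syntactically the one used by the filters.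
  have hite : ∀ {ι : Type} [DecidableEq ι] [Fintype ι] (s : Finset ι) (p : ι → Prop)
      [DecidablePred p] (D : DecidablePred p), (s.filter p).card =
        ∑ e, @ite ℕ (p e) (D e) (if e ∈ s then 1 else 0) 0 := by
    intro ι _ _ s p _ D
    rw [Finset.card_filter, ← Fintype.sum_ite_mem]
    exact Finset.sum_congr rfl fun e _ => by split_ifs <;> rfl
  rw [deltaEnds, hite, hite, Fintype.sum_sum_type, Fintype.sum_sum_type]
  congr 1
  rw [Finset.sum_eq_zero (s := (Finset.univ : Finset (Pair ℓ))), add_zero]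
  · rfl
  · exact fun e _ => if_neg id

lemma adj_iff (d : Diagram ℓ N) (i j : Fin ℓ) : d.graph.Adj i j ↔
    ∃ l : Line ℓ, d.mult l ≠ 0 ∧ ((l.fst = i ∧ l.snd = j) ∨ (l.fst = j ∧ l.snd = i)) := by
  have key : ∀ i j, ((∃ e ∈ d.dd, e.1 = (i, j)) ∨ (∃ e ∈ d.dp, e.1 = (i, j)) ∨
      (∃ e, d.pp e ≠ 0 ∧ e.1 = (i, j))) ↔
      ∃ l : Line ℓ, d.mult l ≠ 0 ∧ (l.fst = i ∧ l.snd = j) := by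
    intro i j
    constructor
    · rintro (⟨e, he, h⟩ | ⟨e, he, h⟩ | ⟨e, he, h⟩)
      · exact ⟨.inl e, by simp [mult, he], by simp [Line.fst, Line.snd, h]⟩
      · exact ⟨.inr (.inl e), by simp [mult, he], by simp [Line.fst, Line.snd, h]⟩
      · exact ⟨.inr (.inr e), by simpa [mult] using he, by simp [Line.fst, Line.snd, h]⟩
    · rintro ⟨l, hl, h1, h2⟩
      rcases l with e | e | e
      · exact Or.inl ⟨e, by simpa [mult] using hl, Prod.ext h1 h2⟩
      · exact Or.inr (Or.inl ⟨e, by simpa [mult] using hl, Prod.ext h1 h2⟩)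
      · exact Or.inr (Or.inr ⟨e, hl, Prod.ext h1 h2⟩)
  rw [graph, SimpleGraph.fromRel_adj, key, key]
  constructor
  · rintro ⟨-, ⟨l, hl, h⟩ | ⟨l, hl, h⟩⟩
    · exact ⟨l, hl, Or.inl h⟩
    · exact ⟨l, hl, Or.inr h⟩
  · rintro ⟨l, hl, h | h⟩
    · exact ⟨fun hij => l.fst_ne_snd (h.1.trans (hij.trans h.2.symm)), Or.inl ⟨l, hl, h⟩⟩
    · exact ⟨fun hij => l.fst_ne_snd (h.1.trans (hij.symm.trans h.2.symm)), Or.inr ⟨l, hl, h⟩⟩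

end Diagram

/-- The diagrams of order `N` contributing to the correlation operator. -/
def Diagram.Admissible (d : Diagram ℓ N) : Prop :=
  d.order = N ∧ (∀ i, d.deltaEnds i ≤ 1) ∧ d.graph.Connected

lemma mem_diagrams (d : Diagram ℓ N) : d ∈ diagrams ℓ N ↔ d.Admissible := by
  classical
  rw [diagrams, Finset.mem_filter, Diagram.Admissible]
  simp

lemma exists_touching_line {d : Diagram 3 N} (hd : d.Admissible) (j : Fin 3) :
    ∃ l : Line 3, d.mult l ≠ 0 ∧ l.touches j := by
  obtain ⟨-, -, hc⟩ := hd
  obtain ⟨j', hj'⟩ := exists_ne j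
  obtain ⟨w⟩ := hc.preconnected j j'
  cases w with
  | nil => exact absurd rfl hj'
  | cons h _ =>
    obtain ⟨l, hl, h | h⟩ := (d.adj_iff _ _).1 h
    · exact ⟨l, hl, Or.inl h.1⟩
    · exact ⟨l, hl, Or.inr h.2⟩

/-- A particle without momentum ends is a leaf. -/
lemma exists_leaf_line {d : Diagram 3 N} (hd : d.Admissible) (j : Fin 3)
    (hj : ∀ l : Line 3, d.mult l ≠ 0 → ¬ l.momAt j) :
    ∃ l₀ : Line 3, l₀.deltaAt j ∧ d.mult l₀ = 1 ∧
      ∀ l, l ≠ l₀ → d.mult l ≠ 0 → ¬ l.touches j := by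
  obtain ⟨l₀, h0, ht⟩ := exists_touching_line hd j
  have hδ : ∀ l : Line 3, d.mult l ≠ 0 → l.touches j → l.deltaAt j := fun l hl h =>
    ((l.touches_iff j).1 h).resolve_right (hj l hl)
  have hle := hd.2.1 j
  rw [d.deltaEnds_eq] at hle
  have h1 := hδ l₀ h0 ht
  refine ⟨l₀, h1, ?_, fun l hne hl htl => ?_⟩
  · have := (Finset.single_le_sum (f := fun l : Line 3 => if l.deltaAt j then d.mult l else 0)
      (fun _ _ => Nat.zero_le _) (Finset.mem_univ l₀)).trans hle
    simp only [h1, if_true] at this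
    omega
  -- A second line at `j` would bring a second density end there.
  · have := (Finset.sum_le_sum_of_subset (Finset.subset_univ {l, l₀})
      (f := fun l : Line 3 => if l.deltaAt j then d.mult l else 0)).trans hle
    rw [Finset.sum_pair hne] at this
    simp only [h1, hδ l hl htl, if_true] at this
    omega

/-- In a connected diagram on three particles one particle is joined to both others. -/
lemma exists_center {d : Diagram 3 N} (hd : d.Admissible) :
    ∃ x : Fin 3, ∀ y, y ≠ x → d.graph.Adj x y := by
  obtain ⟨-, -, hc⟩ := hd
  have hn : ∀ j, ∃ j', d.graph.Adj j j' := fun j => by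
    obtain ⟨j', hj'⟩ := exists_ne j
    obtain ⟨w⟩ := hc.preconnected j j'
    cases w with
    | nil => exact absurd rfl hj'
    | cons h _ => exact ⟨_, h⟩
  obtain ⟨a, ha⟩ := hn 0
  -- Vertex `0` has a neighbour `a`. The third vertex `b` has a neighbour too, and whichever of `0`
  -- and `a` this is becomes the centre.
  have h3 : ∀ a : Fin 3, a ≠ 0 → ∃ b, b ≠ 0 ∧ b ≠ a ∧ ∀ y, y = 0 ∨ y = a ∨ y = b := by decide
  obtain ⟨b, hb0, hba, hall⟩ := h3 a ha.ne'
  obtain ⟨c, hc'⟩ := hn b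
  rcases hall c with rfl | rfl | rfl
  · refine ⟨0, fun y hy => ?_⟩
    rcases hall y with rfl | rfl | rfl
    · exact absurd rfl hy
    · exact ha
    · exact hc'.symm
  · refine ⟨c, fun y hy => ?_⟩
    rcases hall y with rfl | rfl | rfl
    · exact ha.symm
    · exact absurd rfl hy
    · exact hc'.symm
  · exact absurd rfl hc'.ne

lemma exists_two_lines {d : Diagram 3 N} (hd : d.Admissible) :
    ∃ x : Fin 3, ∀ y, y ≠ x → ∃ l : Line 3, d.mult l ≠ 0 ∧
      ((l.fst = x ∧ l.snd = y) ∨ (l.fst = y ∧ l.snd = x)) := by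
  obtain ⟨x, hx⟩ := exists_center hd
  exact ⟨x, fun y hy => (d.adj_iff _ _).1 (hx y hy)⟩

/-- The centre is joined to two different particles, which takes two distinct lines, and each line
is at least of first order. -/
lemma diagrams_three_eq_empty (hN : N < 2) : diagrams 3 N = ∅ := by
  refine Finset.eq_empty_of_forall_notMem fun d hd => ?_
  rw [mem_diagrams] at hd
  obtain ⟨x, hx⟩ := exists_two_lines hd
  have h3 : ∀ x : Fin 3, ∃ y z, y ≠ x ∧ z ≠ x ∧ y ≠ z := by decide
  obtain ⟨y, z, hy, hz, hyz⟩ := h3 x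
  obtain ⟨l, hl, h⟩ := hx y hy
  obtain ⟨l', hl', h'⟩ := hx z hz
  have hne : l ≠ l' := by
    rintro rfl
    rcases h with ⟨a, b⟩ | ⟨a, b⟩ <;> rcases h' with ⟨a', b'⟩ | ⟨a', b'⟩
    · exact hyz (b.symm.trans b')
    · exact hz (a'.symm.trans a)
    · exact hy (a.symm.trans a')
    · exact hyz (a.symm.trans a')
  have hs := Finset.sum_le_sum_of_subset (Finset.subset_univ {l, l'}) (f := d.mult)
  rw [← d.order_eq, hd.1, Finset.sum_pair hne] at hs
  omega

variable (S : System)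

/-- The value of a line. -/
def System.lineVal (q L : Fin ℓ → E3) : Line ℓ → ℂ
  | .inl e => S.Cdd (q e.1.1 - q e.1.2)
  | .inr (.inl e) => S.dpLine q L e.1.1 e.1.2
  | .inr (.inr e) => S.ppLine q L e.1.1 e.1.2

/-- Treating the three kinds of lines uniformly, with multiplicities, allows a single line to be
split off without regard to its kind. -/
lemma System.amp_eq (d : Diagram ℓ N) (q L : Fin ℓ → E3) :
    S.amp d q L = (∏ e, ((d.pp e).factorial : ℂ)⁻¹) * ∏ l, S.lineVal q L l ^ d.mult l := by
  have hite : ∀ {ι : Type} [DecidableEq ι] [Fintype ι] (s : Finset ι) (f : ι → ℂ),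
      ∏ e, f e ^ (if e ∈ s then 1 else 0) = ∏ e ∈ s, f e := by
    intro ι _ _ s f
    rw [← Fintype.prod_ite_mem s]
    exact Finset.prod_congr rfl fun e _ => by split_ifs <;> simp
  simp only [Fintype.prod_sum_type, Diagram.mult, System.lineVal, hite, System.amp,
    Finset.prod_mul_distrib]
  ring

lemma System.lineVal_eq_zero {q L : Fin ℓ → E3} {l : Line ℓ} {i : Fin ℓ} (h : l.momAt i)
    (hL : L i = 0) : S.lineVal q L l = 0 := by
  rcases l with e | e | e
  · exact h.elim
  · change e.1.2 = i at h
    simp [System.lineVal, System.dpLine, h, hL]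
  · rcases h with h | h <;> simp [System.lineVal, System.ppLine, h, hL]

lemma System.amp_eq_zero {d : Diagram ℓ N} {q L : Fin ℓ → E3} {l : Line ℓ} {i : Fin ℓ}
    (hl : d.mult l ≠ 0) (h : l.momAt i) (hL : L i = 0) : S.amp d q L = 0 := by
  rw [S.amp_eq, Finset.prod_eq_zero (Finset.mem_univ l), mul_zero]
  rw [S.lineVal_eq_zero h hL, zero_pow hl]

end Lines

/-! ### Distributions of the fields which leave a particle empty -/

section Empty

open scoped SchwartzMap

variable {n ℓ N : ℕ}

lemma hasTemperateGrowth_coord (s : Fin n) (a : Fin 3) :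
    (fun k : Fin n → E3 => ((k s a : ℝ) : ℂ)).HasTemperateGrowth := by
  let f : (Fin n → E3) →L[ℝ] ℂ := Complex.ofRealCLM ∘L
    ((EuclideanSpace.proj a : E3 →L[ℝ] ℝ) ∘L ContinuousLinearMap.proj s)
  exact f.hasTemperateGrowth

lemma System.hasTemperateGrowth_momVec (S : System) (t : Fin n → ℝ) (σ : Fin n → Fin ℓ) (t' : ℝ)
    (j : Fin ℓ) (a : Fin 3) :
    (fun k : Fin n → E3 => ((S.momVec t σ k t' j a : ℝ) : ℂ)).HasTemperateGrowth := by
  have h : (fun k : Fin n → E3 => ((S.momVec t σ k t' j a : ℝ) : ℂ))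
      = fun k => ∑ r, (if σ r = j then (S.gqp (t r) t' : ℂ) else 0) * ((k r a : ℝ) : ℂ) := by
    funext k
    rw [System.momVec, WithLp.ofLp_sum, Finset.sum_apply]
    push_cast
    refine Finset.sum_congr rfl fun r _ => ?_
    split_ifs <;> simp
  rw [h]
  exact Function.HasTemperateGrowth.sum fun r _ =>
    (Function.HasTemperateGrowth.const _).mul (hasTemperateGrowth_coord r a)

lemma hasTemperateGrowth_prod {V : Type*} [NormedAddCommGroup V] [NormedSpace ℝ V] {ι : Type*}
    (s : Finset ι) {f : ι → V → ℂ} (h : ∀ i ∈ s, (f i).HasTemperateGrowth) :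
    (fun v => ∏ i ∈ s, f i v).HasTemperateGrowth := by
  classical
  induction s using Finset.induction_on with
  | empty => simp only [Finset.prod_empty]; exact Function.HasTemperateGrowth.const (1 : ℂ)
  | insert i s hi ih =>
    simp only [Finset.prod_insert hi]
    exact (h i (by simp)).mul (ih fun j hj => h j (by simp [hj]))

lemma System.hasTemperateGrowth_resp (S : System) (f : Fin n → FieldType) (t : Fin n → ℝ)
    (σ : Fin n → Fin ℓ) : (S.resp f t σ).HasTemperateGrowth := by
  refine hasTemperateGrowth_prod _ fun s _ => ?_
  rcases hs : f s with _ | _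
  · exact Function.HasTemperateGrowth.const (1 : ℂ)
  · have h : (fun k : Fin n → E3 =>
        System.oneResp .B (k s) (S.momVec t σ k (t s) (σ s)))
        = fun k => Complex.I * ∑ a, ((S.momVec t σ k (t s) (σ s) a : ℝ) : ℂ) *
          ((k s a : ℝ) : ℂ) := by
      funext k
      simp [System.oneResp, PiLp.inner_apply]
    rw [h]
    exact (Function.HasTemperateGrowth.const _).mul (Function.HasTemperateGrowth.sum fun a _ =>
      (S.hasTemperateGrowth_momVec t σ _ _ a).mul (hasTemperateGrowth_coord s a))

/-- Sums of products of a function of the wave vectors of temperate growth and a bounded continuous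
function of the positions which does not depend on the position of particle `j`. -/
inductive Sep (n : ℕ) (j : Fin 3) : ((Fin 3 → E3) → (Fin n → E3) → ℂ) → Prop
  | base {m : (Fin n → E3) → ℂ} {c : (Fin 3 → E3) → ℂ} (hm : m.HasTemperateGrowth)
      (hc : Continuous c) (hb : ∃ B, ∀ q, ‖c q‖ ≤ B)
      (hind : ∀ q v, c (Function.update q j v) = c q) : Sep n j fun q k => m k * c q
  | add {A B : (Fin 3 → E3) → (Fin n → E3) → ℂ} (hA : Sep n j A) (hB : Sep n j B) :
      Sep n j fun q k => A q k + B q k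

namespace Sep

variable {j : Fin 3} {A B : (Fin 3 → E3) → (Fin n → E3) → ℂ}

lemma temperate {m : (Fin n → E3) → ℂ} (hm : m.HasTemperateGrowth) :
    Sep n j fun _ k => m k := by
  have := base (j := j) hm (c := fun _ => 1) continuous_const ⟨1, by simp⟩ (by simp)
  simpa using this

lemma mul (hA : Sep n j A) (hB : Sep n j B) : Sep n j fun q k => A q k * B q k := by
  induction hA with
  | add _ _ ih₁ ih₂ => simpa only [add_mul] using ih₁.add ih₂
  | @base m c hm hc hb hind =>
    induction hB with
    | add _ _ ih₁ ih₂ => simpa only [mul_add] using ih₁.add ih₂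
    | @base m' c' hm' hc' hb' hind' =>
      obtain ⟨b, hb⟩ := hb
      obtain ⟨b', hb'⟩ := hb'
      have h := base (j := j) (hm.mul hm') (hc.mul hc') ⟨b * b', fun q => by
        rw [Pi.mul_apply, norm_mul]
        exact mul_le_mul (hb _) (hb' _) (norm_nonneg _) ((norm_nonneg _).trans (hb 0))⟩
        (fun q v => by simp only [Pi.mul_apply, hind, hind'])
      have e : (fun (q : Fin 3 → E3) (k : Fin n → E3) => m k * c q * (m' k * c' q))
          = fun q k => (m * m') k * (c * c') q := by
        funext q k
        simp only [Pi.mul_apply]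
        ring
      rw [e]
      exact h

lemma sum {ι : Type*} (s : Finset ι) {A : ι → (Fin 3 → E3) → (Fin n → E3) → ℂ}
    (h : ∀ i ∈ s, Sep n j (A i)) : Sep n j fun q k => ∑ i ∈ s, A i q k := by
  classical
  induction s using Finset.induction_on with
  | empty => simpa using temperate (j := j) (Function.HasTemperateGrowth.const (E := Fin n → E3) (0 : ℂ))
  | insert i s hi ih =>
    simp only [Finset.sum_insert hi]
    exact (h i (by simp)).add (ih fun j hj => h j (by simp [hj]))

lemma prod {ι : Type*} (s : Finset ι) {A : ι → (Fin 3 → E3) → (Fin n → E3) → ℂ}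
    (h : ∀ i ∈ s, Sep n j (A i)) : Sep n j fun q k => ∏ i ∈ s, A i q k := by
  classical
  induction s using Finset.induction_on with
  | empty => simpa using temperate (j := j) (Function.HasTemperateGrowth.const (E := Fin n → E3) (1 : ℂ))
  | insert i s hi ih =>
    simp only [Finset.prod_insert hi]
    exact (h i (by simp)).mul (ih fun j hj => h j (by simp [hj]))

lemma pow (hA : Sep n j A) (N : ℕ) : Sep n j fun q k => A q k ^ N := by
  have := prod (Finset.range N) (A := fun _ => A) fun _ _ => hA
  simpa using this

lemma corr {S : System} {w : E3 → ℝ} (hW : Integrable fun h => w h * S.P0 ‖h‖) {a b : Fin 3} (ha : a ≠ j) (hb : b ≠ j) :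
    Sep n j fun q _ => S.corr w (q a - q b) := by
  have h := base (n := n) (j := j) (m := fun _ => 1) (Function.HasTemperateGrowth.const _)
    (c := fun q : Fin 3 → E3 => S.corr w (q a - q b))
    ((continuous_planeAvg hW).comp (by fun_prop))
    ((planeAvg_bounded _).imp fun B hB q => hB _)
    (fun q v => by rw [Function.update_of_ne ha, Function.update_of_ne hb])
  simpa using h

end Sep

/-- Combinations, with coefficients of temperate growth, of fading functions of `q i - q j`. -/
def FadingLine (n : ℕ) (i j : Fin 3) (u : (Fin 3 → E3) → (Fin n → E3) → ℂ) : Prop :=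
  ∃ (ι : Type) (_ : Fintype ι) (m : ι → (Fin n → E3) → ℂ) (C : ι → E3 → ℂ),
    (∀ a, (m a).HasTemperateGrowth) ∧ (∀ a, Fading (C a)) ∧
      ∀ q k, u q k = ∑ a, m a k * C a (q i - q j)

variable {S : System} {t : Fin (n + 1) → ℝ} {σ : Fin (n + 1) → Fin 3}

lemma System.Regular.hasLim_fadingLine_mul_sep (hS : S.Regular) (e : Equiv.Perm (Fin 3))
    (h0 : ∀ s, σ s ≠ e 0) (h1 : ∃ s, σ s = e 1) (h2 : ∃ s, σ s = e 2)
    {u A : (Fin 3 → E3) → (Fin (n + 1) → E3) → ℂ} (hu : FadingLine (n + 1) (e 0) (e 2) u)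
    (hA : Sep (n + 1) (e 0) A) :
    S.HasLim t σ (fun q k => u q k * A q k) (fun _ => 0) := by
  obtain ⟨ι, _, m, C, hm, hC, hu⟩ := hu
  induction hA with
  | add _ _ ih₁ ih₂ => simpa only [mul_add, add_zero] using ih₁.add ih₂
  | @base m' c hm' hc hb hind =>
    have h := System.HasLim.sum (s := (Finset.univ : Finset ι)) (fun a _ =>
      (hS.hasLim_of_fading (t := t) e h0 h1 h2 (hC a) hc hb hind).temperate_mul
        ((hm a).mul hm'))
    simp only [mul_zero, Finset.sum_const_zero] at h
    refine (congrArg (fun A => S.HasLim t σ A fun _ => 0) ?_).mp h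
    funext q k
    rw [hu, Finset.sum_mul]
    refine Finset.sum_congr rfl fun a _ => ?_
    simp only [Pi.mul_apply]
    ring

lemma System.Regular.hasLim_fadingLine_mul_fadingLine (hS : S.Regular) (e : Equiv.Perm (Fin 3))
    (h0 : ∀ s, σ s = e 2) {u v : (Fin 3 → E3) → (Fin (n + 1) → E3) → ℂ}
    (hu : FadingLine (n + 1) (e 0) (e 2) u) (hv : FadingLine (n + 1) (e 1) (e 2) v) :
    S.HasLim t σ (fun q k => u q k * v q k) (fun _ => 0) := by
  obtain ⟨ι, _, m, C, hm, hC, hu⟩ := hu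
  obtain ⟨ι', _, m', C', hm', hC', hv⟩ := hv
  have h := System.HasLim.sum (s := (Finset.univ : Finset (ι × ι'))) (fun a _ =>
      (hS.hasLim_of_fading_pair (t := t) e h0 (hC a.1) (hC' a.2)).temperate_mul
        ((hm a.1).mul (hm' a.2)))
  simp only [mul_zero, Finset.sum_const_zero] at h
  refine (congrArg (fun A => S.HasLim t σ A fun _ => 0) ?_).mp h
  funext q k
  rw [hu, hv, Finset.sum_mul_sum, ← Finset.sum_product']
  refine Finset.sum_congr rfl fun a _ => ?_
  simp only [Pi.mul_apply]
  ring

/-- A line with a density end at `j` fades away when `j` is removed to infinity. -/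
lemma System.Regular.fadingLine_lineVal (hS : S.Regular) {L : (Fin n → E3) → Fin 3 → E3}
    (hL : ∀ j a, (fun k => ((L k j a : ℝ) : ℂ)).HasTemperateGrowth) {l : Line 3} {j : Fin 3}
    (h : l.deltaAt j) : ∃ x, x ≠ j ∧ l.touches x ∧
      FadingLine n j x fun q k => S.lineVal q (L k) l := by
  have hone := Function.HasTemperateGrowth.const (E := Fin n → E3) (1 : ℂ)
  rcases l with e | e | e
  · rcases h with rfl | rfl
    · exact ⟨e.1.2, e.2.ne', Or.inr rfl, Unit, inferInstance, fun _ _ => 1, fun _ => S.Cdd,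
        fun _ => hone, fun _ => hS.fading_Cdd, fun q k => by simp [System.lineVal]⟩
    · refine ⟨e.1.1, e.2.ne, Or.inl rfl, Unit, inferInstance, fun _ _ => 1,
        fun _ r => S.Cdd (-r), fun _ => hone, fun _ => hS.fading_Cdd.neg, fun q k => ?_⟩
      simp [System.lineVal]
  · change e.1.1 = j at h
    subst h
    refine ⟨e.1.2, e.2.symm, Or.inr rfl, Fin 3, inferInstance,
      fun a k => (-(S.alpha : ℂ)) * ((L k e.1.2 a : ℝ) : ℂ),
      fun a => S.corr (fun h => h a / ‖h‖ ^ 2),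
      fun a => (Function.HasTemperateGrowth.const _).mul (hL _ a), fun a => hS.fading_dp a,
      fun q k => ?_⟩
    simp only [System.lineVal, System.dpLine]
    refine Finset.sum_congr rfl fun a _ => ?_
    rw [System.Cdp]
    linear_combination (S.alpha : ℂ) * S.corr (fun h => h a / ‖h‖ ^ 2) (q e.1.1 - q e.1.2) *
      ((L k e.1.2 a : ℝ) : ℂ) * Complex.I_mul_I
  · exact h.elim

lemma System.Regular.sep_lineVal (hS : S.Regular) {L : (Fin n → E3) → Fin 3 → E3}
    (hL : ∀ j a, (fun k => ((L k j a : ℝ) : ℂ)).HasTemperateGrowth) {l : Line 3} {j : Fin 3}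
    (h : ¬ l.touches j) : Sep n j fun q k => S.lineVal q (L k) l := by
  obtain ⟨h1, h2⟩ := not_or.1 h
  have hcoord := fun i a => Sep.temperate (j := j) (hL i a)
  have hconst := fun c : ℂ =>
    Sep.temperate (j := j) (Function.HasTemperateGrowth.const (E := Fin n → E3) c)
  rcases l with e | e | e
  · exact Sep.corr (w := fun _ => 1) (by simpa using hS.int) h1 h2
  · simp only [System.lineVal, System.dpLine, System.Cdp]
    exact Sep.sum _ fun a _ => ((hconst _).mul ((hconst (-Complex.I * S.alpha)).mul
      (Sep.corr (hS.integrable_dp a) h1 h2))).mul (hcoord _ a)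
  · simp only [System.lineVal, System.ppLine, System.Cpp]
    have := (hconst (-1)).mul (Sep.sum Finset.univ fun a _ => Sep.sum Finset.univ fun b _ =>
      ((hconst (S.alpha ^ 2)).mul (Sep.corr (a := e.1.1) (b := e.1.2)
        (hS.integrable_pp a b) h1 h2)).mul
        ((hcoord e.1.1 a).mul (hcoord e.1.2 b)))
    simpa only [neg_one_mul] using this

lemma line_ends (e : Equiv.Perm (Fin 3)) (l : Line 3) : ∃ a b, a ≠ b ∧
    ∀ i, l.touches (e i) ↔ a = i ∨ b = i := by
  obtain ⟨a, ha⟩ := e.surjective l.fst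
  obtain ⟨b, hb⟩ := e.surjective l.snd
  refine ⟨a, b, fun h => l.fst_ne_snd (by rw [← ha, ← hb, h]), fun i => ?_⟩
  rw [Line.touches, ← ha, ← hb, e.injective.eq_iff, e.injective.eq_iff]

/-- If two particles are without momentum ends, both are joined to the third one. -/
lemma exists_line_to_center {d : Diagram 3 N} (hd : d.Admissible) (e : Equiv.Perm (Fin 3))
    (hm : ∀ i, i ≠ 2 → ∀ l : Line 3, d.mult l ≠ 0 → ¬ l.momAt (e i)) {i : Fin 3} (hi : i ≠ 2) :
    ∃ l₀ : Line 3, l₀.deltaAt (e i) ∧ l₀.touches (e 2) ∧ d.mult l₀ = 1 ∧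
      ∀ l, l ≠ l₀ → d.mult l ≠ 0 → ¬ l.touches (e i) := by
  obtain ⟨l, hδ, h1, hrest⟩ := exists_leaf_line hd (e i) (hm i hi)
  refine ⟨l, hδ, ?_, h1, hrest⟩
  have hlt : l.touches (e i) := (l.touches_iff _).2 (Or.inl hδ)
  -- Otherwise the line joins the two leaves. It is then the only line at either of them, and the
  -- third particle is isolated, contrary to connectedness.
  by_contra hno
  obtain ⟨a, b, hab, hl⟩ := line_ends e l
  have h3 : ∀ i a b : Fin 3, a ≠ b → i ≠ 2 → (a = i ∨ b = i) → ¬ (a = 2 ∨ b = 2) →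
      ∃ i', i' ≠ 2 ∧ i' ≠ i ∧ (a = i' ∨ b = i') := by
    decide
  obtain ⟨i', hi', hii, hab'⟩ := h3 i a b hab hi ((hl i).1 hlt) fun h => hno ((hl 2).2 h)
  obtain ⟨l', -, -, hrest'⟩ := exists_leaf_line hd (e i') (hm i' hi')
  have hll' : l = l' := by
    by_contra hne
    exact hrest' l hne (by omega) ((hl i').2 hab')
  subst hll'
  obtain ⟨l₂, hl₂, ht₂⟩ := exists_touching_line hd (e 2)
  obtain ⟨a₂, b₂, hab₂, hends⟩ := line_ends e l₂
  have hne : l₂ ≠ l := by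
    rintro rfl
    exact hno ht₂
  have hcov : (a₂ = i ∨ b₂ = i) ∨ (a₂ = i' ∨ b₂ = i') := by omega
  rcases hcov with h | h
  · exact hrest l₂ hne hl₂ ((hends i).2 h)
  · exact hrest' l₂ hne hl₂ ((hends i').2 h)

lemma amp_split_one (S : System) (d : Diagram 3 N) (q L : Fin 3 → E3) {l₀ : Line 3}
    (h0 : d.mult l₀ = 1) : S.amp d q L = S.lineVal q L l₀ *
      ((∏ e, ((d.pp e).factorial : ℂ)⁻¹) *
        ∏ l ∈ Finset.univ.erase l₀, S.lineVal q L l ^ d.mult l) := by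
  rw [S.amp_eq, ← Finset.mul_prod_erase _ _ (Finset.mem_univ l₀), h0, pow_one]
  ring

/-- An empty particle has $L_j=0$, so either a momentum end makes the amplitude vanish identically,
or the particle is a leaf whose line fades. There is no restriction on the order, since the
remaining lines need only be bounded, continuous and independent of the leaf. -/
theorem System.Regular.hasLim_amp_of_not_surjective (hS : S.Regular)
    (hσ : ¬ Function.Surjective σ) {d : Diagram 3 N} (hd : d.Admissible) :
    S.HasLim t σ (fun q k => S.amp d q (S.momVec t σ k S.ti)) (fun _ => 0) := by
  have hempty : ∀ j, (∀ s, σ s ≠ j) → ∀ k, S.momVec t σ k S.ti j = 0 := fun j hj k => by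
    rw [System.momVec]
    exact Finset.sum_eq_zero fun s _ => if_neg (hj s)
  have hL := S.hasTemperateGrowth_momVec t σ S.ti
  -- If some line has a momentum end at an empty particle, the amplitude is identically zero.
  -- Afterwards empty particles carry density ends only.
  by_cases hz : ∃ l : Line 3, d.mult l ≠ 0 ∧ ∃ j, (∀ s, σ s ≠ j) ∧ l.momAt j
  · obtain ⟨l, hl, j, hj, hlj⟩ := hz
    have h : (fun (q : Fin 3 → E3) (k : Fin (n + 1) → E3) => S.amp d q (S.momVec t σ k S.ti))
        = fun _ _ => 0 := by
      funext q k
      exact S.amp_eq_zero hl hlj (hempty j hj k)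
    rw [h]
    exact System.HasLim.zero
  push Not at hz
  have hleaf : ∀ j, (∀ s, σ s ≠ j) → ∃ l₀ : Line 3, l₀.deltaAt j ∧ d.mult l₀ = 1 ∧
      ∀ l, l ≠ l₀ → d.mult l ≠ 0 → ¬ l.touches j :=
    fun j hj => exists_leaf_line hd j fun l hl => hz l hl j hj
  obtain ⟨j, hj⟩ := not_forall.1 hσ
  push Not at hj
  obtain ⟨l₀, hδ, h1, hrest⟩ := hleaf j hj
  obtain ⟨x, hxj, hlx, hfade⟩ := hS.fadingLine_lineVal (S.hasTemperateGrowth_momVec t σ S.ti) hδ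
  have hlj : l₀.touches j := (l₀.touches_iff j).2 (Or.inl hδ)
  have hperm : ∀ j x : Fin 3, x ≠ j → ∃ e : Equiv.Perm (Fin 3), e 0 = j ∧ e 2 = x := by decide
  obtain ⟨e, rfl, rfl⟩ := hperm j x hxj
  by_cases hone : (∃ s, σ s = e 1) ∧ ∃ s, σ s = e 2
  · have hsep : Sep (n + 1) (e 0) fun q k => (∏ e, ((d.pp e).factorial : ℂ)⁻¹) *
        ∏ l ∈ Finset.univ.erase l₀, S.lineVal q (S.momVec t σ k S.ti) l ^ d.mult l := by
      refine (Sep.temperate (Function.HasTemperateGrowth.const _)).mul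
        (Sep.prod _ fun l hl => ?_)
      by_cases h0 : d.mult l = 0
      · simp only [h0, pow_zero]
        exact Sep.temperate (Function.HasTemperateGrowth.const (1 : ℂ))
      · exact (hS.sep_lineVal hL (hrest l (Finset.ne_of_mem_erase hl) h0)).pow _
    have h := hS.hasLim_fadingLine_mul_sep (t := t) e hj hone.1 hone.2 hfade hsep
    simpa only [← amp_split_one S d _ _ h1] using h
  -- two empty particles
  have hconst : ∃ x, ∀ s, σ s = x := by
    rw [not_and_or] at hone
    rcases hone with h | h
    · push Not at h
      exact ⟨e 2, fun s => by
        rcases perm_three_cases e (σ s) with h' | h' | h'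
        · exact absurd h' (hj s)
        · exact absurd h' (h s)
        · exact h'⟩
    · push Not at h
      exact ⟨e 1, fun s => by
        rcases perm_three_cases e (σ s) with h' | h' | h'
        · exact absurd h' (hj s)
        · exact h'
        · exact absurd h' (h s)⟩
  obtain ⟨y, hy⟩ := hconst
  have hperm : ∀ y : Fin 3, ∃ e : Equiv.Perm (Fin 3), e 2 = y := by decide
  -- The numbering `e` is chosen afresh, with `e 2` the only occupied particle.
  clear hone hrest hfade hlx hlj hxj h1 hδ hj
  obtain ⟨e, rfl⟩ := hperm y
  have hm : ∀ i, i ≠ 2 → ∀ l : Line 3, d.mult l ≠ 0 → ¬ l.momAt (e i) := fun i hi l hl =>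
    hz l hl (e i) fun s h => hi (e.injective (h.symm.trans (hy s)))
  have hline : ∀ i : Fin 3, i ≠ 2 → ∃ l₀ : Line 3, l₀.touches (e i) ∧ l₀.touches (e 2) ∧
      d.mult l₀ = 1 ∧ (∀ l, l ≠ l₀ → d.mult l ≠ 0 → ¬ l.touches (e i)) ∧
      FadingLine (n + 1) (e i) (e 2) fun q k => S.lineVal q (S.momVec t σ k S.ti) l₀ := by
    intro i hi
    obtain ⟨l, hδ, ht, h1, hrest⟩ := exists_line_to_center hd e hm hi
    obtain ⟨x, hx, hlx, hf⟩ := hS.fadingLine_lineVal (S.hasTemperateGrowth_momVec t σ S.ti) hδ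
    have hlt : l.touches (e i) := (l.touches_iff _).2 (Or.inl hδ)
    obtain ⟨i', rfl⟩ := e.surjective x
    obtain ⟨a, b, hab, hl⟩ := line_ends e l
    have hii : i' ≠ i := fun h => hx (congrArg e h)
    rw [hl] at ht hlx hlt
    obtain rfl : i' = 2 := by omega
    exact ⟨l, (hl i).2 hlt, (hl 2).2 ht, h1, hrest, hf⟩
  obtain ⟨l₀, ht0, ht0', hm0, hr0, hf0⟩ := hline 0 (by decide)
  obtain ⟨l₁, ht1, ht1', hm1, hr1, hf1⟩ := hline 1 (by decide)
  have hne : l₁ ≠ l₀ := by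
    rintro rfl
    obtain ⟨a, b, hab, hl⟩ := line_ends e l₁
    rw [hl] at ht0 ht1 ht0'
    omega
  -- Any further line would avoid both leaves and thus have both of its ends at `e 2`.
  have hother : ∀ l, l ≠ l₀ → l ≠ l₁ → d.mult l = 0 := by
    intro l h0 h1
    by_contra hl
    have n0 := hr0 l h0 hl
    have n1 := hr1 l h1 hl
    obtain ⟨a, b, hab, hl⟩ := line_ends e l
    rw [hl] at n0 n1
    omega
  have h := (hS.hasLim_fadingLine_mul_fadingLine (t := t) e hy hf0 hf1).const_mul
    (∏ e, ((d.pp e).factorial : ℂ)⁻¹)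
  simp only [mul_zero] at h
  refine (congrArg (fun A => S.HasLim t σ A fun _ => 0) ?_).mp h
  funext q k
  rw [amp_split_one S d _ _ hm0, ← Finset.mul_prod_erase _ _
    (Finset.mem_erase.2 ⟨hne, Finset.mem_univ l₁⟩), hm1, pow_one,
    Finset.prod_eq_one (s := (Finset.univ.erase l₀).erase l₁)]
  · ring
  · intro l hl
    rw [Finset.mem_erase, Finset.mem_erase] at hl
    rw [hother l hl.2.1 hl.1, pow_zero]

theorem System.Regular.hasLim_of_not_surjective (hS : S.Regular) (f : Fin (n + 1) → FieldType)
    (hσ : ¬ Function.Surjective σ) :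
    S.HasLim t σ (fun q k => S.resp f t σ k *
      ∑ d ∈ diagrams 3 N, S.amp d q (S.momVec t σ k S.ti)) (fun _ => 0) := by
  have h := (System.HasLim.sum fun d hd =>
    hS.hasLim_amp_of_not_surjective (t := t) hσ (N := N) (d := d)
      ((mem_diagrams d).1 hd)).temperate_mul
      (S.hasTemperateGrowth_resp f t σ)
  simpa only [Finset.sum_const_zero, mul_zero] using h

end Empty

/-! ### The connected diagrams of second order on three particles -/

section SecondOrder

/-- The pair of two distinct particles. -/
def pairOf (x a : Fin 3) (h : x ≠ a) : Pair 3 :=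
  if h' : x < a then ⟨(x, a), h'⟩ else ⟨(a, x), lt_of_le_of_ne (not_lt.1 h') h.symm⟩

/-- The line between two particles with a density end at `x` if `b.1`, and at `a` if `b.2`. -/
def lineOf (x a : Fin 3) (h : x ≠ a) (b : Bool × Bool) : Line 3 :=
  if b.1 then (if b.2 then .inl (pairOf x a h) else .inr (.inl ⟨(x, a), h⟩))
  else (if b.2 then .inr (.inl ⟨(a, x), h.symm⟩) else .inr (.inr (pairOf x a h)))

lemma pairOf_cases (x a : Fin 3) (h : x ≠ a) :
    (pairOf x a h).1 = (x, a) ∨ (pairOf x a h).1 = (a, x) := by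
  unfold pairOf
  split_ifs <;> simp

lemma eq_pairOf {x a : Fin 3} (h : x ≠ a) {e : Pair 3}
    (he : (e.1.1 = x ∧ e.1.2 = a) ∨ (e.1.1 = a ∧ e.1.2 = x)) : e = pairOf x a h := by
  have h' := e.2
  unfold pairOf
  rcases he with ⟨rfl, rfl⟩ | ⟨rfl, rfl⟩
  · rw [dif_pos h']
  · rw [dif_neg (not_lt.2 h'.le)]

lemma touches_lineOf (x a : Fin 3) (h : x ≠ a) (b : Bool × Bool) (i : Fin 3) :
    (lineOf x a h b).touches i ↔ x = i ∨ a = i := by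
  obtain ⟨b, b'⟩ := b
  cases b <;> cases b' <;> simp only [lineOf, Line.touches, Line.fst, Line.snd, if_true,
    Bool.false_eq_true, if_false]
  · rcases pairOf_cases x a h with h' | h' <;> rw [h']
    exact or_comm
  · exact or_comm
  · rcases pairOf_cases x a h with h' | h' <;> rw [h']
    exact or_comm

lemma deltaAt_lineOf (x a : Fin 3) (h : x ≠ a) (b : Bool × Bool) :
    (lineOf x a h b).deltaAt x ↔ b.1 = true := by
  obtain ⟨b, b'⟩ := b
  cases b <;> cases b' <;> simp only [lineOf, Line.deltaAt, if_true, Bool.false_eq_true, if_false]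
  · simp [h.symm]
  · simp only [iff_true]
    rcases pairOf_cases x a h with h' | h' <;> simp [h']

lemma exists_eq_lineOf {x a : Fin 3} (h : x ≠ a) {l : Line 3}
    (hl : (l.fst = x ∧ l.snd = a) ∨ (l.fst = a ∧ l.snd = x)) : ∃ b, l = lineOf x a h b := by
  rcases l with e | e | e
  · exact ⟨(true, true), by rw [eq_pairOf h hl]; rfl⟩
  · rcases hl with hl | hl
    · exact ⟨(true, false), congrArg (fun e => Sum.inr (Sum.inl e)) (Subtype.ext (Prod.ext hl.1 hl.2))⟩
    · exact ⟨(false, true), congrArg (fun e => Sum.inr (Sum.inl e)) (Subtype.ext (Prod.ext hl.1 hl.2))⟩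
  · exact ⟨(false, false), by rw [eq_pairOf h hl]; rfl⟩

lemma lineOf_injective (x a : Fin 3) (h : x ≠ a) : Function.Injective (lineOf x a h) := by
  rintro ⟨b, b'⟩ ⟨c, c'⟩ hbc
  cases b <;> cases b' <;> cases c <;> cases c' <;> simp_all [lineOf, eq_comm]

lemma Diagram.mult_injective {ℓ N : ℕ} : Function.Injective (Diagram.mult (ℓ := ℓ) (N := N)) := by
  intro d d' h
  have hif : ∀ {p q : Prop} [Decidable p] [Decidable q],
      (if p then 1 else 0 : ℕ) = (if q then 1 else 0) → (p ↔ q) := by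
    intro p q _ _ h
    split_ifs at h <;> simp_all
  refine Prod.ext ?_ (Prod.ext ?_ ?_)
  · exact Finset.ext fun e => hif (congrFun h (.inl e))
  · exact Finset.ext fun e => hif (congrFun h (.inr (.inl e)))
  · exact funext fun e => Fin.ext (congrFun h (.inr (.inr e)))

/-- The diagram consisting of two lines. -/
def ofLines (l l' : Line 3) : Diagram 3 2 :=
  (Finset.univ.filter fun e => .inl e = l ∨ .inl e = l',
    Finset.univ.filter fun e => .inr (.inl e) = l ∨ .inr (.inl e) = l',
    fun e => if .inr (.inr e) = l ∨ .inr (.inr e) = l' then 1 else 0)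

lemma mult_ofLines (l l' l'' : Line 3) :
    (ofLines l l').mult l'' = if l'' = l ∨ l'' = l' then 1 else 0 := by
  rcases l'' with e | e | e
  · simp [Diagram.mult, ofLines, Diagram.dd]
  · simp [Diagram.mult, ofLines, Diagram.dp]
  · simp only [Diagram.mult, ofLines, Diagram.pp]
    split_ifs <;> rfl

lemma mult_ofLines_ne_zero {l l' l'' : Line 3} :
    (ofLines l l').mult l'' ≠ 0 ↔ l'' = l ∨ l'' = l' := by
  rw [mult_ofLines]
  split_ifs with h <;> simp [h]

/-- With `c` constant one this computes the order, with `c` an indicator the number of density ends.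
-/
lemma sum_mult_ofLines {l l' : Line 3} (h : l ≠ l') (c : Line 3 → ℕ) :
    ∑ l'', c l'' * (ofLines l l').mult l'' = c l + c l' := by
  have : ∀ l'', c l'' * (ofLines l l').mult l'' = if l'' ∈ ({l, l'} : Finset (Line 3)) then c l''
      else 0 := by
    intro l''
    rw [mult_ofLines]
    simp
  simp only [this]
  rw [Fintype.sum_ite_mem, Finset.sum_pair h]

lemma System.amp_ofLines (S : System) {l l' : Line 3} (h : l ≠ l') (q L : Fin 3 → E3) :
    S.amp (ofLines l l') q L = S.lineVal q L l * S.lineVal q L l' := by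
  rw [S.amp_eq, Finset.prod_eq_one (s := (Finset.univ : Finset (Pair 3))), one_mul]
  · have : ∀ l'', S.lineVal q L l'' ^ (ofLines l l').mult l'' =
        if l'' ∈ ({l, l'} : Finset (Line 3)) then S.lineVal q L l'' else 1 := by
      intro l''
      rw [mult_ofLines]
      simp only [Finset.mem_insert, Finset.mem_singleton]
      split_ifs <;> simp
    simp only [this]
    rw [Fintype.prod_ite_mem, Finset.prod_pair h]
  · intro e _
    have := mult_ofLines l l' (.inr (.inr e))
    change (ofLines l l').pp e = _ at this
    rw [this]
    split_ifs <;> simp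

lemma ne_add_one (x : Fin 3) : x ≠ x + 1 := by revert x; decide

lemma ne_add_two (x : Fin 3) : x ≠ x + 2 := by revert x; decide

/-- The diagram with centre `x` and given lines to the two other particles. -/
def starDiagram (z : Fin 3 × (Bool × Bool) × (Bool × Bool)) : Diagram 3 2 :=
  ofLines (lineOf z.1 (z.1 + 1) (ne_add_one _) z.2.1) (lineOf z.1 (z.1 + 2) (ne_add_two _) z.2.2)

lemma star_lines_ne (x : Fin 3) (b b' : Bool × Bool) :
    lineOf x (x + 1) (ne_add_one _) b ≠ lineOf x (x + 2) (ne_add_two _) b' := by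
  intro h
  have h1 := (touches_lineOf x (x + 1) (ne_add_one _) b (x + 1)).2 (Or.inr rfl)
  rw [h, touches_lineOf] at h1
  clear h
  revert h1 x
  decide

/-- No two density ends meet at the centre. -/
def starSet : Finset (Fin 3 × (Bool × Bool) × (Bool × Bool)) :=
  Finset.univ.filter fun z => ¬ (z.2.1.1 = true ∧ z.2.2.1 = true)

lemma mem_starSet {z : Fin 3 × (Bool × Bool) × (Bool × Bool)} :
    z ∈ starSet ↔ ¬ (z.2.1.1 = true ∧ z.2.2.1 = true) := by
  rw [starSet, Finset.mem_filter, and_iff_right (Finset.mem_univ z)]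

lemma starDiagram_admissible {z : Fin 3 × (Bool × Bool) × (Bool × Bool)} (hz : z ∈ starSet) :
    (starDiagram z).Admissible := by
  obtain ⟨x, b, b'⟩ := z
  have hz' : ¬ (b.1 = true ∧ b'.1 = true) := mem_starSet.1 hz
  have hne := star_lines_ne x b b'
  refine ⟨?_, fun i => ?_, ?_⟩
  · have := sum_mult_ofLines hne fun _ => 1
    simp only [one_mul] at this
    rw [Diagram.order_eq]
    exact this
  · have := sum_mult_ofLines hne fun l => if l.deltaAt i then 1 else 0
    simp only [ite_mul, one_mul, zero_mul] at this
    rw [Diagram.deltaEnds_eq, starDiagram, this]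
    have h1 : ∀ l : Line 3, l.deltaAt i → l.touches i := fun l h => (l.touches_iff i).2 (Or.inl h)
    -- The two lines share only the centre, where `starSet` excludes two density ends; each leaf has
    -- just one line.
    have h2 : ¬ ((lineOf x (x + 1) (ne_add_one _) b).deltaAt i ∧
        (lineOf x (x + 2) (ne_add_two _) b').deltaAt i) := by
      rintro ⟨h, h'⟩
      by_cases hi : x = i
      · subst hi
        rw [deltaAt_lineOf] at h h'
        exact hz' ⟨h, h'⟩
      · have t1 := h1 _ h
        have t2 := h1 _ h'
        rw [touches_lineOf] at t1 t2
        exact absurd ((t1.resolve_left hi).trans (t2.resolve_left hi).symm)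
          (by clear * -; revert x; decide)
    split_ifs with ha hb hb
    · exact absurd ⟨ha, hb⟩ h2
    all_goals norm_num
  · have hadj : ∀ y, y ≠ x → (starDiagram (x, b, b')).graph.Adj x y := by
      intro y hy
      have hends : ∀ a (h : x ≠ a) c, ((lineOf x a h c).fst = x ∧ (lineOf x a h c).snd = a) ∨
          ((lineOf x a h c).fst = a ∧ (lineOf x a h c).snd = x) := by
        intro a h c
        have h1 := (touches_lineOf x a h c x).2 (Or.inl rfl)
        have h2 := (touches_lineOf x a h c a).2 (Or.inr rfl)
        rcases h1 with h1 | h1 <;> rcases h2 with h2 | h2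
        · exact absurd (h1.symm.trans h2) h
        · exact Or.inl ⟨h1, h2⟩
        · exact Or.inr ⟨h2, h1⟩
        · exact absurd (h1.symm.trans h2) h
      rw [Diagram.adj_iff]
      have h3 : ∀ x y : Fin 3, y ≠ x → y = x + 1 ∨ y = x + 2 := by decide
      rcases h3 x y hy with rfl | rfl
      · exact ⟨_, mult_ofLines_ne_zero.2 (Or.inl rfl), hends _ _ _⟩
      · exact ⟨_, mult_ofLines_ne_zero.2 (Or.inr rfl), hends _ _ _⟩
    have hr : ∀ y, (starDiagram (x, b, b')).graph.Reachable x y := fun y => by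
      by_cases hy : y = x
      · rw [hy]
      · exact (hadj y hy).reachable
    exact { preconnected := fun y y' => (hr y).symm.trans (hr y'), nonempty := ⟨x⟩ }

/-- The centre is recovered as the only particle touched by both lines, and then each line is
identified by its leaf. -/
lemma starDiagram_injective : Function.Injective starDiagram := by
  rintro ⟨x, b, b'⟩ ⟨y, c, c'⟩ h
  have key : ∀ l, (l = lineOf x (x + 1) (ne_add_one _) b ∨ l = lineOf x (x + 2) (ne_add_two _) b') ↔
      (l = lineOf y (y + 1) (ne_add_one _) c ∨ l = lineOf y (y + 2) (ne_add_two _) c') := fun l => by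
    rw [← mult_ofLines_ne_zero, ← mult_ofLines_ne_zero]
    exact iff_of_eq (congrArg (fun d => Diagram.mult d l ≠ 0) h)
  have ht : ∀ l, (l = lineOf y (y + 1) (ne_add_one _) c ∨ l = lineOf y (y + 2) (ne_add_two _) c') →
      l.touches y := by
    rintro l (rfl | rfl) <;> exact (touches_lineOf _ _ _ _ _).2 (Or.inl rfl)
  have h1 := ht _ ((key _).1 (Or.inl rfl))
  have h2 := ht _ ((key _).1 (Or.inr rfl))
  rw [touches_lineOf] at h1 h2
  have hxy : x = y := by
    clear key ht h
    revert x y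
    decide
  subst hxy
  have e1 := (key _).1 (Or.inl rfl)
  have e2 := (key _).1 (Or.inr rfl)
  have e1' := lineOf_injective _ _ _ (e1.resolve_right (star_lines_ne x b c'))
  have e2' := lineOf_injective _ _ _ (e2.resolve_left fun h => star_lines_ne x c b' h.symm)
  rw [e1', e2']

/-- The two lines at the centre already exhaust the order two, so both have multiplicity one and
there are no others. -/
lemma exists_starDiagram {d : Diagram 3 2} (hd : d.Admissible) :
    ∃ z ∈ starSet, starDiagram z = d := by
  obtain ⟨x, hx⟩ := exists_two_lines hd
  obtain ⟨l, hl, h⟩ := hx (x + 1) (ne_add_one x).symm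
  obtain ⟨l', hl', h'⟩ := hx (x + 2) (ne_add_two x).symm
  obtain ⟨b, rfl⟩ := exists_eq_lineOf (ne_add_one x) h
  obtain ⟨b', rfl⟩ := exists_eq_lineOf (ne_add_two x) h'
  have hne := star_lines_ne x b b'
  obtain ⟨ho, hδ, -⟩ := hd
  rw [d.order_eq, ← Finset.add_sum_erase _ _ (Finset.mem_univ (lineOf x (x + 1) (ne_add_one x) b)),
    ← Finset.add_sum_erase _ _ (Finset.mem_erase.2 ⟨hne.symm, Finset.mem_univ _⟩)] at ho
  have hrest : ∑ l ∈ (Finset.univ.erase (lineOf x (x + 1) (ne_add_one x) b)).erase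
      (lineOf x (x + 2) (ne_add_two x) b'), d.mult l = 0 := by omega
  rw [Finset.sum_eq_zero_iff] at hrest
  refine ⟨(x, b, b'), mem_starSet.2 ?_, ?_⟩
  · rintro ⟨hb, hb'⟩
    have h1 := hδ x
    rw [d.deltaEnds_eq] at h1
    have h2 := (Finset.sum_le_sum_of_subset (Finset.subset_univ {lineOf x (x + 1) (ne_add_one x) b,
      lineOf x (x + 2) (ne_add_two x) b'})
      (f := fun l : Line 3 => if l.deltaAt x then d.mult l else 0)).trans h1
    rw [Finset.sum_pair hne, if_pos ((deltaAt_lineOf _ _ _ _).2 hb),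
      if_pos ((deltaAt_lineOf _ _ _ _).2 hb')] at h2
    omega
  · refine Diagram.mult_injective (funext fun l => ?_)
    rw [starDiagram, mult_ofLines]
    split_ifs with hc
    · rcases hc with rfl | rfl <;> simp only <;> omega
    · rw [not_or] at hc
      exact (hrest l (Finset.mem_erase.2 ⟨hc.2, Finset.mem_erase.2 ⟨hc.1, Finset.mem_univ _⟩⟩)).symm

variable (S : System)

/-- The value of a line between `x` and `a` with given density ends. -/
def System.edgeVal (q L : Fin 3 → E3) (x a : Fin 3) (b : Bool × Bool) : ℂ :=
  if b.1 then (if b.2 then S.Cdd (q a - q x) else S.dpLine q L x a)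
  else (if b.2 then S.dpLine q L a x else S.ppLine q L a x)

lemma System.Cdd_neg (r : E3) : S.Cdd (-r) = S.Cdd r := by
  rw [System.Cdd, System.corr_eq, planeAvg_neg]
  simp only [norm_neg]
  rfl

lemma System.Cpp_neg (r : E3) (a b : Fin 3) : S.Cpp (-r) a b = S.Cpp r b a := by
  rw [System.Cpp, System.corr_eq, planeAvg_neg, System.Cpp, System.corr_eq]
  congr 2
  funext h
  simp [mul_comm (h a)]

lemma System.ppLine_comm (q L : Fin 3 → E3) (x a : Fin 3) :
    S.ppLine q L x a = S.ppLine q L a x := by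
  rw [System.ppLine, System.ppLine, Finset.sum_comm]
  congr 1
  refine Finset.sum_congr rfl fun i _ => Finset.sum_congr rfl fun j _ => ?_
  rw [← neg_sub, S.Cpp_neg, mul_comm ((L x j : ℝ) : ℂ)]

/-- Separations are read from the leaf `a` to the centre `x`, whatever the order of the pair. This
is legitimate because `Cdd` is even and reversing the separation in `Cpp` merely transposes its
indices. -/
lemma System.lineVal_lineOf (q L : Fin 3 → E3) (x a : Fin 3) (h : x ≠ a) (b : Bool × Bool) :
    S.lineVal q L (lineOf x a h b) = S.edgeVal q L x a b := by
  obtain ⟨b, b'⟩ := b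
  cases b <;> cases b' <;> simp only [lineOf, System.edgeVal, System.lineVal, if_true,
    Bool.false_eq_true, if_false]
  · rcases pairOf_cases x a h with h' | h' <;> rw [h']
    exact S.ppLine_comm q L x a
  · rcases pairOf_cases x a h with h' | h' <;> rw [h']
    rw [← S.Cdd_neg, neg_sub]

/-- The sum over all lines between `x` and `a`. -/
def System.fullEdge (q L : Fin 3 → E3) (x a : Fin 3) : ℂ := ∑ b, S.edgeVal q L x a b

/-- The sum over all lines between `x` and `a` with a density end at `x`. -/
def System.deltaEdge (q L : Fin 3 → E3) (x a : Fin 3) : ℂ := ∑ b', S.edgeVal q L x a (true, b')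

/-- Only the centre can violate the rule on density ends. The admissible pairs of lines are
therefore all pairs minus those in which both lines have a density end at the centre, and each of
the two sums factorises. -/
theorem System.sum_amp_diagrams (q L : Fin 3 → E3) :
    ∑ d ∈ diagrams 3 2, S.amp d q L = ∑ x, (S.fullEdge q L x (x + 1) * S.fullEdge q L x (x + 2)
      - S.deltaEdge q L x (x + 1) * S.deltaEdge q L x (x + 2)) := by
  have hT : ∀ d : Diagram 3 2, d ∈ diagrams 3 2 ↔ d.Admissible := mem_diagrams
  generalize diagrams 3 2 = T at hT ⊢
  have h := Finset.sum_nbij (s := starSet) (t := T)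
    (f := fun z => S.edgeVal q L z.1 (z.1 + 1) z.2.1 * S.edgeVal q L z.1 (z.1 + 2) z.2.2)
    (g := fun d => S.amp d q L) starDiagram (fun z hz => (hT _).2 (starDiagram_admissible hz))
    starDiagram_injective.injOn (fun d hd => by
      obtain ⟨z, hz, h⟩ := exists_starDiagram ((hT d).1 (Finset.mem_coe.1 hd))
      exact ⟨z, Finset.mem_coe.2 hz, h⟩) fun z _ => by
      rw [starDiagram, S.amp_ofLines (star_lines_ne _ _ _), S.lineVal_lineOf, S.lineVal_lineOf]
  rw [← h, starSet, Finset.sum_filter, Fintype.sum_prod_type]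
  refine Finset.sum_congr rfl fun x _ => ?_
  simp [Fintype.sum_prod_type, System.fullEdge, System.deltaEdge]
  ring

end SecondOrder

/-! ### Second order amplitudes when every particle carries a field -/

section Symbol

variable {n : ℕ}

/-- Combinations, with coefficients of temperate growth, of plane wave averages in `q a - q x`,
together with the corresponding weight. -/
def PlaneLine (n : ℕ) (a x : Fin 3) (u : (Fin 3 → E3) → (Fin n → E3) → ℂ)
    (w : (Fin n → E3) → E3 → ℂ) : Prop :=
  ∃ (ι : Type) (_ : Fintype ι) (m : ι → (Fin n → E3) → ℂ) (W : ι → E3 → ℝ),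
    (∀ i, (m i).HasTemperateGrowth) ∧ (∀ i, Integrable (W i)) ∧
      (∀ q k, u q k = ∑ i, m i k * planeAvg (W i) (q a - q x)) ∧
      ∀ k h, w k h = ∑ i, m i k * (W i h : ℂ)

lemma PlaneLine.add {a x : Fin 3} {u v : (Fin 3 → E3) → (Fin n → E3) → ℂ}
    {w z : (Fin n → E3) → E3 → ℂ} (hu : PlaneLine n a x u w) (hv : PlaneLine n a x v z) :
    PlaneLine n a x (fun q k => u q k + v q k) (fun k h => w k h + z k h) := by
  obtain ⟨ι, _, m, W, hm, hW, hu, hw⟩ := hu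
  obtain ⟨ι', _, m', W', hm', hW', hv, hz⟩ := hv
  refine ⟨ι ⊕ ι', inferInstance, Sum.elim m m', Sum.elim W W', ?_, ?_, ?_, ?_⟩
  · rintro (i | i)
    · exact hm i
    · exact hm' i
  · rintro (i | i)
    · exact hW i
    · exact hW' i
  · intro q k
    simp [hu, hv]
  · intro k h
    simp [hw, hz]

lemma PlaneLine.congr {a x : Fin 3} {u v : (Fin 3 → E3) → (Fin n → E3) → ℂ}
    {w z : (Fin n → E3) → E3 → ℂ} (hu : PlaneLine n a x u w) (h₁ : ∀ q k, v q k = u q k)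
    (h₂ : ∀ k h, z k h = w k h) : PlaneLine n a x v z := by
  obtain rfl : v = u := funext fun q => funext fun k => h₁ q k
  obtain rfl : z = w := funext fun q => funext fun k => h₂ q k
  exact hu

variable {S : System}

lemma System.Regular.hasLim_planeLine_mul (hS : S.Regular) {m : ℕ} {t : Fin (m + 3) → ℝ}
    {σ : Fin (m + 3) → Fin 3} (hσ : Function.Surjective σ) (e : Equiv.Perm (Fin 3))
    {u v : (Fin 3 → E3) → (Fin (m + 3) → E3) → ℂ} {w z : (Fin (m + 3) → E3) → E3 → ℂ}
    (hu : PlaneLine (m + 3) (e 0) (e 2) u w) (hv : PlaneLine (m + 3) (e 1) (e 2) v z) :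
    S.HasLim t σ (fun q k => u q k * v q k)
      (fun k => w k (waveSum σ k (e 0)) * z k (waveSum σ k (e 1)) * S.damping t σ k) := by
  obtain ⟨ι, _, m, W, hm, hW, hu, hw⟩ := hu
  obtain ⟨ι', _, m', W', hm', hW', hv, hz⟩ := hv
  have h := System.HasLim.sum (s := (Finset.univ : Finset (ι × ι'))) (fun i _ =>
    (hS.hasLim_of_surjective (t := t) hσ e (hW i.1) (hW' i.2)).temperate_mul
      ((hm i.1).mul (hm' i.2)))
  have e1 : (fun (q : Fin 3 → E3) (k : Fin (_ + 3) → E3) => u q k * v q k) = fun q k =>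
      ∑ i : ι × ι', (m i.1 * m' i.2) k *
        (planeAvg (W i.1) (q (e 0) - q (e 2)) * planeAvg (W' i.2) (q (e 1) - q (e 2))) := by
    funext q k
    rw [hu, hv, Finset.sum_mul_sum, ← Finset.sum_product']
    refine Finset.sum_congr rfl fun i _ => ?_
    simp only [Pi.mul_apply]
    ring
  have e2 : (fun k : Fin (_ + 3) → E3 => w k (waveSum σ k (e 0)) * z k (waveSum σ k (e 1)) *
      S.damping t σ k) = fun k => ∑ i : ι × ι', (m i.1 * m' i.2) k *
        (((W i.1 (waveSum σ k (e 0)) : ℂ) * (W' i.2 (waveSum σ k (e 1)) : ℂ)) *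
          S.damping t σ k) := by
    funext k
    rw [hw, hz, Finset.sum_mul_sum, ← Finset.sum_product', Finset.sum_mul]
    refine Finset.sum_congr rfl fun i _ => ?_
    simp only [Pi.mul_apply]
    ring
  rw [e1, e2]
  exact h

/-- `α L·h / h²`. -/
def System.proj (S : System) (L h : E3) : ℝ := S.alpha * (inner ℝ L h / ‖h‖ ^ 2)

lemma System.proj_eq_sum (S : System) (L h : E3) :
    S.proj L h = ∑ i, S.alpha * L i * (h i / ‖h‖ ^ 2) := by
  rw [System.proj, PiLp.inner_apply, Finset.sum_div, Finset.mul_sum]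
  refine Finset.sum_congr rfl fun i _ => ?_
  simp only [RCLike.inner_apply, conj_trivial]
  ring

lemma System.corr_dp_neg (S : System) (i : Fin 3) (r : E3) :
    S.corr (fun h => h i / ‖h‖ ^ 2) (-r) = -S.corr (fun h => h i / ‖h‖ ^ 2) r := by
  rw [System.corr_eq, planeAvg_neg, planeAvg, planeAvg, ← mul_neg, ← integral_neg]
  congr 2
  funext h
  simp [neg_div]

/-! ### Fourier weights of the lines between a leaf and the centre -/

section Edges

variable {L : (Fin n → E3) → Fin 3 → E3}

lemma System.Regular.planeLine_Cdd (hS : S.Regular) (a x : Fin 3) :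
    PlaneLine n a x (fun q _ => S.Cdd (q a - q x)) (fun _ h => (S.P0 ‖h‖ : ℂ)) :=
  ⟨Unit, inferInstance, fun _ _ => 1, fun _ h => 1 * S.P0 ‖h‖,
    fun _ => Function.HasTemperateGrowth.const _, fun _ => by simpa using hS.int,
    fun q k => by simp [System.Cdd, System.corr_eq], fun k h => by simp⟩

/-- The density sits at the centre, so the correlation is taken at $q_x-q_a$; it is odd, whence the
sign opposite to that in `planeLine_dp_in`. -/
lemma System.Regular.planeLine_dp_out (hS : S.Regular) (a x : Fin 3)
    (hL : ∀ j a, (fun k => ((L k j a : ℝ) : ℂ)).HasTemperateGrowth) :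
    PlaneLine n a x (fun q k => S.dpLine q (L k) x a)
      (fun k h => ((S.proj (L k a) h * S.P0 ‖h‖ : ℝ) : ℂ)) := by
  refine ⟨Fin 3, inferInstance, fun i k => (S.alpha : ℂ) * ((L k a i : ℝ) : ℂ),
    fun i h => h i / ‖h‖ ^ 2 * S.P0 ‖h‖,
    fun i => (Function.HasTemperateGrowth.const _).mul (hL a i), fun i => hS.integrable_dp i,
    fun q k => ?_, fun k h => ?_⟩
  · simp only [System.dpLine]
    refine Finset.sum_congr rfl fun i _ => ?_
    rw [System.Cdp, ← neg_sub, S.corr_dp_neg, ← System.corr_eq]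
    linear_combination -(S.alpha : ℂ) * S.corr (fun h => h i / ‖h‖ ^ 2) (q a - q x) *
      ((L k a i : ℝ) : ℂ) * Complex.I_mul_I
  · beta_reduce
    rw [S.proj_eq_sum, Finset.sum_mul]
    push_cast
    refine Finset.sum_congr rfl fun i _ => ?_
    ring

lemma System.Regular.planeLine_dp_in (hS : S.Regular) (a x : Fin 3)
    (hL : ∀ j a, (fun k => ((L k j a : ℝ) : ℂ)).HasTemperateGrowth) :
    PlaneLine n a x (fun q k => S.dpLine q (L k) a x)
      (fun k h => ((-S.proj (L k x) h * S.P0 ‖h‖ : ℝ) : ℂ)) := by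
  refine ⟨Fin 3, inferInstance, fun i k => -(S.alpha : ℂ) * ((L k x i : ℝ) : ℂ),
    fun i h => h i / ‖h‖ ^ 2 * S.P0 ‖h‖,
    fun i => (Function.HasTemperateGrowth.const _).mul (hL x i), fun i => hS.integrable_dp i,
    fun q k => ?_, fun k h => ?_⟩
  · simp only [System.dpLine]
    refine Finset.sum_congr rfl fun i _ => ?_
    rw [System.Cdp, ← System.corr_eq]
    linear_combination (S.alpha : ℂ) * S.corr (fun h => h i / ‖h‖ ^ 2) (q a - q x) *
      ((L k x i : ℝ) : ℂ) * Complex.I_mul_I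
  · beta_reduce
    rw [S.proj_eq_sum, neg_mul, Finset.sum_mul, ← Finset.sum_neg_distrib]
    push_cast
    refine Finset.sum_congr rfl fun i _ => ?_
    ring

lemma System.Regular.planeLine_pp (hS : S.Regular) (a x : Fin 3)
    (hL : ∀ j a, (fun k => ((L k j a : ℝ) : ℂ)).HasTemperateGrowth) :
    PlaneLine n a x (fun q k => S.ppLine q (L k) a x)
      (fun k h => ((-(S.proj (L k a) h * S.proj (L k x) h) * S.P0 ‖h‖ : ℝ) : ℂ)) := by
  refine ⟨Fin 3 × Fin 3, inferInstance,
    fun i k => -(S.alpha : ℂ) ^ 2 * (((L k a i.1 : ℝ) : ℂ) * ((L k x i.2 : ℝ) : ℂ)),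
    fun i h => h i.1 * h i.2 / ‖h‖ ^ 4 * S.P0 ‖h‖,
    fun i => (Function.HasTemperateGrowth.const _).mul ((hL a i.1).mul (hL x i.2)),
    fun i => hS.integrable_pp i.1 i.2, fun q k => ?_, fun k h => ?_⟩
  · simp only [System.ppLine]
    rw [Fintype.sum_prod_type, ← Finset.sum_neg_distrib]
    refine Finset.sum_congr rfl fun i _ => ?_
    rw [← Finset.sum_neg_distrib]
    refine Finset.sum_congr rfl fun j _ => ?_
    rw [System.Cpp, ← System.corr_eq]
    ring
  · beta_reduce
    rw [S.proj_eq_sum, S.proj_eq_sum, Finset.sum_mul_sum, neg_mul, Finset.sum_mul,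
      Fintype.sum_prod_type, ← Finset.sum_neg_distrib]
    push_cast
    refine Finset.sum_congr rfl fun i _ => ?_
    rw [Finset.sum_mul, ← Finset.sum_neg_distrib]
    refine Finset.sum_congr rfl fun j _ => ?_
    have : (‖h‖ : ℂ) ^ 4 = (‖h‖ : ℂ) ^ 2 * (‖h‖ : ℂ) ^ 2 := by ring
    rw [this, mul_div_mul_comm]
    ring

lemma System.Regular.planeLine_deltaEdge (hS : S.Regular) (a x : Fin 3)
    (hL : ∀ j a, (fun k => ((L k j a : ℝ) : ℂ)).HasTemperateGrowth) :
    PlaneLine n a x (fun q k => S.deltaEdge q (L k) x a)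
      (fun k h => ((S.P0 ‖h‖ * (1 + S.proj (L k a) h) : ℝ) : ℂ)) := by
  refine ((hS.planeLine_Cdd a x).add (hS.planeLine_dp_out a x hL)).congr (fun q k => ?_)
    fun k h => ?_
  · simp [System.deltaEdge, System.edgeVal]
  · push_cast
    ring

/-- With $A_y=\alpha L_y\cdot h/h^2$ the four kinds of line contribute $1$, $A_a$, $-A_x$ and
$-A_aA_x$, which factorise as $(1+A_a)(1-A_x)$. -/
lemma System.Regular.planeLine_fullEdge (hS : S.Regular) (a x : Fin 3)
    (hL : ∀ j a, (fun k => ((L k j a : ℝ) : ℂ)).HasTemperateGrowth) :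
    PlaneLine n a x (fun q k => S.fullEdge q (L k) x a)
      (fun k h => ((S.P0 ‖h‖ * (1 + S.proj (L k a) h) * (1 - S.proj (L k x) h) : ℝ) : ℂ)) := by
  refine (((hS.planeLine_Cdd a x).add (hS.planeLine_dp_out a x hL)).add
    ((hS.planeLine_dp_in a x hL).add (hS.planeLine_pp a x hL))).congr (fun q k => ?_) fun k h => ?_
  · simp [System.fullEdge, System.edgeVal, Fintype.sum_prod_type]
  · push_cast
    ring

end Edges

/-- The contribution of the diagrams with centre `x` and leaves `a`, `b`, in terms of the total
wave vectors `κ` and the vectors `L`. -/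
def System.star (S : System) (κ L : Fin 3 → E3) (a b x : Fin 3) : ℝ :=
  S.P0 ‖κ a‖ * (1 + S.proj (L a) (κ a)) * (S.P0 ‖κ b‖ * (1 + S.proj (L b) (κ b))) *
    ((1 - S.proj (L x) (κ a)) * (1 - S.proj (L x) (κ b)) - 1)

/-- For each centre, the difference of the full and the density edges has $P_0(1+A_a)\,P_0(1+A_b)$
as a common factor, with $(1-A_x)(1-A_x')-1$ left over. -/
theorem System.Regular.hasLim_sum_amp (hS : S.Regular) {m : ℕ} {t : Fin (m + 3) → ℝ}
    {σ : Fin (m + 3) → Fin 3} (hσ : Function.Surjective σ) :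
    S.HasLim t σ (fun q k => ∑ d ∈ diagrams 3 2, S.amp d q (S.momVec t σ k S.ti))
      (fun k => ((S.damping t σ k * ∑ x, S.star (waveSum σ k) (S.momVec t σ k S.ti)
        (x + 1) (x + 2) x : ℝ) : ℂ)) := by
  have hL := S.hasTemperateGrowth_momVec t σ S.ti
  have hperm : ∀ x : Fin 3, ∃ e : Equiv.Perm (Fin 3), e 0 = x + 1 ∧ e 1 = x + 2 ∧ e 2 = x := by
    decide
  have hx : ∀ x ∈ (Finset.univ : Finset (Fin 3)), S.HasLim t σ (fun q k =>
      S.fullEdge q (S.momVec t σ k S.ti) x (x + 1) * S.fullEdge q (S.momVec t σ k S.ti) x (x + 2)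
      - S.deltaEdge q (S.momVec t σ k S.ti) x (x + 1) *
        S.deltaEdge q (S.momVec t σ k S.ti) x (x + 2))
      (fun k => ((S.damping t σ k * S.star (waveSum σ k) (S.momVec t σ k S.ti)
        (x + 1) (x + 2) x : ℝ) : ℂ)) := by
    intro x _
    obtain ⟨e, h0, h1, h2⟩ := hperm x
    have hF := hS.hasLim_planeLine_mul (t := t) hσ e
      (hS.planeLine_fullEdge (e 0) (e 2) hL) (hS.planeLine_fullEdge (e 1) (e 2) hL)
    have hD := (hS.hasLim_planeLine_mul (t := t) hσ e
      (hS.planeLine_deltaEdge (e 0) (e 2) hL) (hS.planeLine_deltaEdge (e 1) (e 2) hL)).const_mul (-1)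
    rw [h0, h1, h2] at hF hD
    have h := hF.add hD
    simp only [neg_one_mul, ← sub_eq_add_neg] at h
    refine (congrArg (fun T => S.HasLim t σ _ T) ?_).mp h
    funext k
    rw [System.star]
    push_cast
    ring
  have h := System.HasLim.sum hx
  simp only [S.sum_amp_diagrams, Finset.mul_sum]
  push_cast at h ⊢
  exact h

end Symbol

/-! ### Sums over the distributions of the fields -/

section Values

variable (S : System)

lemma System.star_comm (κ L : Fin 3 → E3) (a b x : Fin 3) :
    S.star κ L a b x = S.star κ L b a x := by
  unfold System.star
  ring

/-- The sum over centres does not depend on the numbering of the particles, because `star` is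
symmetric in its leaves. -/
lemma System.sum_star (κ L : Fin 3 → E3) (e : Equiv.Perm (Fin 3)) :
    ∑ x, S.star κ L (x + 1) (x + 2) x = S.star κ L (e 1) (e 2) (e 0)
      + S.star κ L (e 2) (e 0) (e 1) + S.star κ L (e 0) (e 1) (e 2) := by
  -- A permutation of three elements either preserves or reverses their cyclic order.
  have h3 : ∀ e : Equiv.Perm (Fin 3), ∀ x, (e x + 1 = e (x + 1) ∧ e x + 2 = e (x + 2)) ∨
      (e x + 1 = e (x + 2) ∧ e x + 2 = e (x + 1)) := by decide
  have h : ∀ x, S.star κ L (e x + 1) (e x + 2) (e x) = S.star κ L (e (x + 1)) (e (x + 2)) (e x) := by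
    intro x
    rcases h3 e x with ⟨h, h'⟩ | ⟨h, h'⟩
    · rw [h, h']
    · rw [h, h', S.star_comm]
  rw [← Equiv.sum_comp e, Fin.sum_univ_three, h, h, h]
  rfl

/-- The value of all second order diagrams in terms of the wave vectors and the vectors `L`. -/
def System.starTotal {n : ℕ} (t : Fin n → ℝ) (σ : Fin n → Fin 3) (k : Fin n → E3) : ℝ :=
  S.damping t σ k * ∑ x, S.star (waveSum σ k) (S.momVec t σ k S.ti) (x + 1) (x + 2) x

/-- For $k\ne0$ the quotient $k\cdot k/k^2$ is $1$. At $k=0$ it is $0/0=0$, and the identity holds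
there only thanks to the factor $P_0(0)=0$. -/
lemma System.P0_mul_proj_smul (h0 : S.P0 0 = 0) (g : ℝ) (k : E3) :
    S.P0 ‖k‖ * (1 + S.proj (g • k) k) = S.P0 ‖k‖ * (1 + S.alpha * g) := by
  by_cases hk : k = 0
  · rw [hk, norm_zero, h0, zero_mul, zero_mul]
  · have : ‖k‖ ^ 2 ≠ 0 := by
      have := norm_pos_iff.2 hk
      positivity
    rw [System.proj, real_inner_smul_left, real_inner_self_eq_norm_sq, mul_div_assoc,
      div_self this, mul_one]

lemma waveSum_of_injective {n ℓ : ℕ} {σ : Fin n → Fin ℓ} (hσ : Function.Injective σ)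
    (k : Fin n → E3) (s : Fin n) : waveSum σ k (σ s) = k s := by
  rw [waveSum, Finset.sum_eq_single s]
  · rw [if_pos rfl]
  · exact fun r _ hr => if_neg fun h => hr (hσ h)
  · simp

lemma System.momVec_eq_waveSum {n ℓ : ℕ} (t : Fin n → ℝ) (σ : Fin n → Fin ℓ) (k : Fin n → E3)
    (t' : ℝ) (j : Fin ℓ) :
    S.momVec t σ k t' j = waveSum σ (fun s => S.gqp (t s) t' • k s) j := rfl

theorem System.starTotal_three (h0 : S.P0 0 = 0) (t : Fin 3 → ℝ) {σ : Fin 3 → Fin 3}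
    (hσ : Function.Surjective σ) (k : Fin 3 → E3) : S.starTotal t σ k = S.T111 t k := by
  have hinj : Function.Injective σ := Finite.injective_iff_surjective.2 hσ
  let e : Equiv.Perm (Fin 3) := Equiv.ofBijective σ ⟨hinj, hσ⟩
  have he : ∀ s, e s = σ s := fun s => rfl
  have hκ : ∀ s, waveSum σ k (e s) = k s := waveSum_of_injective hinj k
  have hL : ∀ s, S.momVec t σ k S.ti (e s) = S.Kv t k s := fun s =>
    waveSum_of_injective hinj _ s
  have hstar : ∀ a b c, S.star (waveSum σ k) (S.momVec t σ k S.ti) (e a) (e b) (e c)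
      = S.T111term t k a b c := by
    intro a b c
    rw [System.star, hκ, hκ, hL, hL, hL]
    have h1 := S.P0_mul_proj_smul h0 (S.g t a) (k a)
    have h2 := S.P0_mul_proj_smul h0 (S.g t b) (k b)
    change _ * (1 + S.proj (S.Kv t k a) (k a)) = _ at h1
    change _ * (1 + S.proj (S.Kv t k b) (k b)) = _ at h2
    rw [h1, h2, System.T111term, System.proj, System.proj]
    ring
  rw [System.starTotal, S.sum_star _ _ e, hstar, hstar, hstar, System.damping, System.T111,
    sum_perm_three e, hL, hL, hL]
  ring

/-- The fields `c` and `d` share a particle, which enters through $k_c+k_d$ and $K_c+K_d$. The three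
choices of the centre give the three summands of `T112`. -/
theorem System.starTotal_four (h0 : S.P0 0 = 0) (t : Fin 4 → ℝ) {σ : Fin 4 → Fin 3}
    {a b c d : Fin 4} (hsum : ∀ f : Fin 4 → E3, ∑ r, f r = f a + f b + f c + f d)
    (hab : σ a ≠ σ b) (hac : σ a ≠ σ c) (hbc : σ b ≠ σ c) (hcd : σ c = σ d) (k : Fin 4 → E3) :
    S.starTotal t σ k = S.T112 t k a b c d := by
  have hinj : Function.Injective ![σ a, σ b, σ c] := by
    intro i j hij
    fin_cases i <;> fin_cases j <;> simp_all [eq_comm]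
  let e : Equiv.Perm (Fin 3) := Equiv.ofBijective _ (Finite.injective_iff_bijective.1 hinj)
  have e0 : e 0 = σ a := rfl
  have e1 : e 1 = σ b := rfl
  have e2 : e 2 = σ c := rfl
  have hw : ∀ v : Fin 4 → E3, waveSum σ v (e 0) = v a ∧ waveSum σ v (e 1) = v b ∧
      waveSum σ v (e 2) = v c + v d := by
    intro v
    rw [e0, e1, e2]
    refine ⟨?_, ?_, ?_⟩ <;> rw [waveSum, hsum]
    · simp [hab.symm, hac.symm, ← hcd]
    · simp [hab, hbc.symm, ← hcd]
    · simp only [← hcd, hac, hbc, if_true, if_false, zero_add]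
  obtain ⟨κ0, κ1, κ2⟩ := hw k
  obtain ⟨L0, L1, L2⟩ := hw fun s => S.gqp (t s) S.ti • k s
  rw [← S.momVec_eq_waveSum t σ k S.ti] at L0 L1 L2
  change _ = S.Kv t k a at L0
  change _ = S.Kv t k b at L1
  change _ = S.Kv t k c + S.Kv t k d at L2
  have h1 := S.P0_mul_proj_smul h0 (S.g t a) (k a)
  have h2 := S.P0_mul_proj_smul h0 (S.g t b) (k b)
  change _ * (1 + S.proj (S.Kv t k a) (k a)) = _ at h1
  change _ * (1 + S.proj (S.Kv t k b) (k b)) = _ at h2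
  rw [System.starTotal, S.sum_star _ _ e, System.star, System.star, System.star, System.damping,
    sum_perm_three e, κ0, κ1, κ2, L0, L1, L2, h1, h2, System.T112, System.T112term,
    System.T112term]
  simp only [System.proj]
  ring

/-! ### Blocks of four fields on three particles -/

/-- The six ways to distribute four fields over three particles, up to permutations of the
particles; the last two fields share a particle. -/
def block : Fin 6 → Fin 4 → Fin 4 :=
  ![![0, 1, 2, 3], ![0, 2, 1, 3], ![0, 3, 1, 2], ![1, 2, 0, 3], ![1, 3, 0, 2], ![2, 3, 0, 1]]

lemma sum_block {M : Type*} [AddCommMonoid M] (i : Fin 6) (f : Fin 4 → M) :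
    ∑ r, f r = f (block i 0) + f (block i 1) + f (block i 2) + f (block i 3) := by
  have h : ∀ i, Function.Bijective (block i) := by decide
  rw [← (Equiv.ofBijective _ (h i)).sum_comp, Fin.sum_univ_four]
  rfl

lemma block_distinct : ∀ (σ : Fin 4 → Fin 3), Function.Surjective σ → ∀ i,
    σ (block i 2) = σ (block i 3) → σ (block i 0) ≠ σ (block i 1) ∧
      σ (block i 0) ≠ σ (block i 2) ∧ σ (block i 1) ≠ σ (block i 2) := by
  decide

lemma exists_unique_block : ∀ (σ : Fin 4 → Fin 3), Function.Surjective σ →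
    ∃ i, ∀ i', σ (block i' 2) = σ (block i' 3) ↔ i' = i := by
  decide

lemma card_block : ∀ i, (Finset.univ.filter fun σ : Fin 4 → Fin 3 =>
    Function.Surjective σ ∧ σ (block i 2) = σ (block i 3)).card = 6 := by
  decide

lemma sum_surjective_three {U : (Fin 3 → Fin 3) → ℂ} {T : ℂ}
    (h0 : ∀ σ, ¬ Function.Surjective σ → U σ = 0) (h1 : ∀ σ, Function.Surjective σ → U σ = T) :
    T = (Nat.factorial 3 : ℂ)⁻¹ * ∑ σ, U σ := by
  have hU : ∀ σ, U σ = if Function.Surjective σ then T else 0 := fun σ => by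
    split_ifs with h
    · exact h1 σ h
    · exact h0 σ h
  have hc : (Finset.univ.filter fun σ : Fin 3 → Fin 3 => Function.Surjective σ).card = 6 := by
    decide
  simp only [hU]
  rw [← Finset.sum_filter, Finset.sum_const, hc]
  rw [nsmul_eq_mul, ← mul_assoc]
  norm_num [Nat.factorial]

/-- A surjection of four fields onto three particles has exactly one pair sharing a particle. Each
of the six pairs arises from $3!$ surjections, which cancels the prefactor. -/
lemma sum_surjective_four {U : (Fin 4 → Fin 3) → ℂ} {T : Fin 6 → ℂ}
    (h0 : ∀ σ, ¬ Function.Surjective σ → U σ = 0)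
    (h1 : ∀ σ i, Function.Surjective σ → σ (block i 2) = σ (block i 3) → U σ = T i) :
    ∑ i, T i = (Nat.factorial 3 : ℂ)⁻¹ * ∑ σ, U σ := by
  have hU : ∀ σ, U σ = ∑ i, if Function.Surjective σ ∧ σ (block i 2) = σ (block i 3) then T i
      else 0 := fun σ => by
    by_cases hσ : Function.Surjective σ
    · obtain ⟨i, hi⟩ := exists_unique_block σ hσ
      simp only [hi, hσ, true_and, Finset.sum_ite_eq', Finset.mem_univ, if_true]
      exact h1 σ i hσ ((hi i).2 rfl)
    · simp [hσ, h0 σ hσ]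
  simp only [hU]
  rw [Finset.sum_comm, Finset.mul_sum]
  refine Finset.sum_congr rfl fun i _ => ?_
  rw [← Finset.sum_filter, Finset.sum_const, card_block]
  rw [nsmul_eq_mul, ← mul_assoc]
  norm_num [Nat.factorial]

/-! ### The cumulants -/

variable {S}

lemma System.resp_rho {n ℓ : ℕ} (t : Fin n → ℝ) (σ : Fin n → Fin ℓ) (k : Fin n → E3) :
    S.resp (fun _ => FieldType.rho) t σ k = 1 := by
  simp [System.resp, System.oneResp]

/-- A response field which no later field on the same particle can respond to vanishes. -/
lemma System.resp_eq_zero (hgqp : ∀ t t', t ≤ t' → S.gqp t t' = 0) {n ℓ : ℕ}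
    {f : Fin n → FieldType} {t : Fin n → ℝ} {σ : Fin n → Fin ℓ} {s : Fin n}
    (hs : f s = FieldType.B) (hlast : ∀ r, σ r = σ s → t r ≤ t s) (k : Fin n → E3) :
    S.resp f t σ k = 0 := by
  refine Finset.prod_eq_zero (Finset.mem_univ s) ?_
  have h : S.momVec t σ k (t s) (σ s) = 0 := by
    rw [System.momVec]
    refine Finset.sum_eq_zero fun r _ => ?_
    split_ifs with hr
    · rw [hgqp _ _ (hlast r hr), zero_smul]
    · rfl
  rw [h, hs]
  simp [System.oneResp]

/-- Non-surjective distributions drop out at every order, so it suffices that the response factors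
vanish on surjective ones; the diagrams need not be known. -/
theorem System.Regular.cumulantEq_zero (hS : S.Regular)
    (hgqq : ∀ t, S.ti ≤ t → S.gqq t S.ti = 1) {n N : ℕ} {f : Fin (n + 1) → FieldType}
    {t : Fin (n + 1) → ℝ} (ht : ∀ s, S.ti ≤ t s)
    (hresp : ∀ σ : Fin (n + 1) → Fin 3, Function.Surjective σ → ∀ k, S.resp f t σ k = 0) :
    S.CumulantEq 3 N f t 0 := by
  refine S.cumulantEq_of_hasLim hgqq ht (U := fun _ _ => 0) (fun σ => ?_) (by simp)
  by_cases hσ : Function.Surjective σ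
  · simp only [hresp σ hσ, zero_mul]
    exact System.HasLim.zero
  · exact hS.hasLim_of_not_surjective f hσ

theorem System.cumulantEq_zero_of_lt_two
    (hgqq : ∀ t, S.ti ≤ t → S.gqq t S.ti = 1) {n N : ℕ} {f : Fin (n + 1) → FieldType}
    {t : Fin (n + 1) → ℝ} (ht : ∀ s, S.ti ≤ t s) (hN : N < 2) :
    S.CumulantEq 3 N f t 0 := by
  refine S.cumulantEq_of_hasLim hgqq ht (U := fun _ _ => 0) (fun σ => ?_) (by simp)
  simp only [diagrams_three_eq_empty hN, Finset.sum_empty, mul_zero]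
  exact System.HasLim.zero

theorem System.Regular.cumulantEq_two (hS : S.Regular)
    (hgqq : ∀ t, S.ti ≤ t → S.gqq t S.ti = 1) {m : ℕ} {f : Fin (m + 3) → FieldType}
    {t : Fin (m + 3) → ℝ} (ht : ∀ s, S.ti ≤ t s) {T : (Fin (m + 3) → E3) → ℂ}
    (hT : ∀ k, T k = (Nat.factorial 3 : ℂ)⁻¹ * ∑ σ : Fin (m + 3) → Fin 3,
      if Function.Surjective σ then S.resp f t σ k * (S.starTotal t σ k : ℂ) else 0) :
    S.CumulantEq 3 2 f t T := by
  refine S.cumulantEq_of_hasLim hgqq ht (U := fun σ k =>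
    if Function.Surjective σ then S.resp f t σ k * (S.starTotal t σ k : ℂ) else 0)
    (fun σ => ?_) fun k => hT _
  by_cases hσ : Function.Surjective σ
  · simp only [if_pos hσ]
    exact (hS.hasLim_sum_amp hσ).temperate_mul (S.hasTemperateGrowth_resp f t σ)
  · simp only [if_neg hσ]
    exact hS.hasLim_of_not_surjective f hσ

theorem System.Regular.cumulantEq_rho_three (hS : S.Regular)
    (hgqq : ∀ t, S.ti ≤ t → S.gqq t S.ti = 1) {t : Fin 3 → ℝ} (ht : ∀ s, S.ti ≤ t s) :
    S.CumulantEq 3 2 (fun _ => FieldType.rho) t fun k => (S.T111 t k : ℂ) := by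
  refine hS.cumulantEq_two hgqq ht (m := 0) fun k => ?_
  refine sum_surjective_three (fun σ hσ => if_neg hσ) fun σ hσ => ?_
  rw [if_pos hσ, System.resp_rho, one_mul, S.starTotal_three hS.zero t hσ k]

/-- Three fields on three particles sit one on each, so a response field could only respond to
itself, and $g_{qp}(t,t)=0$. -/
theorem System.Regular.cumulantEq_B_three (hS : S.Regular)
    (hgqq : ∀ t, S.ti ≤ t → S.gqq t S.ti = 1) (hgqp : ∀ t t', t ≤ t' → S.gqp t t' = 0)
    {f : Fin 3 → FieldType} {t : Fin 3 → ℝ} (ht : ∀ s, S.ti ≤ t s)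
    (hf : ∃ s, f s = FieldType.B) (N : ℕ) : S.CumulantEq 3 N f t 0 := by
  obtain ⟨s, hs⟩ := hf
  refine hS.cumulantEq_zero hgqq ht fun σ hσ k => System.resp_eq_zero hgqp hs (fun r hr => ?_) k
  rw [Finite.injective_iff_surjective.2 hσ hr]

/-- The value of the second order diagrams when the fields are distributed in a given block. -/
def System.blockValue (S : System) (t : Fin 4 → ℝ) (k : Fin 4 → E3) (i : Fin 6) : ℝ :=
  S.T112 t k (block i 0) (block i 1) (block i 2) (block i 3)

lemma System.sum_blocks {t : Fin 4 → ℝ} {f : Fin 4 → FieldType} {k : Fin 4 → E3} (h0 : S.P0 0 = 0)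
    {R : Fin 6 → ℂ} (hR : ∀ σ i, Function.Surjective σ → σ (block i 2) = σ (block i 3) →
      S.resp (ℓ := 3) f t σ k = R i) :
    ∑ i, R i * (S.blockValue t k i : ℂ) = (Nat.factorial 3 : ℂ)⁻¹ * ∑ σ : Fin 4 → Fin 3,
      if Function.Surjective σ then S.resp f t σ k * (S.starTotal t σ k : ℂ) else 0 := by
  refine sum_surjective_four (fun σ hσ => if_neg hσ) fun σ i hσ hi => ?_
  obtain ⟨h01, h02, h12⟩ := block_distinct σ hσ i hi
  rw [if_pos hσ, hR σ i hσ hi, S.starTotal_four h0 t (sum_block i) h01 h02 h12 hi k]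
  rfl

theorem System.Regular.cumulantEq_rho_four (hS : S.Regular)
    (hgqq : ∀ t, S.ti ≤ t → S.gqq t S.ti = 1) {t : Fin 4 → ℝ} (ht : ∀ s, S.ti ≤ t s) :
    S.CumulantEq 3 2 (fun _ => FieldType.rho) t fun k =>
      ((S.T112 t k 0 1 2 3 + S.T112 t k 0 2 1 3 + S.T112 t k 0 3 1 2
        + S.T112 t k 1 2 0 3 + S.T112 t k 1 3 0 2 + S.T112 t k 2 3 0 1 : ℝ) : ℂ) := by
  refine hS.cumulantEq_two hgqq ht (m := 1) fun k => ?_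
  rw [← S.sum_blocks hS.zero (R := fun _ => 1) fun σ i _ _ => System.resp_rho t σ k]
  simp only [one_mul, Fin.sum_univ_six]
  push_cast
  rfl

theorem System.Regular.cumulantEq_rho_rho_rho_B (hS : S.Regular)
    (hgqq : ∀ t, S.ti ≤ t → S.gqq t S.ti = 1) (hgqp : ∀ t t', t ≤ t' → S.gqp t t' = 0)
    {t : Fin 4 → ℝ} (ht : ∀ s, S.ti ≤ t s) :
    S.CumulantEq 3 2 ![FieldType.rho, FieldType.rho, FieldType.rho, FieldType.B] t fun k =>
      Complex.I * ((inner ℝ (k 3) (k 2) * S.gqp (t 2) (t 3) * S.T112 t k 0 1 2 3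
        + inner ℝ (k 3) (k 1) * S.gqp (t 1) (t 3) * S.T112 t k 0 2 1 3
        + inner ℝ (k 3) (k 0) * S.gqp (t 0) (t 3) * S.T112 t k 1 2 0 3 : ℝ) : ℂ) := by
  refine hS.cumulantEq_two hgqq ht (m := 1) fun k => ?_
  -- The blocks `0`, `1` and `3` pair the response field with field `2`, `1` and `0` respectively.
  -- In the other blocks it is alone on its particle and its factor vanishes.
  let R : Fin 6 → ℝ := ![inner ℝ (k 3) (k 2) * S.gqp (t 2) (t 3),
    inner ℝ (k 3) (k 1) * S.gqp (t 1) (t 3), 0, inner ℝ (k 3) (k 0) * S.gqp (t 0) (t 3), 0, 0]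
  rw [← S.sum_blocks hS.zero (R := fun i => Complex.I * (R i : ℂ)) ?_]
  · simp only [Fin.sum_univ_six]
    have h : ∀ i, S.blockValue t k i =
      S.T112 t k (block i 0) (block i 1) (block i 2) (block i 3) := fun _ => rfl
    simp [R, h, block]
    ring
  · intro σ i hσ hi
    obtain ⟨h01, h02, h12⟩ := block_distinct σ hσ i hi
    have h3 : S.gqp (t 3) (t 3) = 0 := hgqp _ _ le_rfl
    have hr : S.resp ![FieldType.rho, FieldType.rho, FieldType.rho, FieldType.B] t σ k
        = Complex.I * ((inner ℝ (k 3) (S.momVec t σ k (t 3) (σ 3)) : ℝ) : ℂ) := by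
      rw [System.resp, Fin.prod_univ_four]
      simp [System.oneResp]
    rw [hr, System.momVec, Fin.sum_univ_four, if_pos rfl, h3, zero_smul, add_zero]
    congr 2
    fin_cases i <;> simp [block] at hi h01 h02 h12 <;>
      simp_all [R, real_inner_smul_right, eq_comm, mul_comm]

theorem System.Regular.cumulantEq_B_B_four (hS : S.Regular)
    (hgqq : ∀ t, S.ti ≤ t → S.gqq t S.ti = 1) (hgqp : ∀ t t', t ≤ t' → S.gqp t t' = 0)
    {f : Fin 4 → FieldType} {t : Fin 4 → ℝ} (ht : ∀ s, S.ti ≤ t s)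
    (hf : ∃ s s', s ≠ s' ∧ f s = FieldType.B ∧ f s' = FieldType.B) (N : ℕ) :
    S.CumulantEq 3 N f t 0 := by
  obtain ⟨s, s', hne, hs, hs'⟩ := hf
  -- The particles carry two, one and one fields. Hence one of the two response fields is alone, or
  -- they form the shared pair.
  have hdec : ∀ σ : Fin 4 → Fin 3, Function.Surjective σ → ∀ s s', s ≠ s' →
      (∀ r, σ r = σ s → r = s) ∨ (∀ r, σ r = σ s' → r = s') ∨
        ∀ r, (σ r = σ s ∨ σ r = σ s') → r = s ∨ r = s' := by
    decide
  refine hS.cumulantEq_zero hgqq ht fun σ hσ k => ?_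
  rcases hdec σ hσ s s' hne with h | h | h
  · exact System.resp_eq_zero hgqp hs (fun r hr => by rw [h r hr]) k
  · exact System.resp_eq_zero hgqp hs' (fun r hr => by rw [h r hr]) k
  -- In a shared pair the later response field has nothing after it to respond to.
  · rcases le_total (t s) (t s') with hle | hle
    · refine System.resp_eq_zero hgqp hs' (fun r hr => ?_) k
      rcases h r (Or.inr hr) with rfl | rfl
      · exact hle
      · exact le_rfl
    · refine System.resp_eq_zero hgqp hs (fun r hr => ?_) k
      rcases h r (Or.inl hr) with rfl | rfl
      · exact le_rfl
      · exact hle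

end Values

end KFT

end

theorem mainTheorem8 (S : KFT.System)
    (hsigma : 0 < S.sigma)
    (hPint : Integrable (fun h : KFT.E3 => S.P0 ‖h‖))
    (hPzero : S.P0 0 = 0)
    (hPcont : ContinuousWithinAt S.P0 (Set.Ici 0) 0)
    (hgqq : ∀ t, S.ti ≤ t → S.gqq t S.ti = 1)
    (hgqp : ∀ t t', t ≤ t' → S.gqp t t' = 0) :
    -- the density 3-point cumulant at second order
    (∀ t : Fin 3 → ℝ, (∀ s, S.ti ≤ t s) →
      S.CumulantEq 3 2 (fun _ => KFT.FieldType.rho) t (fun k => (S.T111 t k : ℂ))) ∧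
    -- every other 3-point cumulant vanishes, to all orders
    (∀ (f : Fin 3 → KFT.FieldType) (t : Fin 3 → ℝ), (∀ s, S.ti ≤ t s) →
      (∃ s, f s = KFT.FieldType.B) → ∀ N, S.CumulantEq 3 N f t 0) ∧
    -- the density 4-point cumulant at second order
    (∀ t : Fin 4 → ℝ, (∀ s, S.ti ≤ t s) →
      S.CumulantEq 3 2 (fun _ => KFT.FieldType.rho) t (fun k =>
        ((S.T112 t k 0 1 2 3 + S.T112 t k 0 2 1 3 + S.T112 t k 0 3 1 2
          + S.T112 t k 1 2 0 3 + S.T112 t k 1 3 0 2 + S.T112 t k 2 3 0 1 : ℝ) : ℂ))) ∧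
    -- the 4-point cumulant with one response field at second order
    (∀ t : Fin 4 → ℝ, (∀ s, S.ti ≤ t s) →
      S.CumulantEq 3 2
        ![KFT.FieldType.rho, KFT.FieldType.rho, KFT.FieldType.rho, KFT.FieldType.B] t (fun k =>
        Complex.I *
        ((inner ℝ (k 3) (k 2) * S.gqp (t 2) (t 3) * S.T112 t k 0 1 2 3
          + inner ℝ (k 3) (k 1) * S.gqp (t 1) (t 3) * S.T112 t k 0 2 1 3
          + inner ℝ (k 3) (k 0) * S.gqp (t 0) (t 3) * S.T112 t k 1 2 0 3 : ℝ) : ℂ))) ∧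
    -- 4-point cumulants with at least two response fields vanish, to all orders
    (∀ (f : Fin 4 → KFT.FieldType) (t : Fin 4 → ℝ), (∀ s, S.ti ≤ t s) →
      (∃ s s', s ≠ s' ∧ f s = KFT.FieldType.B ∧ f s' = KFT.FieldType.B) →
      ∀ N, S.CumulantEq 3 N f t 0) ∧
    -- second order is the lowest order at which 3-particle cumulants can be nonzero
    (∀ (n : ℕ) (f : Fin (n + 1) → KFT.FieldType) (t : Fin (n + 1) → ℝ), (∀ s, S.ti ≤ t s) →
      ∀ N, N < 2 → S.CumulantEq 3 N f t 0) := by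
  have hS : S.Regular := ⟨hsigma, hPint, hPzero, hPcont⟩
  exact ⟨fun t ht => hS.cumulantEq_rho_three hgqq ht,
    fun f t ht hf N => hS.cumulantEq_B_three hgqq hgqp ht hf N,
    fun t ht => hS.cumulantEq_rho_four hgqq ht,
    fun t ht => hS.cumulantEq_rho_rho_rho_B hgqq hgqp ht,
    fun f t ht hf N => hS.cumulantEq_B_B_four hgqq hgqp ht hf N,
    fun n f t ht N hN => KFT.System.cumulantEq_zero_of_lt_two hgqq ht hN⟩
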